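/- **Proposition 3.2.** Let $p$ be a prime number and let $f\colon X\to Y$ be a smooth morphism of schemes of characteristic $p$ (that is, $p=0$ in $\mathcal O_Y$), with $X$ integral. Let $F_X$, $F_Y$ be the absolute Frobenius morphisms, let $X'=X\times_{Y,F_Y}Y$ be the base change of $f$ along $F_Y$, and let $F=(F_X,f)\colon X\to X'$ be the relative Frobenius morphism of $X$ over $Y$. View $F^*F_*\mathcal O_X=\mathcal O_X\otimes_{F^{-1}\mathcal O_{X'}}F^{-1}F_*\mathcal O_X$ as a sheaf of $\mathcal O_X$-algebras through the factor $\mathcal O_X$, let $I$ be the kernel of the natural homomorphism of $\mathcal O_X$-algebras $F^*F_*\mathcal O_X\to\mathcal O_X$ (the adjunction map), and let $\mathrm{Gr}(F^*F_*\mathcal O_X)=\bigoplus_{k\ge 0}I^k/I^{k+1}$. For an $\mathcal O_X$-module $E$ let $\tau(E)$ be the quotient of the symmetric algebra $\mathrm{Sym}(E)$ by the graded sheaf of ideals locally generated by the $p$-th powers $e^p\in\mathrm{Sym}^p(E)$ of all local sections $e$ of $E$. Let $\Omega_f$ be the sheaf of relative differentials of $f$. Then: 1. There is a natural isomorphism of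 $\mathcal O_X$-modules $I/I^2\cong\Omega_f$, namely one that sends the class of $1\otimes s-s\otimes 1$ to $ds$ for all local sections $s$ of $\mathcal O_X$. 2. There is a natural isomorphism of graded $\mathcal O_X$-algebras $\tau(I/I^2)\cong\mathrm{Gr}(F^*F_*\mathcal O_X)$, namely one that restricts to the identity of $I/I^2$ in degree $1$. -/

import Mathlib

open CategoryTheory Limits TopologicalSpace Opposite AlgebraicGeometry

universe u

namespace FrobDiff

noncomputable section

/-! ## The relative Frobenius morphism -/

section frobenius

/-- The ring endomorphism `a ↦ a ^ p` of a ring in which `p = 0`. -/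
def frobHom (p : ℕ) [hp : Fact p.Prime] (R : Type u) [CommRing R] (h : (p : R) = 0) : R →+* R where
  toFun a := a ^ p
  map_one' := one_pow p
  map_mul' a b := mul_pow a b p
  map_zero' := zero_pow hp.out.ne_zero
  map_add' a b := by
    obtain ⟨r, hr⟩ := exists_add_pow_prime_eq hp.out a b
    rw [hr, h, zero_mul, zero_mul, zero_mul, add_zero]

/-- A scheme `X` is of characteristic `p`, that is, a scheme over `𝔽_p`: `p = 0` in `𝒪_X`. -/
class IsOfChar (p : ℕ) (X : Scheme.{u}) : Prop where
  natCast_eq_zero : (p : Γ(X, ⊤)) = 0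

theorem IsOfChar.cast_eq_zero (p : ℕ) (X : Scheme.{u}) [IsOfChar p X] (U : X.Opens) :
    (p : Γ(X, U)) = 0 := by
  have h := congrArg (X.presheaf.map (homOfLE (le_top : U ≤ ⊤)).op).hom
    (IsOfChar.natCast_eq_zero (p := p) (X := X))
  rwa [map_natCast, map_zero] at h

theorem IsOfChar.of_hom (p : ℕ) {X Y : Scheme.{u}} (f : X ⟶ Y) [IsOfChar p Y] : IsOfChar p X where
  natCast_eq_zero := by
    have h := congrArg f.appTop.hom (IsOfChar.natCast_eq_zero (p := p) (X := Y))
    rwa [map_natCast, map_zero] at h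

variable (p : ℕ) [hp : Fact p.Prime]

/-- The `p`-th power endomorphism of the structure sheaf. -/
def frobPresheaf (X : Scheme.{u}) [IsOfChar p X] : X.presheaf ⟶ X.presheaf where
  app U := CommRingCat.ofHom (frobHom p Γ(X, U.unop) (IsOfChar.cast_eq_zero p X U.unop))
  naturality U V i := by
    ext a
    exact (map_pow (X.presheaf.map i).hom a p).symm

/-- The absolute Frobenius as a morphism of ringed spaces: the identity on the underlying space
and the `p`-th power map on functions. -/
def absFrobPre (X : Scheme.{u}) [IsOfChar p X] :
    X.toPresheafedSpace.Hom X.toPresheafedSpace where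
  base := 𝟙 _
  c := frobPresheaf p X ≫ (TopCat.Presheaf.Pushforward.id X.presheaf).inv

theorem absFrobPre_stalkMap (X : Scheme.{u}) [IsOfChar p X] (x : X)
    (a : X.presheaf.stalk x) :
    (PresheafedSpace.Hom.stalkMap (absFrobPre p X) x).hom a = (a ^ p : X.presheaf.stalk x) := by
  obtain ⟨U, hx, s, rfl⟩ := X.presheaf.exists_germ_eq a
  refine (PresheafedSpace.stalkMap_germ_apply (absFrobPre p X) U x hx s).trans ?_
  exact map_pow (X.presheaf.germ U x hx).hom s p

/-- The absolute Frobenius morphism `F_X : X ⟶ X` of a scheme of characteristic `p`. -/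
def absoluteFrobenius (X : Scheme.{u}) [IsOfChar p X] : X ⟶ X :=
  Scheme.Hom.mk
    { toHom := absFrobPre p X
      prop := fun x => ⟨fun a ha => by
        have ha' : IsUnit (M := X.presheaf.stalk x) (a ^ p : X.presheaf.stalk x) :=
          absFrobPre_stalkMap p X x a ▸ ha
        exact (isUnit_pow_iff hp.out.ne_zero).mp ha'⟩ }

theorem absoluteFrobenius_app (X : Scheme.{u}) [IsOfChar p X] (U : X.Opens) (s : Γ(X, U)) :
    (absoluteFrobenius p X).app U s = (s ^ p : Γ(X, U)) := rfl

theorem absoluteFrobenius_comp {X Y : Scheme.{u}} (f : X ⟶ Y) [IsOfChar p X] [IsOfChar p Y] :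
    absoluteFrobenius p X ≫ f = f ≫ absoluteFrobenius p Y := by
  refine Scheme.Hom.ext rfl fun U => ?_
  ext s
  change X.presheaf.map (𝟙 (op (f ⁻¹ᵁ U))) ((f.app U s) ^ p : Γ(X, f ⁻¹ᵁ U)) =
    f.app U (s ^ p : Γ(Y, U))
  rw [X.presheaf.map_id, CategoryTheory.id_apply]
  exact (map_pow (f.app U).hom s p).symm

/-- The Frobenius twist `X'`: the base change of `f : X ⟶ Y` along `F_Y : Y ⟶ Y`. -/
def frobeniusTwist {X Y : Scheme.{u}} (f : X ⟶ Y) [IsOfChar p Y] : Scheme.{u} :=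
  pullback f (absoluteFrobenius p Y)

/-- The relative Frobenius morphism `F : X ⟶ X'` of `f : X ⟶ Y`, the morphism with components
`F_X : X ⟶ X` and `f : X ⟶ Y`. -/
def relativeFrobenius {X Y : Scheme.{u}} (f : X ⟶ Y) [IsOfChar p Y] : X ⟶ frobeniusTwist p f :=
  haveI := IsOfChar.of_hom p f
  pullback.lift (absoluteFrobenius p X) f (absoluteFrobenius_comp p f)

end frobenius

/-! ## Direct and inverse images of sheaves of algebras

A sheaf of (commutative) `𝒪_X`-algebras is an object of `Under X.sheaf`: a sheaf of commutative
rings with a homomorphism from `𝒪_X`. -/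

section algebras

variable {X Y : Scheme.{u}} (g : X ⟶ Y)

instance : HasPushouts (TopCat.Sheaf CommRingCat.{u} X) :=
  inferInstanceAs (HasPushouts (CategoryTheory.Sheaf (Opens.grothendieckTopology X) CommRingCat.{u}))

/-- The homomorphism `𝒪_Y ⟶ g_* 𝒪_X`. -/
def sharp : Y.sheaf ⟶ (TopCat.Sheaf.pushforward CommRingCat.{u} g.base).obj X.sheaf := ⟨g.c⟩

/-- The inverse image functor `g⁻¹` for sheaves of rings. -/
abbrev inverseImage : TopCat.Sheaf CommRingCat.{u} Y ⥤ TopCat.Sheaf CommRingCat.{u} X :=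
  TopCat.Sheaf.pullback CommRingCat.{u} g.base

/-- The adjunction between `g⁻¹` and `g_*`. -/
abbrev inverseImageAdj :
    inverseImage g ⊣ TopCat.Sheaf.pushforward CommRingCat.{u} g.base :=
  TopCat.Sheaf.pullbackPushforwardAdjunction CommRingCat.{u} g.base

/-- The homomorphism `g⁻¹ 𝒪_Y ⟶ 𝒪_X`. -/
def invSharp : (inverseImage g).obj Y.sheaf ⟶ X.sheaf :=
  ((inverseImageAdj g).homEquiv _ _).symm (sharp g)

/-- The sheaf of `𝒪_Y`-algebras `g_* 𝒪_X`. -/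
def pushforwardStructure : Under Y.sheaf := Under.mk (sharp g)

/-- The pullback `g^* A = 𝒪_X ⊗_{g⁻¹ 𝒪_Y} g⁻¹ A` of a sheaf of `𝒪_Y`-algebras `A`; the tensor
product of sheaves of commutative rings is their pushout. The `𝒪_X`-algebra structure is the one
through the factor `𝒪_X`. -/
def pullbackAlgebra (A : Under Y.sheaf) : Under X.sheaf :=
  Under.mk (pushout.inl (invSharp g) ((inverseImage g).map A.hom))

/-- The map `A ⟶ g_* g^* A`, `a ↦ 1 ⊗ a`. -/
def pullbackSection (A : Under Y.sheaf) :
    A.right ⟶ (TopCat.Sheaf.pushforward CommRingCat.{u} g.base).obj (pullbackAlgebra g A).right :=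
  (inverseImageAdj g).homEquiv _ _ (pushout.inr (invSharp g) ((inverseImage g).map A.hom))

/-- The sheaf of `𝒪_X`-algebras `g^* g_* 𝒪_X`. -/
abbrev pullPush : Under X.sheaf := pullbackAlgebra g (pushforwardStructure g)

/-- The natural homomorphism of `𝒪_X`-algebras `g^* g_* 𝒪_X ⟶ 𝒪_X`: the identity on the factor
`𝒪_X` and the adjunction map `g⁻¹ g_* 𝒪_X ⟶ 𝒪_X` on the other factor. -/
def counitAlgebra : pullPush g ⟶ Under.mk (𝟙 X.sheaf) :=
  Under.homMk (pushout.desc (𝟙 _) ((inverseImageAdj g).counit.app X.sheaf)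
    (by rw [Category.comp_id]; exact Adjunction.homEquiv_counit ..)) (pushout.inl_desc ..)

theorem counitAlgebra_pullbackSection :
    pullbackSection g (pushforwardStructure g) ≫
      (TopCat.Sheaf.pushforward CommRingCat.{u} g.base).map (counitAlgebra g).right = 𝟙 _ := by
  refine ((inverseImageAdj g).homEquiv_naturality_right
    (pushout.inr (invSharp g) ((inverseImage g).map (pushforwardStructure g).hom))
    (counitAlgebra g).right).symm.trans ?_
  have h : pushout.inr (invSharp g) ((inverseImage g).map (pushforwardStructure g).hom) ≫
      (counitAlgebra g).right = (inverseImageAdj g).counit.app X.sheaf := pushout.inr_desc ..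
  refine (congrArg ((inverseImageAdj g).homEquiv _ _) h).trans ?_
  exact ((inverseImageAdj g).homEquiv_unit _ _ _).trans
    ((inverseImageAdj g).right_triangle_components X.sheaf)

end algebras

/-! ## Commutative algebra: associated graded rings and truncated symmetric algebras -/

section rings

variable {A B : Type u} [CommRing A] [CommRing B]

/-- The ideal `⨁ₖ Iᵏ⁺¹ tᵏ` of the Rees algebra `⨁ₖ Iᵏ tᵏ ⊆ A[t]`. -/
def grKer (I : Ideal A) : Ideal (reesAlgebra I) where
  carrier := {f | ∀ k, (f : Polynomial A).coeff k ∈ I ^ (k + 1)}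
  zero_mem' k := by simp
  add_mem' hf hg k := by
    simpa using add_mem (hf k) (hg k)
  smul_mem' c f hf k := by
    rw [smul_eq_mul, Subalgebra.coe_mul, Polynomial.coeff_mul]
    refine Ideal.sum_mem _ fun ij hij => ?_
    have h : ij.1 + ij.2 = k := Finset.HasAntidiagonal.mem_antidiagonal.mp hij
    rw [← h, add_assoc, pow_add]
    exact Ideal.mul_mem_mul (c.2 ij.1) (hf ij.2)

/-- The associated graded ring `⨁ₖ Iᵏ / Iᵏ⁺¹`. -/
abbrev Gr (I : Ideal A) : Type u := reesAlgebra I ⧸ grKer I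

/-- The class in `Iᵏ / Iᵏ⁺¹` of an element of `Iᵏ`. -/
def Gr.mk (I : Ideal A) (k : ℕ) (a : A) (ha : a ∈ I ^ k) : Gr I :=
  Ideal.Quotient.mk (grKer I) ⟨Polynomial.monomial k a, reesAlgebra.monomial_mem.mpr ha⟩

/-- The `k`-th graded piece `Iᵏ / Iᵏ⁺¹` of the associated graded ring. -/
def Gr.piece (I : Ideal A) (k : ℕ) : Set (Gr I) := {z | ∃ a ha, Gr.mk I k a ha = z}

/-- The homomorphism of Rees algebras induced by a ring homomorphism. -/
def reesMap (φ : A →+* B) {I : Ideal A} {J : Ideal B} (h : I ≤ J.comap φ) :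
    reesAlgebra I →+* reesAlgebra J :=
  ((Polynomial.mapRingHom φ).comp (reesAlgebra I).val.toRingHom).codRestrict (reesAlgebra J)
    fun f k => by
      have h1 := Ideal.mem_map_of_mem φ (f.2 k)
      rw [Ideal.map_pow] at h1
      simpa using! Ideal.pow_right_mono (Ideal.map_le_iff_le_comap.mpr h) k h1

/-- The homomorphism of associated graded rings induced by a ring homomorphism. -/
def Gr.map (φ : A →+* B) {I : Ideal A} {J : Ideal B} (h : I ≤ J.comap φ) : Gr I →+* Gr J :=
  Ideal.quotientMap (grKer J) (reesMap φ h) fun f hf k => by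
    have h1 := Ideal.mem_map_of_mem φ (hf k)
    rw [Ideal.map_pow] at h1
    simpa [reesMap] using! Ideal.pow_right_mono (Ideal.map_le_iff_le_comap.mpr h) (k + 1) h1

theorem Gr.map_mk (φ : A →+* B) {I : Ideal A} {J : Ideal B} (h : I ≤ J.comap φ) (k : ℕ) (a : A)
    (ha : a ∈ I ^ k) (hb : φ a ∈ J ^ k) : Gr.map φ h (Gr.mk I k a ha) = Gr.mk J k (φ a) hb := by
  refine congrArg (Ideal.Quotient.mk (grKer J)) (Subtype.ext ?_)
  exact Polynomial.map_monomial φ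

theorem Gr.map_id (I : Ideal A) (h : I ≤ I.comap (RingHom.id A)) :
    Gr.map (RingHom.id A) h = RingHom.id _ := by
  refine Ideal.Quotient.ringHom_ext (RingHom.ext fun f => ?_)
  refine congrArg (Ideal.Quotient.mk (grKer I)) (Subtype.ext ?_)
  exact Polynomial.map_id

theorem Gr.map_comp {C : Type u} [CommRing C] (φ : A →+* B) (ψ : B →+* C) {I : Ideal A}
    {J : Ideal B} {K : Ideal C} (h : I ≤ J.comap φ) (h' : J ≤ K.comap ψ)
    (h'' : I ≤ K.comap (ψ.comp φ)) :
    Gr.map (ψ.comp φ) h'' = (Gr.map ψ h').comp (Gr.map φ h) := by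
  refine Ideal.Quotient.ringHom_ext (RingHom.ext fun f => ?_)
  refine congrArg (Ideal.Quotient.mk (grKer K)) (Subtype.ext ?_)
  exact (Polynomial.map_map φ ψ f.1).symm

/-- The map `I / I² → J / J²` induced by a ring homomorphism. -/
def cotangentMap (φ : A →+* B) {I : Ideal A} {J : Ideal B} (h : I ≤ J.comap φ) :
    I.Cotangent →+ J.Cotangent :=
  (Ideal.mapCotangent I J φ.toIntAlgHom h).toAddMonoidHom

theorem cotangentMap_toCotangent (φ : A →+* B) {I : Ideal A} {J : Ideal B} (h : I ≤ J.comap φ)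
    (z : I) : cotangentMap φ h (I.toCotangent z) = J.toCotangent ⟨φ z, h z.2⟩ := rfl

theorem cotangentMap_smul (φ : A →+* B) {I : Ideal A} {J : Ideal B} (h : I ≤ J.comap φ)
    (a : A) (z : I.Cotangent) : cotangentMap φ h (a • z) = φ a • cotangentMap φ h z := by
  obtain ⟨z, rfl⟩ := I.toCotangent_surjective z
  rw [← map_smul, cotangentMap_toCotangent, cotangentMap_toCotangent, ← map_smul]
  exact congrArg J.toCotangent (Subtype.ext (map_mul φ a z))

variable {M N : Type u} [AddCommGroup M] [Module A M] [AddCommGroup N] [Module B N]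

/-- The ideal of the symmetric algebra of `M` generated by the elements `m ^ p` for `m` in `M`. -/
def tauKer (p : ℕ) (A M : Type u) [CommRing A] [AddCommGroup M] [Module A M] :
    Ideal (SymmetricAlgebra A M) :=
  Ideal.span (Set.range fun m : M => SymmetricAlgebra.ι A M m ^ p)

/-- The algebra `Sym(M) / (m ^ p : m ∈ M)`. -/
abbrev Tau (p : ℕ) (A M : Type u) [CommRing A] [AddCommGroup M] [Module A M] : Type u :=
  SymmetricAlgebra A M ⧸ tauKer p A M

/-- The natural map from `M` to `Sym(M) / (m ^ p : m ∈ M)`. -/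
def Tau.ι (p : ℕ) (A M : Type u) [CommRing A] [AddCommGroup M] [Module A M] : M →ₗ[A] Tau p A M :=
  (Ideal.Quotient.mkₐ A (tauKer p A M)).toLinearMap.comp (SymmetricAlgebra.ι A M)

/-- The `k`-th graded piece of `Sym(M) / (m ^ p : m ∈ M)`, the image of `Symᵏ(M)`: it is spanned
by the products of `k` elements of `M`. -/
def Tau.piece (p : ℕ) (A M : Type u) [CommRing A] [AddCommGroup M] [Module A M] (k : ℕ) :
    Submodule A (Tau p A M) :=
  LinearMap.range (Tau.ι p A M) ^ k

/-- The homomorphism of symmetric algebras induced by a semilinear map. -/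
def symMap (φ : A →+* B) (l : M →ₛₗ[φ] N) : SymmetricAlgebra A M →+* SymmetricAlgebra B N :=
  letI : Algebra A (SymmetricAlgebra B N) := ((algebraMap B _).comp φ).toAlgebra
  (SymmetricAlgebra.lift (R := A) (A := SymmetricAlgebra B N)
    { toFun := fun m => SymmetricAlgebra.ι B N (l m)
      map_add' := by simp
      map_smul' := fun a m => by
        rw [l.map_smulₛₗ, map_smul, Algebra.smul_def, Algebra.smul_def]; rfl } : _ →ₐ[A] _).toRingHom

theorem symMap_ι (φ : A →+* B) (l : M →ₛₗ[φ] N) (m : M) :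
    symMap φ l (SymmetricAlgebra.ι A M m) = SymmetricAlgebra.ι B N (l m) := by
  let _ : Algebra A (SymmetricAlgebra B N) := ((algebraMap B _).comp φ).toAlgebra
  exact SymmetricAlgebra.lift_ι_apply (A := SymmetricAlgebra B N) _ m

theorem symMap_algebraMap (φ : A →+* B) (l : M →ₛₗ[φ] N) (a : A) :
    symMap φ l (algebraMap A _ a) = algebraMap B _ (φ a) := by
  let _ : Algebra A (SymmetricAlgebra B N) := ((algebraMap B _).comp φ).toAlgebra
  exact AlgHom.commutes (SymmetricAlgebra.lift (R := A) (A := SymmetricAlgebra B N) _) a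

theorem sym_ringHom_ext {C : Type u} [CommRing C] {f g : SymmetricAlgebra A M →+* C}
    (h : ∀ a : A, f (algebraMap A _ a) = g (algebraMap A _ a))
    (h' : ∀ m : M, f (SymmetricAlgebra.ι A M m) = g (SymmetricAlgebra.ι A M m)) : f = g := by
  refine RingHom.ext fun x => ?_
  induction x using SymmetricAlgebra.induction with
  | algebraMap r => exact h r
  | ι x => exact h' x
  | mul a b ha hb => rw [map_mul, map_mul, ha, hb]
  | add a b ha hb => rw [map_add, map_add, ha, hb]

/-- The homomorphism of the algebras `Sym / (p-th powers)` induced by a semilinear map. -/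
def Tau.map (p : ℕ) (φ : A →+* B) (l : M →ₛₗ[φ] N) : Tau p A M →+* Tau p B N :=
  Ideal.quotientMap (tauKer p B N) (symMap φ l) (by
    refine Ideal.span_le.mpr ?_
    rintro _ ⟨m, rfl⟩
    change symMap φ l (SymmetricAlgebra.ι A M m ^ p) ∈ tauKer p B N
    rw [map_pow, symMap_ι]
    exact Ideal.subset_span ⟨l m, rfl⟩)

theorem Tau.map_ι (p : ℕ) (φ : A →+* B) (l : M →ₛₗ[φ] N) (m : M) :
    Tau.map p φ l (Tau.ι p A M m) = Tau.ι p B N (l m) :=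
  congrArg (Ideal.Quotient.mk (tauKer p B N)) (symMap_ι φ l m)

theorem Tau.map_algebraMap (p : ℕ) (φ : A →+* B) (l : M →ₛₗ[φ] N) (a : A) :
    Tau.map p φ l (algebraMap A _ a) = algebraMap B _ (φ a) :=
  congrArg (Ideal.Quotient.mk (tauKer p B N)) (symMap_algebraMap φ l a)

theorem Tau.ringHom_ext (p : ℕ) {C : Type u} [CommRing C] {f g : Tau p A M →+* C}
    (h : ∀ a : A, f (algebraMap A _ a) = g (algebraMap A _ a))
    (h' : ∀ m : M, f (Tau.ι p A M m) = g (Tau.ι p A M m)) : f = g :=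
  Ideal.Quotient.ringHom_ext (sym_ringHom_ext h h')

end rings

/-! ## Sheafification -/

section sheafification

variable {X : Scheme.{u}}

/-- The sheaf of `𝒪_X`-algebras associated with a presheaf of `𝒪_X`-algebras. -/
def sheafifyAlgebra (B : Under X.presheaf) : Under X.sheaf :=
  Under.mk (Y := (presheafToSheaf (Opens.grothendieckTopology X) CommRingCat.{u}).obj B.right)
    ⟨B.hom ≫ toSheafify (Opens.grothendieckTopology X) B.right⟩

/-- The natural map from a presheaf of algebras to the associated sheaf. -/
def toSheafifyAlgebra (B : Under X.presheaf) (U : X.Opens) :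
    B.right.obj (op U) ⟶ (sheafifyAlgebra B).right.obj.obj (op U) :=
  (toSheafify (Opens.grothendieckTopology X) B.right).app (op U)

/-- For subsets `S U` of the rings `B(U)`, the sections of the sheaf associated with `B` that
locally come from elements of these subsets. If the `S U` are the degree `k` parts of a
presheaf of graded algebras `B`, then this is the degree `k` part of the associated sheaf of
graded algebras. -/
def localImage (B : Under X.presheaf) (S : ∀ U : X.Opens, Set (B.right.obj (op U)))
    (U : X.Opens) : Set ((sheafifyAlgebra B).right.obj.obj (op U)) :=
  {s | ∀ x ∈ U, ∃ (V : X.Opens) (hV : V ≤ U), x ∈ V ∧ ∃ b ∈ S V,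
    toSheafifyAlgebra B V b = (sheafifyAlgebra B).right.obj.map (homOfLE hV).op s}

/-- The sheaf of `𝒪_X`-modules associated with a presheaf of `𝒪_X`-modules. -/
def sheafifyModule (M : X.PresheafOfModules) : X.Modules :=
  (PresheafOfModules.sheafification (𝟙 X.ringCatSheaf.obj)).obj M

/-- The natural map from a presheaf of modules to the associated sheaf. -/
def toSheafifyModule (M : X.PresheafOfModules) (U : X.Opens) :
    M.presheaf.obj (op U) ⟶ (sheafifyModule M).presheaf.obj (op U) :=
  (toSheafify (Opens.grothendieckTopology X) M.presheaf).app (op U)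

end sheafification

/-! ## Relative differentials -/

section differentials

variable {X Y : Scheme.{u}} (f : X ⟶ Y)

/-- The presheaf of relative differentials `U ↦ Ω_{𝒪_X(U) / (f⁻¹ 𝒪_Y)(U)}`. -/
def preOmega : X.PresheafOfModules :=
  PresheafOfModules.DifferentialsConstruction.relativeDifferentials'
    (S' := ((inverseImage f).obj Y.sheaf).obj) (R := X.presheaf) (invSharp f).hom

/-- The sheaf of relative differentials `Ω_f`. -/
def Omega : X.Modules := sheafifyModule (preOmega f)

/-- The universal derivation `d : 𝒪_X ⟶ Ω_f`. -/
def omegaD (U : X.Opens) (s : Γ(X, U)) : Γ(Omega f, U) :=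
  toSheafifyModule (preOmega f) U
    (CommRingCat.KaehlerDifferential.d (f := (invSharp f).hom.app (op U)) s)

end differentials

/-! ## The kernel of an augmentation, its conormal sheaf and associated graded algebra -/

section augmented

variable {X : Scheme.{u}} {A : Under X.sheaf} (ε : A ⟶ Under.mk (𝟙 X.sheaf))

/-- The sheaf of ideals `I = ker (ε : A ⟶ 𝒪_X)`. -/
def augIdeal (U : (Opens X)ᵒᵖ) : Ideal (A.right.obj.obj U) :=
  RingHom.ker (ε.right.hom.app U).hom

theorem augIdeal_le {U V : (Opens X)ᵒᵖ} (i : U ⟶ V) :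
    augIdeal ε U ≤ (augIdeal ε V).comap (A.right.obj.map i).hom := by
  intro z hz
  have h := congrArg (fun q => q.hom z) (ε.right.hom.naturality i)
  have hz' : (ε.right.hom.app U).hom z = 0 := hz
  change (ε.right.hom.app V).hom ((A.right.obj.map i).hom z) = 0
  refine h.trans ?_
  change ((Under.mk (𝟙 X.sheaf)).right.obj.map i).hom ((ε.right.hom.app U).hom z) = 0
  rw [hz', map_zero]

/-- The presheaf of abelian groups `U ↦ I(U) / I(U)²`. -/
def preConormalAb : TopCat.Presheaf Ab.{u} X where
  obj U := AddCommGrpCat.of (augIdeal ε U).Cotangent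
  map i := AddCommGrpCat.ofHom (cotangentMap (A.right.obj.map i).hom (augIdeal_le ε i))
  map_id U := by
    ext z
    obtain ⟨z, rfl⟩ := (augIdeal ε U).toCotangent_surjective z
    refine congrArg (augIdeal ε U).toCotangent (Subtype.ext ?_)
    exact congrArg (fun q => q.hom z.1) (A.right.obj.map_id U)
  map_comp {U V W} i j := by
    ext z
    obtain ⟨z, rfl⟩ := (augIdeal ε U).toCotangent_surjective z
    refine congrArg (augIdeal ε W).toCotangent (Subtype.ext ?_)
    exact congrArg (fun q => q.hom z.1) (A.right.obj.map_comp i j)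

/-- `I(U) / I(U)²` is an `𝒪_X(U)`-module through `𝒪_X(U) ⟶ A(U)`. -/
instance preConormalModule (U : (Opens X)ᵒᵖ) :
    Module (X.ringCatSheaf.obj.obj U) ((preConormalAb ε).obj U) :=
  Module.compHom (R := A.right.obj.obj U) (augIdeal ε U).Cotangent (A.hom.hom.app U).hom

/-- The presheaf of `𝒪_X`-modules `U ↦ I(U) / I(U)²`. -/
def preConormal : X.PresheafOfModules :=
  PresheafOfModules.ofPresheaf (preConormalAb ε) fun U V i r z => by
    refine (cotangentMap_smul (A.right.obj.map i).hom (augIdeal_le ε i)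
      ((A.hom.hom.app U).hom r) z).trans ?_
    exact congrArg (fun q : A.right.obj.obj V =>
        q • cotangentMap (A.right.obj.map i).hom (augIdeal_le ε i) z)
      (congrArg (fun q => q.hom r) (A.hom.hom.naturality i)).symm

/-- The sheaf of `𝒪_X`-modules `I / I²`. -/
def conormal : X.Modules := sheafifyModule (preConormal ε)

/-- The class in `I / I²` of a section of `I`. -/
def conormalMk (U : X.Opens) (z : augIdeal ε (op U)) : Γ(conormal ε, U) :=
  toSheafifyModule (preConormal ε) U ((augIdeal ε (op U)).toCotangent z)

/-- The presheaf of `𝒪_X`-algebras `U ↦ ⨁ₖ I(U)ᵏ / I(U)ᵏ⁺¹`. -/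
def preGr : Under X.presheaf :=
  Under.mk (Y := (show TopCat.Presheaf CommRingCat.{u} X from
    { obj := fun U => CommRingCat.of (Gr (augIdeal ε U))
      map := fun i => CommRingCat.ofHom (Gr.map (A.right.obj.map i).hom (augIdeal_le ε i))
      map_id := fun U => by
        have h : ∀ (φ : A.right.obj.obj U →+* A.right.obj.obj U) (_ : φ = RingHom.id _)
            (hle : augIdeal ε U ≤ (augIdeal ε U).comap φ), Gr.map φ hle = RingHom.id _ := by
          rintro _ rfl hle
          exact Gr.map_id _ hle
        exact congrArg CommRingCat.ofHom
          (h _ (congrArg CommRingCat.Hom.hom (A.right.obj.map_id U)) _)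
      map_comp := fun {U V W} i j => by
        have h : ∀ (φ : A.right.obj.obj U →+* A.right.obj.obj W)
            (_ : φ = (A.right.obj.map j).hom.comp (A.right.obj.map i).hom)
            (hle : augIdeal ε U ≤ (augIdeal ε W).comap φ), Gr.map φ hle =
              (Gr.map (A.right.obj.map j).hom (augIdeal_le ε j)).comp
                (Gr.map (A.right.obj.map i).hom (augIdeal_le ε i)) := by
          rintro _ rfl hle
          exact Gr.map_comp _ _ _ _ hle
        exact congrArg CommRingCat.ofHom
          (h _ (congrArg CommRingCat.Hom.hom (A.right.obj.map_comp i j)) _) }))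
    { app := fun U => CommRingCat.ofHom
        ((algebraMap (A.right.obj.obj U) (Gr (augIdeal ε U))).comp (A.hom.hom.app U).hom)
      naturality := fun U V i => by
        ext r
        refine (congrArg (algebraMap (A.right.obj.obj V) (Gr (augIdeal ε V)))
          (congrArg (fun q => q.hom r) (A.hom.hom.naturality i))).trans ?_
        refine congrArg (Ideal.Quotient.mk (grKer (augIdeal ε V))) (Subtype.ext ?_)
        exact (Polynomial.map_C (A.right.obj.map i).hom).symm }

/-- The sheaf of `𝒪_X`-algebras `Gr(A) = ⨁ₖ Iᵏ / Iᵏ⁺¹`. -/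
def grSheaf : Under X.sheaf := sheafifyAlgebra (preGr ε)

/-- The degree `k` part `Iᵏ / Iᵏ⁺¹` of `Gr(A)`. -/
def grPiece (k : ℕ) (U : X.Opens) : Set ((grSheaf ε).right.obj.obj (op U)) :=
  localImage (preGr ε) (fun V => Gr.piece (augIdeal ε (op V)) k) U

/-- The class in degree `1` of `Gr(A)` of a section of `I`. -/
def grMkOne (U : X.Opens) (z : augIdeal ε (op U)) : (grSheaf ε).right.obj.obj (op U) :=
  toSheafifyAlgebra (preGr ε) U
    (Gr.mk (augIdeal ε (op U)) 1 z.1 ((pow_one (augIdeal ε (op U))).symm ▸ z.2))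

end augmented

/-! ## The algebra `τ(E)` -/

section tau

variable (p : ℕ) {X : Scheme.{u}} (E : X.Modules)

/-- The restriction maps of the structure sheaf. -/
def resHom {U V : (Opens X)ᵒᵖ} (i : U ⟶ V) : Γ(X, U.unop) →+* Γ(X, V.unop) :=
  (X.presheaf.map i).hom

/-- The restriction maps of a sheaf of modules, as semilinear maps. -/
def resMap {U V : (Opens X)ᵒᵖ} (i : U ⟶ V) :
    Γ(E, U.unop) →ₛₗ[resHom i] Γ(E, V.unop) where
  toFun := E.presheaf.map i
  map_add' := map_add _
  map_smul' r m := Scheme.Modules.map_smul E i.unop r m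

/-- The presheaf of `𝒪_X`-algebras `U ↦ Sym(E(U)) / (e ^ p : e ∈ E(U))`. -/
def preTau : Under X.presheaf :=
  Under.mk (Y := (show TopCat.Presheaf CommRingCat.{u} X from
    { obj := fun U => CommRingCat.of (Tau p Γ(X, U.unop) Γ(E, U.unop))
      map := fun i => CommRingCat.ofHom (Tau.map p (resHom i) (resMap E i))
      map_id := fun U => by
        ext1
        refine Tau.ringHom_ext p (fun a => ?_) (fun m => ?_)
        · refine (Tau.map_algebraMap p _ (resMap E (𝟙 U)) a).trans ?_
          exact congrArg (algebraMap Γ(X, U.unop) _)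
            (congrArg (fun q => q.hom a) (X.presheaf.map_id U))
        · refine (Tau.map_ι p _ (resMap E (𝟙 U)) m).trans ?_
          exact congrArg (Tau.ι p _ _) (congrArg (fun q => q.hom m) (E.presheaf.map_id U))
      map_comp := fun {U V W} i j => by
        ext1
        refine Tau.ringHom_ext p (fun a => ?_) (fun m => ?_)
        · refine (Tau.map_algebraMap p _ (resMap E (i ≫ j)) a).trans ?_
          refine Eq.trans ?_ (congrArg (Tau.map p _ (resMap E j))
            (Tau.map_algebraMap p _ (resMap E i) a)).symm
          refine Eq.trans ?_ (Tau.map_algebraMap p _ (resMap E j) _).symm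
          exact congrArg (algebraMap Γ(X, W.unop) _)
            (congrArg (fun q => q.hom a) (X.presheaf.map_comp i j))
        · refine (Tau.map_ι p _ (resMap E (i ≫ j)) m).trans ?_
          refine Eq.trans ?_ (congrArg (Tau.map p _ (resMap E j))
            (Tau.map_ι p _ (resMap E i) m)).symm
          refine Eq.trans ?_ (Tau.map_ι p _ (resMap E j) _).symm
          exact congrArg (Tau.ι p _ _) (congrArg (fun q => q.hom m) (E.presheaf.map_comp i j)) }))
    { app := fun U => CommRingCat.ofHom (algebraMap Γ(X, U.unop) (Tau p Γ(X, U.unop) Γ(E, U.unop)))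
      naturality := fun U V i => by
        ext a
        exact (Tau.map_algebraMap p _ (resMap E i) a).symm }

/-- The sheaf of `𝒪_X`-algebras `τ(E) = Sym(E) / J_E`, where `J_E` is the sheaf of ideals locally
generated by the sections `e ^ p` for all sections `e` of `E`. -/
def tauSheaf : Under X.sheaf := sheafifyAlgebra (preTau p E)

/-- The degree `k` part of `τ(E)`, the image of `Symᵏ(E)`. -/
def tauPiece (k : ℕ) (U : X.Opens) : Set ((tauSheaf p E).right.obj.obj (op U)) :=
  localImage (preTau p E)
    (fun V => ((Tau.piece p Γ(X, V) Γ(E, V) k : Submodule _ _) : Set (Tau p Γ(X, V) Γ(E, V)))) U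

/-- The natural map `E ⟶ τ(E)` onto the degree `1` part. -/
def tauι (U : X.Opens) (e : Γ(E, U)) : (tauSheaf p E).right.obj.obj (op U) :=
  toSheafifyAlgebra (preTau p E) U (Tau.ι p Γ(X, U) Γ(E, U) e)

end tau

/-! ## The algebra `g^* g_* 𝒪_X` -/

section pullPush

variable {X Y : Scheme.{u}} (g : X ⟶ Y)

/-- For `s ∈ 𝒪_X(U)`, the section `s ⊗ 1` of `g^* g_* 𝒪_X`, the image of `s` under the
`𝒪_X`-algebra structure. -/
def sectionLeft (U : X.Opens) (s : Γ(X, U)) : (pullPush g).right.obj.obj (op U) :=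
  (pullPush g).hom.hom.app (op U) s

/-- For `s ∈ 𝒪_X(g⁻¹(V)) = (g_* 𝒪_X)(V)`, the section `1 ⊗ s` of `g^* g_* 𝒪_X`, the image of `s`
under `g_* 𝒪_X ⟶ g_* g^* g_* 𝒪_X`. -/
def sectionRight (V : Y.Opens) (s : Γ(X, g ⁻¹ᵁ V)) : (pullPush g).right.obj.obj (op (g ⁻¹ᵁ V)) :=
  (pullbackSection g (pushforwardStructure g)).hom.app (op V) s

/-- For `s ∈ 𝒪_X(g⁻¹(V))`, the section `1 ⊗ s - s ⊗ 1` of the kernel of `g^* g_* 𝒪_X ⟶ 𝒪_X`. -/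
def diagSection (V : Y.Opens) (s : Γ(X, g ⁻¹ᵁ V)) :
    augIdeal (counitAlgebra g) (op (g ⁻¹ᵁ V)) :=
  ⟨sectionRight g V s - sectionLeft g (g ⁻¹ᵁ V) s, by
    have h1 := congrArg (fun q => (q.hom.app (op V)).hom s) (counitAlgebra_pullbackSection g)
    have h2 := congrArg (fun q => (q.hom.app (op (g ⁻¹ᵁ V))).hom s) (Under.w (counitAlgebra g))
    exact (map_sub ((counitAlgebra g).right.hom.app (op (g ⁻¹ᵁ V))).hom _ _).trans
      (sub_eq_zero.mpr (h1.trans h2.symm))⟩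

end pullPush

/-- The homomorphism `F^* F_* 𝒪_X ⟶ 𝒪_X` for the relative Frobenius `F` of `f`. -/
abbrev frobCounit (p : ℕ) [Fact p.Prime] {X Y : Scheme.{u}} (f : X ⟶ Y) [IsOfChar p Y] :
    pullPush (relativeFrobenius p f) ⟶ Under.mk (𝟙 X.sheaf) :=
  counitAlgebra (relativeFrobenius p f)

end

end FrobDiff

open FrobDiff

namespace FrobDiff

noncomputable section

/-! ### Truncated symmetric algebras -/

section tauAlgebra

variable {A M : Type u} [CommRing A] [AddCommGroup M] [Module A M] (p : ℕ)

/-! Write `F` for the relative Frobenius. Followed by the projection to `X` it is the absolute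
Frobenius, which is the identity on points. So `F` is inducing, `F⁻¹F_*𝒪_X = 𝒪_X`, and `F^*F_*𝒪_X`
is the pushout of two copies of `𝒪_X` over `F⁻¹𝒪_{X'}`. At a point `x` put `R = 𝒪_{X,x}` and `S =
𝒪_{Y,f(x)}`. Two homomorphisms out of `R` agree on the local ring of `X'` exactly when they agree on
`S` and on `p`-th powers of elements of `R`, so the stalk is `A = R ⊗ R` over `S[Rᵖ]`. Only its
universal property `IsFrobPushout` is used, with `l s = s ⊗ 1` and `r s = 1 ⊗ s`
(`exists_right_relativeFrobenius`).

The kernel `I` of `A → R` is generated by the differences `r s - l s`. In characteristic `p` an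
`S`-derivation kills all `p`-th powers, so the classical argument for `R ⊗_S R` still applies: a
derivation into `N` is a homomorphism from `A` to the square-zero extension `R ⊕ N`, and `I / I²` is
the module of differentials (`exists_omega_iso_conormal`).

The `p`-th power of `r s - l s` is zero, so Frobenius kills `I`, and the inclusion of `I / I²` in
`Gr` extends to `τ(I / I²) → Gr` (`exists_tauSheaf_to_grSheaf`). It is surjective because `Iᵏ` is
generated by products of `k` elements of `I`.

Injectivity is the real content, and there smoothness enters (`exists_ringHom_truncation`,
`injective_of_isTruncatedGraded`). Let `T` be the algebra `τ` of the stalk of `I / I²`, let `P` be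
its ideal generated in degree one, and let `J` be the image of `P` in `B = T / Pᴺ`. The map `s ↦ s +
[r s - l s]` is a homomorphism `R → B / J²` over `S`. Since `J²` is nilpotent, formal smoothness
lifts it to `w : R → B`. Elements of `J` have vanishing `p`-th power, so `w` and the structure map
`R → B` have the same `p`-th powers, and together they define `ψ : A → B` with `ψ z ≡ [z]` modulo
`J²` for `z` in `I`. The map that `ψ` induces on graded rings detects the image of `T` in degrees
below `N`. Neither coordinates nor a basis of the differentials is needed. -/

theorem Tau.ι_pow (m : M) : Tau.ι p A M m ^ p = 0 :=
  (map_pow (Ideal.Quotient.mk (tauKer p A M)) (SymmetricAlgebra.ι A M m) p).symm.trans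
    (Ideal.Quotient.eq_zero_iff_mem.mpr (Ideal.subset_span ⟨m, rfl⟩))

theorem Tau.ι_smul (a : A) (m : M) :
    Tau.ι p A M (a • m) = algebraMap A _ a * Tau.ι p A M m := by
  refine (congrArg (Ideal.Quotient.mk (tauKer p A M))
    ((map_smul (SymmetricAlgebra.ι A M) a m).trans (Algebra.smul_def a _))).trans ?_
  exact map_mul (Ideal.Quotient.mk (tauKer p A M)) _ _

theorem Tau.induction {motive : Tau p A M → Prop}
    (algebraMap : ∀ a : A, motive (algebraMap A _ a)) (ι : ∀ m, motive (Tau.ι p A M m))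
    (mul : ∀ x y, motive x → motive y → motive (x * y))
    (add : ∀ x y, motive x → motive y → motive (x + y)) (x : Tau p A M) : motive x := by
  obtain ⟨x, rfl⟩ := Ideal.Quotient.mk_surjective x
  induction x using SymmetricAlgebra.induction with
  | algebraMap r => exact algebraMap r
  | ι x => exact ι x
  | mul a b ha hb => rw [map_mul]; exact mul _ _ ha hb
  | add a b ha hb => rw [map_add]; exact add _ _ ha hb

variable {C : Type u} [CommRing C] (φ : A →+* C) (l : M →+ C)
  (hl : ∀ a m, l (a • m) = φ a * l m) (hp : ∀ m, l m ^ p = 0)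

/-- The universal property of `Sym(M) / (m ^ p)`. -/
def Tau.lift : Tau p A M →+* C :=
  letI : Algebra A C := φ.toAlgebra
  Ideal.Quotient.lift (tauKer p A M)
    (SymmetricAlgebra.lift (R := A) (A := C)
      { toFun := l, map_add' := map_add l, map_smul' := hl } : _ →ₐ[A] _).toRingHom (by
    intro a ha
    refine (Ideal.span_le (I := RingHom.ker _)).mpr ?_ ha
    rintro _ ⟨m, rfl⟩
    refine (map_pow (SymmetricAlgebra.lift (R := A) (A := C) _) _ p).trans ?_
    rw [SymmetricAlgebra.lift_ι_apply]
    exact hp m)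

theorem Tau.lift_ι (m : M) : Tau.lift p φ l hl hp (Tau.ι p A M m) = l m := by
  let _ : Algebra A C := φ.toAlgebra
  exact SymmetricAlgebra.lift_ι_apply (A := C) _ m

theorem Tau.lift_algebraMap (a : A) : Tau.lift p φ l hl hp (algebraMap A _ a) = φ a := by
  let _ : Algebra A C := φ.toAlgebra
  exact AlgHom.commutes (SymmetricAlgebra.lift (R := A) (A := C) _) a

end tauAlgebra

/-! ### Gradings encoded by homomorphisms to a polynomial ring. -/

section tauGrading

variable {R M T : Type u} [CommRing R] [AddCommGroup M] [Module R M] [CommRing T] (p : ℕ)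

/-- The ring `T` is generated by the image of `a : R → T` and the image of `ι : M → T`, is graded
with `R` in degree `0` and `M` in degree `1`, and the `p`-th powers of elements of `M` vanish.
The grading is given by the homomorphism `x ↦ ∑ₖ xₖ tᵏ` to the polynomial ring. -/
structure IsTruncatedGraded (a : R →+* T) (ι : M →+ T) (c : T →+* Polynomial T) : Prop where
  ι_smul : ∀ r m, ι (r • m) = a r * ι m
  ι_pow : ∀ m, ι m ^ p = 0
  induction : ∀ {motive : T → Prop} (_ : ∀ r, motive (a r)) (_ : ∀ m, motive (ι m))
    (_ : ∀ x y, motive x → motive y → motive (x * y))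
    (_ : ∀ x y, motive x → motive y → motive (x + y)) (x : T), motive x
  grading_algebraMap : ∀ r, c (a r) = Polynomial.C (a r)
  grading_ι : ∀ m, c (ι m) = Polynomial.monomial 1 (ι m)

namespace IsTruncatedGraded

variable {p} {a : R →+* T} {ι : M →+ T} {c : T →+* Polynomial T} (h : IsTruncatedGraded p a ι c)

include h

/-- Setting `t = 1` sums the homogeneous components, so an element with no nonzero component is
zero. -/
theorem eval_grading (x : T) : (c x).eval 1 = x := by
  refine h.induction (motive := fun x => (c x).eval 1 = x) (fun r => ?_) (fun m => ?_)
    (fun x y hx hy => ?_) (fun x y hx hy => ?_) x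
  · simp [h.grading_algebraMap]
  · simp [h.grading_ι]
  · rw [map_mul, Polynomial.eval_mul, hx, hy]
  · rw [map_add, Polynomial.eval_add, hx, hy]

theorem grading_coeff_mem (x : T) : ∀ k, (c x).coeff k ∈ Ideal.span (Set.range ι) ^ k := by
  refine h.induction (motive := fun x => ∀ k, (c x).coeff k ∈ Ideal.span (Set.range ι) ^ k)
    (fun r k => ?_) (fun m k => ?_) (fun x y hx hy k => ?_)
    (fun x y hx hy k => ?_) x
  · rw [h.grading_algebraMap, Polynomial.coeff_C]
    split_ifs with hk
    · simp [hk]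
    · exact zero_mem _
  · rw [h.grading_ι, Polynomial.coeff_monomial]
    split_ifs with hk
    · rw [← hk, pow_one]
      exact Ideal.subset_span ⟨m, rfl⟩
    · exact zero_mem _
  · rw [map_mul, Polynomial.coeff_mul]
    refine Ideal.sum_mem _ fun ij hij => ?_
    rw [← Finset.HasAntidiagonal.mem_antidiagonal.mp hij, pow_add]
    exact Ideal.mul_mem_mul (hx _) (hy _)
  · rw [map_add, Polynomial.coeff_add]
    exact add_mem (hx k) (hy k)

/-- The grading sends generators of degree one to multiples of `t`, hence the `n`-th power of their
ideal into `(tⁿ)`. -/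
theorem grading_coeff_eq_zero {x : T} {k n : ℕ} (hx : x ∈ Ideal.span (Set.range ι) ^ n)
    (hk : k < n) : (c x).coeff k = 0 := by
  have h1 : (Ideal.span (Set.range ι)).map c ≤ Ideal.span {Polynomial.X} := by
    rw [Ideal.map_span]
    refine Ideal.span_le.mpr ?_
    rintro _ ⟨_, ⟨m, rfl⟩, rfl⟩
    rw [h.grading_ι, ← Polynomial.C_mul_X_eq_monomial]
    exact Ideal.mul_mem_left _ _ (Ideal.mem_span_singleton_self _)
  have h2 := Ideal.mem_map_of_mem c hx
  rw [Ideal.map_pow] at h2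
  have h3 := Ideal.pow_right_mono h1 n h2
  rw [Ideal.span_singleton_pow, Ideal.mem_span_singleton] at h3
  exact Polynomial.X_pow_dvd_iff.mp h3 k hk

/-- The components are themselves homogeneous: this is the coassociativity of the grading, checked
on generators. -/
theorem grading_grading_coeff (x : T) :
    ∀ k, c ((c x).coeff k) = Polynomial.monomial k ((c x).coeff k) := by
  refine h.induction
    (motive := fun x => ∀ k, c ((c x).coeff k) = Polynomial.monomial k ((c x).coeff k))
    (fun r k => ?_) (fun m k => ?_) (fun x y hx hy k => ?_)
    (fun x y hx hy k => ?_) x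
  · rw [h.grading_algebraMap, Polynomial.coeff_C]
    split_ifs with hk
    · rw [hk, h.grading_algebraMap]; rfl
    · simp
  · rw [h.grading_ι, Polynomial.coeff_monomial]
    split_ifs with hk
    · rw [← hk, h.grading_ι]
    · simp
  · rw [map_mul, Polynomial.coeff_mul, map_sum, map_sum]
    refine Finset.sum_congr rfl fun ij hij => ?_
    rw [map_mul, hx, hy, Polynomial.monomial_mul_monomial,
      Finset.HasAntidiagonal.mem_antidiagonal.mp hij]
  · rw [map_add, Polynomial.coeff_add, map_add, map_add, hx, hy]

/-- The homogeneous component of degree `k` vanishes if it lies in a higher power of the ideal of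
elements of positive degree. -/
theorem grading_coeff_eq_zero_of_mem {x : T} {k : ℕ}
    (hx : (c x).coeff k ∈ Ideal.span (Set.range ι) ^ (k + 1)) : (c x).coeff k = 0 := by
  have h1 := h.grading_coeff_eq_zero hx (Nat.lt_succ_self k)
  rwa [h.grading_grading_coeff, Polynomial.coeff_monomial_same] at h1

end IsTruncatedGraded

/-- The grading comes from the universal property applied to `m ↦ m t`, which is allowed since `(m
t)ᵖ = mᵖ tᵖ = 0`. -/
theorem Tau.isTruncatedGraded (p : ℕ) [Fact p.Prime] (A M : Type u) [CommRing A]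
    [AddCommGroup M] [Module A M] :
    ∃ c, IsTruncatedGraded p (algebraMap A (Tau p A M)) (Tau.ι p A M).toAddMonoidHom c := by
  have hl (a : A) (m : M) : (Polynomial.monomial 1).toAddMonoidHom.comp
      (Tau.ι p A M).toAddMonoidHom (a • m) =
      Polynomial.C.comp (algebraMap A (Tau p A M)) a * (Polynomial.monomial 1).toAddMonoidHom.comp
      (Tau.ι p A M).toAddMonoidHom m := by
    change Polynomial.monomial 1 (Tau.ι p A M (a • m)) =
        Polynomial.C (algebraMap A _ a) * Polynomial.monomial 1 (Tau.ι p A M m)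
    rw [Polynomial.C_mul_monomial, Tau.ι_smul]
  have hpow (m : M) : (Polynomial.monomial 1).toAddMonoidHom.comp
      (Tau.ι p A M).toAddMonoidHom m ^ p = 0 := by
    change Polynomial.monomial 1 (Tau.ι p A M m) ^ p = 0
    rw [Polynomial.monomial_pow, Tau.ι_pow, map_zero]
  exact ⟨Tau.lift p _ _ hl hpow,
    { ι_smul := Tau.ι_smul p
      ι_pow := Tau.ι_pow p
      induction := Tau.induction p
      grading_algebraMap := Tau.lift_algebraMap p _ _ hl hpow
      grading_ι := Tau.lift_ι p _ _ hl hpow }⟩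

end tauGrading

/-! ### Self-tensor products modulo the `p`-th powers of differences -/

section frobPushout

variable (p : ℕ) {S R A : Type u} [CommRing S] [CommRing R] [CommRing A]

/-- The ring `A` with the homomorphisms `l r : R → A` is the tensor product of `R` with itself over
the subring generated by the image of `g : S → R` and the `p`-th powers. -/
structure IsFrobPushout (g : S →+* R) (l r : R →+* A) : Prop where
  comp_eq : l.comp g = r.comp g
  pow_eq : ∀ s, l s ^ p = r s ^ p
  exists_desc : ∀ {T : Type u} [CommRing T] (v w : R →+* T), v.comp g = w.comp g →
    (∀ s, v s ^ p = w s ^ p) → ∃ ψ : A →+* T, ψ.comp l = v ∧ ψ.comp r = w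
  hom_ext : ∀ {T : Type u} [CommRing T] (ψ χ : A →+* T), ψ.comp l = χ.comp l →
    ψ.comp r = χ.comp r → ψ = χ

variable {p} {g : S →+* R} {l r : R →+* A} (h : IsFrobPushout p g l r)

include h

variable (ε : A →+* R) (hεl : ε.comp l = RingHom.id R) (hεr : ε.comp r = RingHom.id R)

include hεl hεr

/-- Modulo the differences, `l` and `r` coincide. Hence the quotient map and its composite with `l ∘
ε` agree on both factors, so they are equal, and the quotient map kills the kernel of `ε`. -/
theorem IsFrobPushout.ker_eq_span :
    RingHom.ker ε = Ideal.span (Set.range fun s => r s - l s) := by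
  have hl (s : R) : ε (l s) = s := congrArg (fun q => q s) hεl
  have hr (s : R) : ε (r s) = s := congrArg (fun q => q s) hεr
  set J := Ideal.span (Set.range fun s => r s - l s)
  refine le_antisymm (fun a ha => ?_) (Ideal.span_le.mpr ?_)
  · have h1 : (Ideal.Quotient.mk J).comp (l.comp ε) = Ideal.Quotient.mk J := by
      refine h.hom_ext _ _ (RingHom.ext fun s => ?_) (RingHom.ext fun s => ?_)
      · simp [hl]
      · simp only [RingHom.comp_apply, hr]
        exact (Ideal.Quotient.eq.mpr (Ideal.subset_span ⟨s, rfl⟩) :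
        Ideal.Quotient.mk J (r s) = Ideal.Quotient.mk J (l s)).symm
    have h2 := congrArg (fun q => q a) h1
    have ha' : ε a = 0 := ha
    simp only [RingHom.comp_apply, ha', map_zero] at h2
    exact Ideal.Quotient.eq_zero_iff_mem.mp h2.symm
  · rintro _ ⟨s, rfl⟩
    change ε (r s - l s) = 0
    rw [map_sub, hl, hr, sub_self]

/-- Frobenius is a ring homomorphism, so it suffices that it kills the generators `r s - l s`. -/
theorem IsFrobPushout.pow_eq_zero [Fact p.Prime] (hA : (p : A) = 0) {z : A}
    (hz : z ∈ RingHom.ker ε) : z ^ p = 0 := by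
  rw [h.ker_eq_span ε hεl hεr] at hz
  refine (Ideal.span_le (I := RingHom.ker (frobHom p A hA))).mpr ?_ hz
  rintro _ ⟨s, rfl⟩
  refine (map_sub (frobHom p A hA) _ _).trans (sub_eq_zero.mpr (h.pow_eq s).symm)

end frobPushout

/-- The infinitesimal lifting property phrased with bare ring homomorphisms, since in the
application the target carries several maps from `R` and `S`. -/
theorem exists_lift_of_formallySmooth {S R B : Type u} [CommRing S] [CommRing R] [CommRing B]
    {g : S →+* R} (hg : g.FormallySmooth) (K : Ideal B) (hK : IsNilpotent K) (b : S →+* B)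
    (v : R →+* B ⧸ K) (h : v.comp g = (Ideal.Quotient.mk K).comp b) :
    ∃ w : R →+* B, w.comp g = b ∧ (Ideal.Quotient.mk K).comp w = v := by
  algebraize [g, b]
  let v' : R →ₐ[S] B ⧸ K := { v with commutes' := fun s => congrArg (fun q => q s) h }
  refine ⟨(Algebra.FormallySmooth.lift K hK v').toRingHom, ?_, ?_⟩
  · exact RingHom.ext fun s => AlgHom.commutes (Algebra.FormallySmooth.lift K hK v') s
  · exact RingHom.ext fun s => Algebra.FormallySmooth.mk_lift K hK v' s

/-! ### Injectivity of the map from the truncated symmetric algebra to the graded ring -/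

section grInjective

variable {p : ℕ} [Fact p.Prime] {S R A M T : Type u} [CommRing S] [CommRing R] [CommRing A]
  [AddCommGroup M] [Module R M] [CommRing T] {g : S →+* R} {l r : R →+* A}
  (h : IsFrobPushout p g l r) (hg : g.FormallySmooth) (hp0 : (p : R) = 0)
  {ε : A →+* R} (hεl : ε.comp l = RingHom.id R) (hεr : ε.comp r = RingHom.id R)
  (q : RingHom.ker ε →+ M) (hq : ∀ (b : A) z, q (b • z) = ε b • q z)
  {a : R →+* T} {ι : M →+ T} {c : T →+* Polynomial T} (hT : IsTruncatedGraded p a ι c)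

include h hg hp0 hεl hεr hq hT

/-- Formal smoothness produces a multiplicative "Taylor expansion" `w` of functions in the truncated
algebra. Pairing it with the structure map gives a homomorphism from the tensor product that
reproduces the class `q z` to first order. -/
theorem exists_ringHom_truncation (N : ℕ) :
    ∃ ψ : A →+* T ⧸ Ideal.span (Set.range ι) ^ N,
      (∀ s, ψ (l s) = Ideal.Quotient.mk _ (a s)) ∧
      ∀ z : RingHom.ker ε, ψ z - Ideal.Quotient.mk _ (ι (q z)) ∈
        (Ideal.span (Set.range ι)).map (Ideal.Quotient.mk (Ideal.span (Set.range ι) ^ N)) ^ 2 := by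
  have hl (s : R) : ε (l s) = s := congrArg (fun q => q s) hεl
  have hr (s : R) : ε (r s) = s := congrArg (fun q => q s) hεr
  set P := Ideal.span (Set.range ι)
  set π := Ideal.Quotient.mk (P ^ N)
  set J := P.map π
  have hJι (m : M) : π (ι m) ∈ J := Ideal.mem_map_of_mem π (Ideal.subset_span ⟨m, rfl⟩)
  have hJN : J ^ N = ⊥ := by
    rw [← Ideal.map_pow]
    exact Ideal.map_quotient_self _
  -- The truncation by `P ^ N` serves to make `J` nilpotent, as lifting is only available along
  -- nilpotent ideals.
  have hK : IsNilpotent (J ^ 2) := ⟨N, by rw [← pow_mul, mul_comm, pow_mul, hJN]; exact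
    (zero_pow two_ne_zero : (0 : Ideal (T ⧸ P ^ N)) ^ 2 = 0)⟩
  let δ (s : R) : RingHom.ker ε := ⟨r s - l s, by
    rw [RingHom.mem_ker, map_sub, hl, hr, sub_self]⟩
  -- The Leibniz rule. The correction term `δ s • δ t` disappears because `q` is linear through `ε`
  -- and `ε (δ s) = 0`.
  have hqδ (s t : R) : q (δ (s * t)) = s • q (δ t) + t • q (δ s) := by
    have : δ (s * t) = l s • δ t + (l t • δ s + (δ s : A) • δ t) := by
      refine Subtype.ext ?_
      change r (s * t) - l (s * t) = l s * (r t - l t) + (l t * (r s - l s) +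
        (r s - l s) * (r t - l t))
      rw [map_mul, map_mul]
      ring
    rw [this, map_add, map_add, hq, hq, hq, hl, hl, (δ s).2, zero_smul, add_zero]
  -- The first-order expansion `s ↦ s + ds`. It is multiplicative because products of two
  -- differentials lie in `J ^ 2`.
  let v : R →+* (T ⧸ P ^ N) ⧸ J ^ 2 :=
    { toFun := fun s => Ideal.Quotient.mk (J ^ 2) (π (a s + ι (q (δ s))))
      map_one' := by
        have : δ 1 = 0 := Subtype.ext (by simp [δ])
        simp [this]
      map_zero' := by
        have : δ 0 = 0 := Subtype.ext (by simp [δ])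
        simp [this]
      map_mul' := fun s t => by
        rw [← map_mul, ← map_mul, Ideal.Quotient.eq, ← map_sub, hqδ, map_add, hT.ι_smul, hT.ι_smul]
        have : a (s * t) + (a s * ι (q (δ t)) + a t * ι (q (δ s))) -
            (a s + ι (q (δ s))) * (a t + ι (q (δ t))) = -(ι (q (δ s)) * ι (q (δ t))) := by
          rw [map_mul]; ring
        rw [this, map_neg, map_mul, neg_mem_iff, pow_two]
        exact Ideal.mul_mem_mul (hJι _) (hJι _)
      map_add' := fun s t => by
        have : δ (s + t) = δ s + δ t := Subtype.ext (by
          change r (s + t) - l (s + t) = (r s - l s) + (r t - l t)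
          rw [map_add, map_add]; ring)
        rw [this, map_add a, map_add q, map_add ι, add_add_add_comm, map_add π, map_add] }
  -- Over `S` the differential vanishes since `l` and `r` agree there, so `v` is compatible with the
  -- structure map.
  obtain ⟨w, hwg, hwv⟩ := exists_lift_of_formallySmooth hg (J ^ 2) hK ((π.comp a).comp g) v (by
    refine RingHom.ext fun s => ?_
    have : δ (g s) = 0 := Subtype.ext (sub_eq_zero.mpr (congrArg (fun q => q s) h.comp_eq).symm)
    change Ideal.Quotient.mk (J ^ 2) (π (a (g s) + ι (q (δ (g s))))) = _
    rw [this, map_zero, map_zero, add_zero]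
    rfl)
  have hw (s : R) : w s - π (a s) - π (ι (q (δ s))) ∈ J ^ 2 := by
    rw [sub_sub, ← map_add]
    exact Ideal.Quotient.eq.mp (congrArg (fun q => q s) hwv)
  have hwJ (s : R) : w s - π (a s) ∈ J := by
    have := add_mem (Ideal.pow_le_self two_ne_zero (hw s)) (hJι (q (δ s)))
    rwa [sub_add_cancel] at this
  have hB : (p : T ⧸ P ^ N) = 0 := by
    have := congrArg (π.comp a) hp0
    rwa [map_natCast, map_zero] at this
  -- Frobenius kills `J` because the generators of `P` have zero `p`-th power by construction.
  have hJp : J ≤ RingHom.ker (frobHom p _ hB) := by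
    refine Ideal.map_le_iff_le_comap.mpr (Ideal.span_le.mpr ?_)
    rintro _ ⟨m, rfl⟩
    change π (ι m) ^ p = 0
    rw [← map_pow, hT.ι_pow, map_zero]
  -- The difference `w s - a s` lies in `J`, so the two maps have equal `p`-th powers and the
  -- universal property applies.
  obtain ⟨ψ, hψl, hψr⟩ := h.exists_desc (π.comp a) w hwg.symm fun s => by
    have : frobHom p _ hB (w s - π (a s)) = 0 := hJp (hwJ s)
    rw [map_sub, sub_eq_zero] at this
    exact this.symm
  have hψl' (s : R) : ψ (l s) = π (a s) := congrArg (fun q => q s) hψl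
  have hψr' (s : R) : ψ (r s) = w s := congrArg (fun q => q s) hψr
  refine ⟨ψ, hψl', ?_⟩
  -- Modulo `J` the map `ψ` factors through the augmentation. This is what makes the congruence
  -- below stable under multiplication by elements of `A`.
  have hψε (b : A) : ψ b - π (a (ε b)) ∈ J := by
    rw [← Ideal.Quotient.eq]
    refine congrArg (fun q : A →+* (T ⧸ P ^ N) ⧸ J => q b)
      (h.hom_ext ((Ideal.Quotient.mk J).comp ψ) ((Ideal.Quotient.mk J).comp ((π.comp a).comp ε))
        (RingHom.ext fun s => ?_) (RingHom.ext fun s => ?_))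
    · simp [hψl', hl]
    · simp only [RingHom.comp_apply, hψr', hr]
      exact Ideal.Quotient.eq.mpr (hwJ s)
  -- The congruence is checked on generators and then propagated. Membership in the kernel is
  -- carried along because `q` is only defined there.
  have hspan : ∀ z ∈ Ideal.span (Set.range fun s => r s - l s), ∃ hz : z ∈ RingHom.ker ε,
      ψ z - π (ι (q ⟨z, hz⟩)) ∈ J ^ 2 := by
    intro z hz
    refine Submodule.span_induction (p := fun z _ => ∃ hz : z ∈ RingHom.ker ε,
      ψ z - π (ι (q ⟨z, hz⟩)) ∈ J ^ 2) ?_ ?_ ?_ ?_ hz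
    · rintro _ ⟨s, rfl⟩
      refine ⟨(δ s).2, ?_⟩
      rw [map_sub, hψl', hψr']
      exact hw s
    · refine ⟨zero_mem _, ?_⟩
      have : q ⟨0, zero_mem _⟩ = 0 := map_zero q
      rw [this, map_zero, map_zero, map_zero, sub_zero]
      exact zero_mem _
    · rintro x y - - ⟨hx, hx'⟩ ⟨hy, hy'⟩
      refine ⟨add_mem hx hy, ?_⟩
      have : q ⟨x + y, add_mem hx hy⟩ = q ⟨x, hx⟩ + q ⟨y, hy⟩ := map_add q ⟨x, hx⟩ ⟨y, hy⟩
      rw [this, map_add, map_add, map_add, add_sub_add_comm]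
      exact add_mem hx' hy'
    · rintro b x - ⟨hx, hx'⟩
      refine ⟨Ideal.mul_mem_left _ b hx, ?_⟩
      have : q ⟨b • x, Ideal.mul_mem_left _ b hx⟩ = ε b • q ⟨x, hx⟩ := hq b ⟨x, hx⟩
      rw [this, hT.ι_smul, map_mul, smul_eq_mul, map_mul]
      have h1 : ψ b * ψ x - π (a (ε b)) * π (ι (q ⟨x, hx⟩)) =
          ψ b * (ψ x - π (ι (q ⟨x, hx⟩))) + (ψ b - π (a (ε b))) * π (ι (q ⟨x, hx⟩)) := by ring
      rw [h1]
      refine add_mem (Ideal.mul_mem_left _ _ hx') ?_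
      rw [pow_two]
      exact Ideal.mul_mem_mul (hψε b) (hJι _)
  intro z
  obtain ⟨_, hz⟩ := hspan z (h.ker_eq_span ε hεl hεr ▸ z.2)
  exact hz

/-- For `R` formally smooth over `S`, the natural map from the truncated symmetric algebra of
`I / I²` to the graded ring `⨁ₖ Iᵏ / Iᵏ⁺¹` is injective, where `I` is the kernel of
multiplication on the tensor product `A` of `R` with itself over `S[Rᵖ]`. -/
theorem injective_of_isTruncatedGraded (η : T →+* Gr (RingHom.ker ε))
    (hηa : ∀ s, η (a s) = algebraMap A _ (l s))
    (hηι : ∀ m, ∃ (z : RingHom.ker ε) (hz : (z : A) ∈ RingHom.ker ε ^ 1), q z = m ∧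
      η (ι m) = Gr.mk (RingHom.ker ε) 1 z hz) : Function.Injective η := by
  set P := Ideal.span (Set.range ι)
  -- The element `η x` has a representative whose `k`-th coefficient is sent by `ψ` to the `k`-th
  -- component of `x`, modulo `J ^ (k + 1)`. In other words, `η` followed by the graded map of `ψ`
  -- is the reduction from `T` to the graded ring of `J`.
  have key (N : ℕ) (x : T) : ∃ (ψ : A →+* T ⧸ P ^ N) (G : reesAlgebra (RingHom.ker ε)),
      RingHom.ker ε ≤ (P.map (Ideal.Quotient.mk (P ^ N))).comap ψ ∧
      η x = Ideal.Quotient.mk _ G ∧ ∀ k, ψ ((G : Polynomial A).coeff k) -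
        Ideal.Quotient.mk _ ((c x).coeff k) ∈ P.map (Ideal.Quotient.mk (P ^ N)) ^ (k + 1) := by
    obtain ⟨ψ, hψl, hψq⟩ := exists_ringHom_truncation h hg hp0 hεl hεr q hq hT N
    set π := Ideal.Quotient.mk (P ^ N)
    set J := P.map π
    have hψI : RingHom.ker ε ≤ J.comap ψ := fun z hz => by
      have h1 := add_mem (Ideal.pow_le_self two_ne_zero (hψq ⟨z, hz⟩))
        (Ideal.mem_map_of_mem π (Ideal.subset_span ⟨q ⟨z, hz⟩, rfl⟩ : ι (q ⟨z, hz⟩) ∈ P))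
      rwa [sub_add_cancel] at h1
    refine ⟨ψ, ?_⟩
    suffices H : ∃ G : reesAlgebra (RingHom.ker ε), η x = Ideal.Quotient.mk _ G ∧
        ∀ k, ψ ((G : Polynomial A).coeff k) - π ((c x).coeff k) ∈ J ^ (k + 1) by
      obtain ⟨G, hG⟩ := H
      exact ⟨G, hψI, hG⟩
    refine hT.induction (motive := fun x => ∃ G : reesAlgebra (RingHom.ker ε),
      η x = Ideal.Quotient.mk _ G ∧
        ∀ k, ψ ((G : Polynomial A).coeff k) - π ((c x).coeff k) ∈ J ^ (k + 1))
      (fun s => ?_) (fun m => ?_) ?_ ?_ x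
    · refine ⟨algebraMap A _ (l s), hηa s, fun k => ?_⟩
      change ψ ((Polynomial.C (l s)).coeff k) - _ ∈ _
      rw [hT.grading_algebraMap, Polynomial.coeff_C, Polynomial.coeff_C]
      split_ifs
      · rw [hψl, sub_self]
        exact zero_mem _
      · rw [map_zero, map_zero, sub_zero]
        exact zero_mem _
    · obtain ⟨z, hz, rfl, hηz⟩ := hηι m
      refine ⟨_, hηz, fun k => ?_⟩
      change ψ ((Polynomial.monomial 1 (z : A)).coeff k) - _ ∈ _
      rw [hT.grading_ι, Polynomial.coeff_monomial, Polynomial.coeff_monomial]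
      split_ifs with hk
      · rw [← hk]
        exact hψq z
      · rw [map_zero, map_zero, sub_zero]
        exact zero_mem _
    · rintro x y ⟨G, hG, hG'⟩ ⟨H, hH, hH'⟩
      refine ⟨G * H, by rw [map_mul, hG, hH, map_mul], fun k => ?_⟩
      rw [Subalgebra.coe_mul, map_mul, Polynomial.coeff_mul, Polynomial.coeff_mul, map_sum,
        map_sum, ← Finset.sum_sub_distrib]
      refine Ideal.sum_mem _ fun ij hij => ?_
      rw [← Finset.HasAntidiagonal.mem_antidiagonal.mp hij, map_mul, map_mul]
      have h1 : ψ ((H : Polynomial A).coeff ij.2) ∈ J ^ ij.2 := by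
        have h2 := Ideal.mem_map_of_mem ψ (H.2 ij.2)
        rw [Ideal.map_pow] at h2
        exact Ideal.pow_right_mono (Ideal.map_le_iff_le_comap.mpr hψI) _ h2
      have h2 : π ((c x).coeff ij.1) ∈ J ^ ij.1 := by
        have h3 := Ideal.mem_map_of_mem π (hT.grading_coeff_mem x ij.1)
        rwa [Ideal.map_pow] at h3
      have h3 : ψ ((G : Polynomial A).coeff ij.1) * ψ ((H : Polynomial A).coeff ij.2) -
          π ((c x).coeff ij.1) * π ((c y).coeff ij.2) =
          (ψ ((G : Polynomial A).coeff ij.1) - π ((c x).coeff ij.1)) *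
            ψ ((H : Polynomial A).coeff ij.2) + π ((c x).coeff ij.1) *
          (ψ ((H : Polynomial A).coeff ij.2) - π ((c y).coeff ij.2)) := by ring
      rw [h3]
      refine add_mem ?_ ?_
      · have h4 := Ideal.mul_mem_mul (hG' ij.1) h1
        rwa [← pow_add, add_right_comm] at h4
      · have h4 := Ideal.mul_mem_mul h2 (hH' ij.2)
        rwa [← pow_add, ← add_assoc] at h4
    · rintro x y ⟨G, hG, hG'⟩ ⟨H, hH, hH'⟩
      refine ⟨G + H, by rw [map_add, hG, hH, map_add], fun k => ?_⟩
      rw [Subalgebra.coe_add, map_add, Polynomial.coeff_add, Polynomial.coeff_add, map_add,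
        map_add, add_sub_add_comm]
      exact add_mem (hG' k) (hH' k)
  refine (injective_iff_map_eq_zero η).mpr fun x hx => ?_
  have hc : c x = 0 := by
    refine Polynomial.ext fun k => hT.grading_coeff_eq_zero_of_mem ?_
    -- With `N = k + 1` the ideal `J ^ (k + 1)` is zero. As `η x = 0`, the coefficient `G_k` lies in
    -- `I ^ (k + 1)` and is killed by `ψ`, so the component `x_k` lies in `P ^ (k + 1)`.
    obtain ⟨ψ, G, hψI, hG, hG'⟩ := key (k + 1) x
    rw [hx, eq_comm, Ideal.Quotient.eq_zero_iff_mem] at hG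
    have h1 := Ideal.mem_map_of_mem ψ (hG k)
    rw [Ideal.map_pow] at h1
    have h2 := Ideal.pow_right_mono (Ideal.map_le_iff_le_comap.mpr hψI) _ h1
    have h3 := sub_mem h2 (hG' k)
    rw [sub_sub_cancel, ← Ideal.map_pow, Ideal.map_quotient_self, Ideal.mem_bot] at h3
    exact Ideal.Quotient.eq_zero_iff_mem.mp h3
  rw [← hT.eval_grading x, hc, Polynomial.eval_zero]

end grInjective

/-! ### Stalks of sheaves of rings -/

section stalks

variable {X : Scheme.{u}} {F G : TopCat.Sheaf CommRingCat.{u} X}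

/-- The stalk of a sheaf of rings. -/
abbrev stalkRing (F : TopCat.Sheaf CommRingCat.{u} X) (x : X) : CommRingCat.{u} :=
  TopCat.Presheaf.stalk (C := CommRingCat.{u}) (X := X) F.obj x

/-- The germ of a section of a sheaf of rings. -/
def germAt (F : TopCat.Sheaf CommRingCat.{u} X) (U : X.Opens) (x : X) (hx : x ∈ U) :
    F.obj.obj (op U) →+* stalkRing F x :=
  (TopCat.Presheaf.germ (C := CommRingCat.{u}) (X := X) F.obj U x hx).hom

/-- The homomorphism of stalks induced by a homomorphism of sheaves of rings. -/
def stalkHom (φ : F ⟶ G) (x : X) : stalkRing F x →+* stalkRing G x :=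
  ((TopCat.Presheaf.stalkFunctor CommRingCat.{u} (X := X) x).map φ.hom).hom

theorem stalkHom_germAt (φ : F ⟶ G) (U : X.Opens) (x : X) (hx : x ∈ U) (s : F.obj.obj (op U)) :
    stalkHom φ x (germAt F U x hx s) = germAt G U x hx (φ.hom.app (op U) s) :=
  TopCat.Presheaf.stalkFunctor_map_germ_apply U x hx φ.hom s

theorem germAt_res (F : TopCat.Sheaf CommRingCat.{u} X) {U V : X.Opens} (i : V ≤ U) (x : X)
    (hx : x ∈ V) (s : F.obj.obj (op U)) :
    germAt F V x hx (F.obj.map (homOfLE i).op s) = germAt F U x (i hx) s :=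
  TopCat.Presheaf.germ_res_apply (C := CommRingCat.{u}) (X := X) F.obj (homOfLE i) x hx s

theorem exists_germAt_eq (F : TopCat.Sheaf CommRingCat.{u} X) (x : X) (t : stalkRing F x) :
    ∃ (U : X.Opens) (hx : x ∈ U) (s : F.obj.obj (op U)), germAt F U x hx s = t :=
  TopCat.Presheaf.exists_germ_eq (C := CommRingCat.{u}) (X := X) F.obj t

theorem exists_res_eq_of_germAt_eq (F : TopCat.Sheaf CommRingCat.{u} X) {U : X.Opens} {x : X}
    (hx : x ∈ U) {s t : F.obj.obj (op U)} (h : germAt F U x hx s = germAt F U x hx t) :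
    ∃ (V : X.Opens) (i : V ≤ U), x ∈ V ∧
      F.obj.map (homOfLE i).op s = F.obj.map (homOfLE i).op t := by
  obtain ⟨V, hV, i, j, hst⟩ := TopCat.Presheaf.germ_eq (C := CommRingCat.{u}) (X := X) F.obj x
    hx hx s t h
  exact ⟨V, i.le, hV, hst⟩

theorem section_ext_of_germAt (F : TopCat.Sheaf CommRingCat.{u} X) {U : X.Opens}
    {s t : F.obj.obj (op U)} (h : ∀ x hx, germAt F U x hx s = germAt F U x hx t) : s = t :=
  TopCat.Presheaf.section_ext F U s t h

theorem stalkRing_hom_ext {x : X} {T : Type u} [CommRing T] {v w : stalkRing F x →+* T}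
    (h : ∀ (U : X.Opens) (hx : x ∈ U) (s : F.obj.obj (op U)),
      v (germAt F U x hx s) = w (germAt F U x hx s)) : v = w := by
  refine RingHom.ext fun t => ?_
  obtain ⟨U, hx, s, rfl⟩ := exists_germAt_eq F x t
  exact h U hx s

theorem stalkHom_comp {H : TopCat.Sheaf CommRingCat.{u} X} (φ : F ⟶ G) (ψ : G ⟶ H) (x : X) :
    stalkHom (φ ≫ ψ) x = (stalkHom ψ x).comp (stalkHom φ x) := by
  refine stalkRing_hom_ext fun U hx s => ?_
  rw [RingHom.comp_apply, stalkHom_germAt, stalkHom_germAt, stalkHom_germAt]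
  rfl

/-- Stalks commute with pushouts. -/
theorem exists_stalk_desc {B P : TopCat.Sheaf CommRingCat.{u} X} {b : B ⟶ F} {b' : B ⟶ G}
    {l : F ⟶ P} {r : G ⟶ P} (h : IsPushout b b' l r) (x : X) {T : Type u} [CommRing T]
    (v : stalkRing F x →+* T) (w : stalkRing G x →+* T)
    (hvw : v.comp (stalkHom b x) = w.comp (stalkHom b' x)) :
    ∃ ψ : stalkRing P x →+* T, ψ.comp (stalkHom l x) = v ∧ ψ.comp (stalkHom r x) = w := by
  -- Stalks of sheaves are left adjoint to skyscraper sheaves, so they preserve pushouts. The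
  -- composite functor is used since forgetting to presheaves does not preserve pushouts by itself.
  have h1 := h.map (TopCat.Sheaf.forget CommRingCat.{u} X ⋙ TopCat.Presheaf.stalkFunctor _ x)
  have hvw' : (TopCat.Sheaf.forget CommRingCat.{u} X ⋙ TopCat.Presheaf.stalkFunctor _ x).map b ≫
      CommRingCat.ofHom (R := stalkRing F x) v =
      (TopCat.Sheaf.forget CommRingCat.{u} X ⋙ TopCat.Presheaf.stalkFunctor _ x).map b' ≫
      CommRingCat.ofHom (R := stalkRing G x) w := CommRingCat.hom_ext hvw
  refine ⟨(h1.desc _ _ hvw').hom, ?_, ?_⟩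
  · exact congrArg CommRingCat.Hom.hom (h1.inl_desc _ _ hvw')
  · exact congrArg CommRingCat.Hom.hom (h1.inr_desc _ _ hvw')

theorem stalk_pushout_hom_ext {B P : TopCat.Sheaf CommRingCat.{u} X} {b : B ⟶ F} {b' : B ⟶ G}
    {l : F ⟶ P} {r : G ⟶ P} (h : IsPushout b b' l r) (x : X) {T : Type u} [CommRing T]
    (ψ χ : stalkRing P x →+* T) (hl : ψ.comp (stalkHom l x) = χ.comp (stalkHom l x))
    (hr : ψ.comp (stalkHom r x) = χ.comp (stalkHom r x)) : ψ = χ := by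
  have h1 := h.map (TopCat.Sheaf.forget CommRingCat.{u} X ⋙ TopCat.Presheaf.stalkFunctor _ x)
  have h2 : CommRingCat.ofHom (R := stalkRing P x) ψ = CommRingCat.ofHom χ :=
    h1.hom_ext (CommRingCat.hom_ext hl) (CommRingCat.hom_ext hr)
  exact congrArg CommRingCat.Hom.hom h2

end stalks

/-! ### Homomorphisms out of stalks -/

section homs

variable {X Z : Scheme.{u}} (g : X ⟶ Z) (x : X)

/-- The map from the spectrum of a local ring to its scheme is a monomorphism. Equality on a local
ring thus becomes equality of morphisms from `Spec T`, to which the universal property of a fibre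
product applies. -/
theorem comp_stalkMap_eq_iff {T : Type u} [CommRing T] (v w : X.presheaf.stalk x →+* T) :
    v.comp (g.stalkMap x).hom = w.comp (g.stalkMap x).hom ↔
      Spec.map (CommRingCat.ofHom v) ≫ X.fromSpecStalk x ≫ g =
        Spec.map (CommRingCat.ofHom w) ≫ X.fromSpecStalk x ≫ g := by
  rw [← Scheme.SpecMap_stalkMap_fromSpecStalk, ← Spec.map_comp_assoc, ← Spec.map_comp_assoc,
    cancel_mono, Spec.map_injective.eq_iff, CommRingCat.hom_ext_iff]
  rfl

theorem absoluteFrobenius_stalkMap (p : ℕ) [Fact p.Prime] [IsOfChar p X]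
    (a : X.presheaf.stalk x) :
    ((absoluteFrobenius p X).stalkMap x).hom a = (a ^ p : X.presheaf.stalk x) :=
  absFrobPre_stalkMap p X x a

/-- Let `x` be a point of the pullback `X ×_S Z`. Homomorphisms out of the local ring at the
image of a point are determined by their restrictions to the local rings of the factors. -/
theorem comp_stalkMap_lift_eq_iff {X Z W S : Scheme.{u}} {f : X ⟶ S} {g : Z ⟶ S} (a : W ⟶ X)
    (b : W ⟶ Z) (h : a ≫ f = b ≫ g) (x : W) {T : Type u} [CommRing T]
    (v w : W.presheaf.stalk x →+* T) :
    v.comp ((pullback.lift a b h).stalkMap x).hom = w.comp ((pullback.lift a b h).stalkMap x).hom ↔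
      v.comp (a.stalkMap x).hom = w.comp (a.stalkMap x).hom ∧
      v.comp (b.stalkMap x).hom = w.comp (b.stalkMap x).hom := by
  rw [comp_stalkMap_eq_iff, comp_stalkMap_eq_iff, comp_stalkMap_eq_iff]
  have h1 (u : W.presheaf.stalk x →+* T) :
      (Spec.map (CommRingCat.ofHom u) ≫ W.fromSpecStalk x ≫ pullback.lift a b h) ≫
        pullback.fst f g = Spec.map (CommRingCat.ofHom u) ≫ W.fromSpecStalk x ≫ a := by
    rw [Category.assoc, Category.assoc]
    exact congrArg (fun q => _ ≫ _ ≫ q) (pullback.lift_fst a b h)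
  have h2 (u : W.presheaf.stalk x →+* T) :
      (Spec.map (CommRingCat.ofHom u) ≫ W.fromSpecStalk x ≫ pullback.lift a b h) ≫
        pullback.snd f g = Spec.map (CommRingCat.ofHom u) ≫ W.fromSpecStalk x ≫ b := by
    rw [Category.assoc, Category.assoc]
    exact congrArg (fun q => _ ≫ _ ≫ q) (pullback.lift_snd a b h)
  rw [← h1, ← h1, ← h2, ← h2]
  exact ⟨fun h3 => ⟨h3 =≫ _, h3 =≫ _⟩, fun h3 => pullback.hom_ext h3.1 h3.2⟩

/-- The components of `F` are `f` and the absolute Frobenius, and the latter acts on stalks by `s ↦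
sᵖ`. This replaces a computation of the local rings of `X'`. -/
theorem comp_stalkMap_relativeFrobenius_eq_iff (p : ℕ) [Fact p.Prime] {X Y : Scheme.{u}}
    (f : X ⟶ Y) [IsOfChar p Y] (x : X) {T : Type u} [CommRing T]
    (v w : X.presheaf.stalk x →+* T) :
    v.comp ((relativeFrobenius p f).stalkMap x).hom =
        w.comp ((relativeFrobenius p f).stalkMap x).hom ↔
      v.comp (f.stalkMap x).hom = w.comp (f.stalkMap x).hom ∧ ∀ s, v s ^ p = w s ^ p := by
  have := IsOfChar.of_hom p f
  refine (comp_stalkMap_lift_eq_iff (absoluteFrobenius p X) f (absoluteFrobenius_comp p f) x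
    v w).trans (and_comm.trans (and_congr_right' ?_))
  rw [RingHom.ext_iff]
  refine forall_congr' fun s => ?_
  have h1 := absoluteFrobenius_stalkMap x p s
  exact (Eq.congr ((congrArg v h1).trans (map_pow v s p))
    ((congrArg w h1).trans (map_pow w s p)))

/-- The map from the sections of a sheaf to the sections of its inverse image. -/
def inverseImageSection (G : TopCat.Sheaf CommRingCat.{u} Z) (V : Z.Opens) :
    G.obj.obj (op V) →+* ((inverseImage g).obj G).obj.obj (op (g ⁻¹ᵁ V)) :=
  (((inverseImageAdj g).unit.app G).hom.app (op V)).hom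

theorem invSharp_inverseImageSection (V : Z.Opens) (c : Γ(Z, V)) :
    (invSharp g).hom.app (op (g ⁻¹ᵁ V)) (inverseImageSection g Z.sheaf V c) = g.app V c := by
  have h : (inverseImageAdj g).unit.app Z.sheaf ≫
      (TopCat.Sheaf.pushforward CommRingCat.{u} g.base).map (invSharp g) = sharp g :=
    ((inverseImageAdj g).homEquiv_unit _ _ _).symm.trans (Equiv.apply_symm_apply _ _)
  exact congrArg (fun q => (q.hom.app (op V)).hom c) h

theorem inverseImage_hom_ext {G : TopCat.Sheaf CommRingCat.{u} Z}
    {H : TopCat.Sheaf CommRingCat.{u} X} {v w : (inverseImage g).obj G ⟶ H}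
    (h : ∀ (V : Z.Opens) (c : G.obj.obj (op V)),
      v.hom.app (op (g ⁻¹ᵁ V)) (inverseImageSection g G V c) =
      w.hom.app (op (g ⁻¹ᵁ V)) (inverseImageSection g G V c)) : v = w := by
  refine ((inverseImageAdj g).homEquiv _ _).injective ?_
  rw [Adjunction.homEquiv_unit, Adjunction.homEquiv_unit]
  refine CategoryTheory.Sheaf.hom_ext (NatTrans.ext (funext fun V => CommRingCat.hom_ext
    (RingHom.ext fun c => ?_)))
  exact h V.unop c

/-- Homomorphisms out of a stalk of an inverse image sheaf are determined by sections of the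
original sheaf. -/
theorem inverseImage_stalk_hom_ext (G : TopCat.Sheaf CommRingCat.{u} Z) {T : Type u} [CommRing T]
    (v w : stalkRing ((inverseImage g).obj G) x →+* T)
    (h : ∀ (V : Z.Opens) (hx : g x ∈ V) (c : G.obj.obj (op V)),
      v (germAt _ (g ⁻¹ᵁ V) x hx (inverseImageSection g G V c)) =
      w (germAt _ (g ⁻¹ᵁ V) x hx (inverseImageSection g G V c))) : v = w := by
  classical
  -- A homomorphism out of a stalk is the same as a homomorphism to a skyscraper sheaf, and
  -- homomorphisms out of `g⁻¹ G` are determined by sections of `G`.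
  let sky (v : stalkRing ((inverseImage g).obj G) x →+* T) :
      (inverseImage g).obj G ⟶ skyscraperSheaf x (CommRingCat.of T) :=
    ⟨StalkSkyscraperPresheafAdjunctionAuxs.toSkyscraperPresheaf x (CommRingCat.ofHom v)⟩
  have hsky (v) : StalkSkyscraperPresheafAdjunctionAuxs.fromStalk x (sky v).hom =
      CommRingCat.ofHom v :=
    StalkSkyscraperPresheafAdjunctionAuxs.fromStalk_to_skyscraper x
      (𝓕 := ((inverseImage g).obj G).presheaf) (c := CommRingCat.of T) (CommRingCat.ofHom v)
  suffices H : sky v = sky w by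
    have h1 := hsky v
    rw [H, hsky w] at h1
    exact congrArg CommRingCat.Hom.hom h1.symm
  refine inverseImage_hom_ext g fun V c => ?_
  by_cases hV : x ∈ g ⁻¹ᵁ V
  · have h4 (v) : (sky v).hom.app (op (g ⁻¹ᵁ V)) =
        (TopCat.Presheaf.germ (C := CommRingCat.{u}) (X := X) ((inverseImage g).obj G).obj
          (g ⁻¹ᵁ V) x hV ≫ CommRingCat.ofHom v) ≫ eqToHom (if_pos hV).symm :=
      (dif_pos hV).trans (Category.assoc _ _ _).symm
    rw [h4, h4]
    exact congrArg (eqToHom (if_pos hV).symm : CommRingCat.of T ⟶ _).hom (h V hV c)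
  -- On open sets missing `x` the skyscraper takes a terminal value, so there is nothing to compare.
  · exact congrArg (fun q => CommRingCat.Hom.hom q (inverseImageSection g G V c))
      ((isTerminalSkyscraperSheafObjObjOfNotMem (p₀ := x) (A := CommRingCat.of T)
        (U := op (g ⁻¹ᵁ V)) hV).hom_ext _ _)

/-- Both maps out of the stalks are determined by germs of sections of `𝒪_Z` near `g x`, and such a
germ has the same image in `𝒪_{X,x}` either way. The isomorphism of the stalk of `g⁻¹𝒪_Z` with that
of `𝒪_Z` is not needed. -/
theorem comp_stalkHom_invSharp_eq_iff {T : Type u} [CommRing T]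
    (v w : X.presheaf.stalk x →+* T) :
    v.comp (stalkHom (invSharp g) x) = w.comp (stalkHom (invSharp g) x) ↔
      v.comp (g.stalkMap x).hom = w.comp (g.stalkMap x).hom := by
  have key (V : Z.Opens) (hx : g x ∈ V) (c : Γ(Z, V)) :
      stalkHom (invSharp g) x (germAt _ (g ⁻¹ᵁ V) x hx (inverseImageSection g Z.sheaf V c)) =
      (g.stalkMap x).hom (germAt Z.sheaf V (g x) hx c) :=
    (stalkHom_germAt (invSharp g) _ x hx _).trans ((congrArg (germAt X.sheaf _ x hx)
      (invSharp_inverseImageSection g V c)).trans (Scheme.Hom.germ_stalkMap_apply g V x hx c).symm)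
  constructor
  · intro h
    refine stalkRing_hom_ext (F := Z.sheaf) fun V hx c => ?_
    have h1 : v (stalkHom (invSharp g) x
          (germAt _ (g ⁻¹ᵁ V) x hx (inverseImageSection g Z.sheaf V c))) =
        w (stalkHom (invSharp g) x
          (germAt _ (g ⁻¹ᵁ V) x hx (inverseImageSection g Z.sheaf V c))) :=
      RingHom.congr_fun h _
    exact (congrArg v (key V hx c)).symm.trans (h1.trans (congrArg w (key V hx c)))
  · intro h
    refine inverseImage_stalk_hom_ext g x _ _ _ fun V hx c => ?_
    have h1 : v ((g.stalkMap x).hom (germAt Z.sheaf V (g x) hx c)) =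
        w ((g.stalkMap x).hom (germAt Z.sheaf V (g x) hx c)) := RingHom.congr_fun h _
    exact (congrArg v (key V hx c)).trans (h1.trans (congrArg w (key V hx c)).symm)

end homs

/-! ### Direct images along inducing maps, and the pushout description of `g^* g_* 𝒪_X`. -/

section inducing

/-- Let `L : D ⥤ E` be a functor to a preorder which has a left adjoint `ρ` with `L ∘ ρ = id`. Then
natural transformations between functors on `D` of the form `L ⋙ F` come from `E`. -/
theorem exists_whiskerLeft_eq {C D E : Type*} [Category* C] [Category* D] [Category* E]
    [Quiver.IsThin E] (L : D ⥤ E) (ρ : E → D) (j : ∀ U, U ⟶ L.obj (ρ U))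
    (j' : ∀ U, L.obj (ρ U) ⟶ U) (k : ∀ {U V}, (U ⟶ L.obj V) → (ρ U ⟶ V)) {F G : E ⥤ C}
    (a : L ⋙ F ⟶ L ⋙ G) : ∃ b : F ⟶ G, Functor.whiskerLeft L b = a := by
  -- The value at `U` is that of `a` at `ρ U`, transported along `L (ρ U) ≅ U`. All compatibilities
  -- of restriction maps hold because `E` is thin.
  refine ⟨⟨fun U => F.map (j U) ≫ a.app (ρ U) ≫ G.map (j' U), fun U V i => ?_⟩, ?_⟩
  · have h1 := a.naturality (k (i ≫ j V))
    simp only [Functor.comp_map] at h1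
    rw [Category.assoc, Category.assoc, ← G.map_comp, ← F.map_comp_assoc,
      Subsingleton.elim (i ≫ j V) (j U ≫ L.map (k (i ≫ j V))), F.map_comp_assoc,
      reassoc_of% h1, ← G.map_comp, Subsingleton.elim (L.map (k (i ≫ j V)) ≫ j' V) (j' U ≫ i)]
  · refine NatTrans.ext (funext fun V => ?_)
    have h1 := a.naturality (k (𝟙 (L.obj V)))
    simp only [Functor.comp_map] at h1
    change F.map (j _) ≫ a.app _ ≫ G.map (j' _) = a.app V
    rw [Subsingleton.elim (j' (L.obj V)) (L.map (k (𝟙 (L.obj V)))), ← h1, ← F.map_comp_assoc,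
      Subsingleton.elim (j (L.obj V) ≫ L.map (k (𝟙 (L.obj V)))) (𝟙 _), F.map_id]
    exact Category.id_comp _

/-- A natural transformation between direct images along an inducing map comes from a natural
transformation between the original presheaves. -/
theorem exists_map_of_isInducing {X Z : TopCat.{u}} {g : X ⟶ Z} (hg : Topology.IsInducing g)
    {C : Type*} [Category* C] {F G : (Opens X)ᵒᵖ ⥤ C}
    (a : (Opens.map g).op ⋙ F ⟶ (Opens.map g).op ⋙ G) :
    ∃ b : F ⟶ G, Functor.whiskerLeft (Opens.map g).op b = a :=
  exists_whiskerLeft_eq (Opens.map g).op (fun U => op (hg.functorObj U.unop))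
    (fun U => (homOfLE (hg.map_functorObj U.unop).le).op)
    (fun U => (homOfLE (hg.map_functorObj U.unop).ge).op)
    (fun i => (homOfLE (hg.le_functorObj_iff.mpr i.unop.le)).op) a

/-- Every open set of `X` is a preimage of an open set of `Z`, so the direct image sees all
components. -/
theorem hom_ext_of_isInducing {X Z : TopCat.{u}} {g : X ⟶ Z} (hg : Topology.IsInducing g)
    {C : Type*} [Category* C] {F G : (Opens X)ᵒᵖ ⥤ C} {a b : F ⟶ G}
    (h : Functor.whiskerLeft (Opens.map g).op a = Functor.whiskerLeft (Opens.map g).op b) :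
    a = b := by
  refine NatTrans.ext (funext fun U => ?_)
  have h1 : a.app (op ((Opens.map g).obj (hg.functorObj U.unop))) =
      b.app (op ((Opens.map g).obj (hg.functorObj U.unop))) :=
    congrArg (fun q => q.app (op (hg.functorObj U.unop))) h
  rwa [hg.map_functorObj] at h1

variable {X Z : Scheme.{u}} (g : X ⟶ Z)

theorem pushforward_faithful (hg : Topology.IsInducing g.base) :
    (TopCat.Sheaf.pushforward CommRingCat.{u} g.base).Faithful where
  map_injective h := CategoryTheory.Sheaf.hom_ext
    (hom_ext_of_isInducing hg (congrArg (fun q => q.hom) h))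

theorem pushforward_full (hg : Topology.IsInducing g.base) :
    (TopCat.Sheaf.pushforward CommRingCat.{u} g.base).Full where
  map_surjective {F G} a := by
    obtain ⟨b, hb⟩ := exists_map_of_isInducing (F := F.obj) (G := G.obj) hg a.hom
    exact ⟨⟨b⟩, CategoryTheory.Sheaf.hom_ext hb⟩

/-- The counit of an adjunction is invertible when the right adjoint is fully faithful. -/
theorem isIso_counit_of_isInducing (hg : Topology.IsInducing g.base)
    (F : TopCat.Sheaf CommRingCat.{u} X) : IsIso ((inverseImageAdj g).counit.app F) := by
  have := pushforward_faithful g hg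
  have := pushforward_full g hg
  infer_instance

/-- If `g` is inducing, then `g⁻¹ g_* 𝒪_X = 𝒪_X`, and `g^* g_* 𝒪_X` is
`𝒪_X ⊗_{g⁻¹ 𝒪_Z} 𝒪_X`. This is the inclusion of the second factor. -/
theorem exists_right (hg : Topology.IsInducing g.base) :
    ∃ r : X.sheaf ⟶ (pullPush g).right,
      IsPushout (invSharp g) (invSharp g) (pullPush g).hom r ∧
      r ≫ (counitAlgebra g).right = 𝟙 _ ∧
      ∀ (V : Z.Opens) (s : Γ(X, g ⁻¹ᵁ V)), sectionRight g V s = r.hom.app (op (g ⁻¹ᵁ V)) s := by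
  have := isIso_counit_of_isInducing g hg X.sheaf
  let η := (inverseImageAdj g).counit.app X.sheaf
  have h0 : (inverseImage g).map (sharp g) ≫ η = invSharp g :=
    ((inverseImageAdj g).homEquiv_counit _ _ _).symm
  let r0 := pushout.inr (invSharp g) ((inverseImage g).map (sharp g))
  have h1 : r0 ≫ (counitAlgebra g).right = η := pushout.inr_desc ..
  have h2 : IsPushout (invSharp g) ((inverseImage g).map (sharp g)) (pullPush g).hom r0 :=
    IsPushout.of_hasPushout _ _
  -- The counit identifies `g⁻¹ g_* 𝒪_X` with `𝒪_X`. Transporting the second factor of the pushout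
  -- along it gives `r`.
  refine ⟨inv η ≫ r0, ?_, ?_, fun V s => ?_⟩
  · refine h2.of_iso (Iso.refl _) (Iso.refl _) (asIso η) (Iso.refl _) ?_ ?_ ?_ ?_
    · exact (Category.comp_id _).trans (Category.id_comp _).symm
    · exact h0.trans (Category.id_comp _).symm
    · exact (Category.comp_id _).trans (Category.id_comp _).symm
    · exact (Category.comp_id _).trans (IsIso.hom_inv_id_assoc η r0).symm
  · exact (Category.assoc _ _ _).trans ((congrArg (inv η ≫ ·) h1).trans (IsIso.inv_hom_id η))
  · have h3 : pullbackSection g (pushforwardStructure g) =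
        (TopCat.Sheaf.pushforward CommRingCat.{u} g.base).map (inv η ≫ r0) := by
      have h4 : pullbackSection g (pushforwardStructure g) =
          (inverseImageAdj g).homEquiv _ _ (η ≫ (inv η ≫ r0)) := by
        rw [IsIso.hom_inv_id_assoc]; rfl
      refine h4.trans (((inverseImageAdj g).homEquiv_naturality_right _ _).trans ?_)
      refine (congrArg (· ≫ _) (((inverseImageAdj g).homEquiv_unit _ _ _).trans
        ((inverseImageAdj g).right_triangle_components X.sheaf))).trans ?_
      exact Category.id_comp _
    exact congrArg (fun q => (q.hom.app (op V)) s) h3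

end inducing

/-- The first projection composed with `F` is the absolute Frobenius, whose underlying map is the
identity. A continuous map with a continuous left inverse is inducing. -/
theorem relativeFrobenius_isInducing (p : ℕ) [Fact p.Prime] {X Y : Scheme.{u}}
    (f : X ⟶ Y) [IsOfChar p Y] : Topology.IsInducing (relativeFrobenius p f).base := by
  have := IsOfChar.of_hom p f
  have h : relativeFrobenius p f ≫ pullback.fst f (absoluteFrobenius p Y) =
    absoluteFrobenius p X := pullback.lift_fst ..
  refine Topology.IsInducing.of_comp (g := (pullback.fst f (absoluteFrobenius p Y)).base)
    (relativeFrobenius p f).continuous (pullback.fst f (absoluteFrobenius p Y)).continuous ?_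
  have h2 : ((pullback.fst f (absoluteFrobenius p Y)).base ∘ (relativeFrobenius p f).base) = id :=
    congrArg (fun q : X ⟶ X => (q.base : X → X)) h
  rw [h2]
  exact Topology.IsInducing.id

/-- The stalks of `F^* F_* 𝒪_X` for the relative Frobenius `F` of `f`. -/
theorem exists_right_relativeFrobenius (p : ℕ) [Fact p.Prime] {X Y : Scheme.{u}}
    (f : X ⟶ Y) [IsOfChar p Y] :
    ∃ r : X.sheaf ⟶ (pullPush (relativeFrobenius p f)).right,
      r ≫ (frobCounit p f).right = 𝟙 _ ∧
      (∀ (V : (frobeniusTwist p f).Opens) (s : Γ(X, relativeFrobenius p f ⁻¹ᵁ V)),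
        sectionRight (relativeFrobenius p f) V s =
          r.hom.app (op (relativeFrobenius p f ⁻¹ᵁ V)) s) ∧
      ∀ x : X, IsFrobPushout p (R := X.presheaf.stalk x) (f.stalkMap x).hom
        (stalkHom (pullPush (relativeFrobenius p f)).hom x) (stalkHom r x) := by
  obtain ⟨r, h1, h2, h3⟩ := exists_right _ (relativeFrobenius_isInducing p f)
  refine ⟨r, h2, h3, fun x => ?_⟩
  have h4 {T : Type u} [CommRing T] (v w : X.presheaf.stalk x →+* T) :=
    (comp_stalkHom_invSharp_eq_iff (relativeFrobenius p f) x v w).trans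
      (comp_stalkMap_relativeFrobenius_eq_iff p f x v w)
  have h5 : (stalkHom (pullPush (relativeFrobenius p f)).hom x).comp
      (stalkHom (invSharp (relativeFrobenius p f)) x) =
      (stalkHom r x).comp (stalkHom (invSharp (relativeFrobenius p f)) x) :=
    (stalkHom_comp _ _ x).symm.trans
      ((congrArg (fun q => stalkHom q x) h1.w).trans (stalkHom_comp _ _ x))
  refine ⟨((h4 _ _).mp h5).1, ((h4 _ _).mp h5).2, fun v w hv hw => ?_, fun ψ χ hl hr => ?_⟩
  · exact exists_stalk_desc h1 x v w ((h4 v w).mpr ⟨hv, hw⟩)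
  · exact stalk_pushout_hom_ext h1 x ψ χ hl hr

/-! ### Stalks of sheafifications -/

section sheafification

/-- The universal property of a stalk. -/
theorem exists_stalk_lift {C : Type*} [Category.{u} C] [HasColimits C] {X : TopCat.{u}}
    (F : TopCat.Presheaf C X) (x : X) {T : C} (k : ∀ U : Opens X, x ∈ U → (F.obj (op U) ⟶ T))
    (hk : ∀ (U V : Opens X) (i : V ⟶ U) (hx : x ∈ V),
      F.map i.op ≫ k V hx = k U (i.le hx)) :
    ∃ K : F.stalk x ⟶ T, ∀ U hx, F.germ U x hx ≫ K = k U hx := by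
  let c : Cocone ((OpenNhds.inclusion x).op ⋙ F) :=
    { pt := T
      ι := { app := fun U => k U.unop.1 U.unop.2
             naturality := fun U V i =>
              (hk U.unop.1 V.unop.1 ((OpenNhds.inclusion x).map i.unop) V.unop.2).trans
                (Category.comp_id _).symm } }
  exact ⟨colimit.desc _ c, fun U hx => colimit.ι_desc c (op ⟨U, hx⟩)⟩

variable {C : Type (u + 1)} [Category.{u} C] [HasColimits C] [HasTerminal C]
  {X : TopCat.{u}} [HasWeakSheafify (Opens.grothendieckTopology X) C] (F : TopCat.Presheaf C X)

/-- The universal property of the stalk of a sheafification. -/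
theorem exists_stalk_sheafify_lift (x : X) {T : C}
    (k : ∀ U : Opens X, x ∈ U → (F.obj (op U) ⟶ T))
    (hk : ∀ (U V : Opens X) (i : V ⟶ U) (hx : x ∈ V),
      F.map i.op ≫ k V hx = k U (i.le hx)) :
    ∃ K : TopCat.Presheaf.stalk (C := C)
        (CategoryTheory.sheafify (Opens.grothendieckTopology X) F) x ⟶ T,
      ∀ U hx, (CategoryTheory.toSheafify (Opens.grothendieckTopology X) F).app (op U) ≫
        TopCat.Presheaf.germ (C := C)
          (CategoryTheory.sheafify (Opens.grothendieckTopology X) F) U x hx ≫ K = k U hx := by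
  obtain ⟨K, hK⟩ := exists_stalk_lift F x k hk
  have := TopCat.Presheaf.stalkFunctor_map_unit_toSheafify_isIso x C F
  let e := asIso ((TopCat.Presheaf.stalkFunctor C x).map
    (CategoryTheory.toSheafify (Opens.grothendieckTopology X) F))
  refine ⟨e.inv ≫ K, fun U hx => ?_⟩
  have h : _ ≫ e.hom = _ ≫ _ := TopCat.Presheaf.stalkFunctor_map_germ U x hx
    (CategoryTheory.toSheafify (Opens.grothendieckTopology X) F)
  refine (Category.assoc _ _ _).symm.trans ((congrArg (· ≫ e.inv ≫ K) h.symm).trans ?_)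
  refine (Category.assoc _ _ _).trans (Eq.trans ?_ (hK U hx))
  exact congrArg (F.germ U x hx ≫ ·) (e.hom_inv_id_assoc K)

variable {FC : C → C → Type*} {CC : C → Type u} [∀ X Y, FunLike (FC X Y) (CC X) (CC Y)]
  [instCC : ConcreteCategory.{u} C FC] [PreservesFilteredColimits (CategoryTheory.forget C)]

/-- Every germ of a sheafification comes from the presheaf. -/
theorem exists_germ_toSheafify_eq (x : X)
    (t : ToType (TopCat.Presheaf.stalk (C := C)
      (CategoryTheory.sheafify (Opens.grothendieckTopology X) F) x)) :
    ∃ (U : Opens X) (hx : x ∈ U) (s : ToType (F.obj (op U))),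
      (TopCat.Presheaf.germ (C := C)
        (CategoryTheory.sheafify (Opens.grothendieckTopology X) F) U x hx)
        ((CategoryTheory.toSheafify (Opens.grothendieckTopology X) F).app (op U) s) = t := by
  have := TopCat.Presheaf.stalkFunctor_map_unit_toSheafify_isIso x C F
  let e := asIso ((TopCat.Presheaf.stalkFunctor C x).map
    (CategoryTheory.toSheafify (Opens.grothendieckTopology X) F))
  obtain ⟨U, hx, s, hs⟩ := TopCat.Presheaf.exists_germ_eq F (e.inv t)
  refine ⟨U, hx, s, ?_⟩
  refine (TopCat.Presheaf.stalkFunctor_map_germ_apply U x hx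
    (CategoryTheory.toSheafify (Opens.grothendieckTopology X) F) s).symm.trans ?_
  exact (congrArg e.hom hs).trans (Iso.inv_hom_id_apply e t)

end sheafification

/-! ### Stalks of sheaves of modules -/

section modules

variable {X : Scheme.{u}} (E : X.Modules)

/-- The stalk of a sheaf of modules. -/
abbrev modStalk (x : X) : Ab.{u} := TopCat.Presheaf.stalk (C := Ab.{u}) (X := X) E.presheaf x

instance modStalkModule (x : X) : Module (X.presheaf.stalk x) (modStalk E x) :=
  PresheafOfModules.instModuleCarrierStalkCommRingCatCarrierAbPresheafOpensCarrier (R := X.presheaf)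
    E.val x

/-- The germ of a function. -/
def strGerm (U : X.Opens) (x : X) (hx : x ∈ U) : Γ(X, U) →+* X.presheaf.stalk x :=
  (X.presheaf.germ U x hx).hom

/-- The germ of a section of a sheaf of modules. -/
def modGerm (U : X.Opens) (x : X) (hx : x ∈ U) : Γ(E, U) →+ modStalk E x :=
  (TopCat.Presheaf.germ (C := Ab.{u}) (X := X) E.presheaf U x hx).hom

theorem modGerm_res {U V : X.Opens} (i : V ≤ U) (x : X) (hx : x ∈ V) (m : Γ(E, U)) :
    modGerm E V x hx (E.presheaf.map (homOfLE i).op m) = modGerm E U x (i hx) m :=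
  TopCat.Presheaf.germ_res_apply (C := Ab.{u}) (X := X) E.presheaf (homOfLE i) x hx m

theorem modGerm_smul (U : X.Opens) (x : X) (hx : x ∈ U) (s : Γ(X, U)) (m : Γ(E, U)) :
    modGerm E U x hx (s • m) =
      strGerm U x hx s • modGerm E U x hx m :=
  PresheafOfModules.germ_smul (R := X.presheaf) E.val x U hx s m

theorem exists_modGerm_eq (x : X) (t : modStalk E x) :
    ∃ (U : X.Opens) (hx : x ∈ U) (m : Γ(E, U)), modGerm E U x hx m = t :=
  TopCat.Presheaf.exists_germ_eq (C := Ab.{u}) (X := X) E.presheaf t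

variable {E} {E' : X.Modules} (ψ : E ⟶ E')

/-- The map of stalks induced by a homomorphism of sheaves of modules. -/
def modStalkMap (x : X) : modStalk E x →+ modStalk E' x :=
  ((TopCat.Presheaf.stalkFunctor Ab.{u} (X := X) x).map ψ.mapPresheaf).hom

theorem modStalkMap_modGerm (U : X.Opens) (x : X) (hx : x ∈ U) (m : Γ(E, U)) :
    modStalkMap ψ x (modGerm E U x hx m) = modGerm E' U x hx (ψ.app U m) :=
  TopCat.Presheaf.stalkFunctor_map_germ_apply U x hx ψ.mapPresheaf m

theorem isIso_of_modStalkMap_bijective (h : ∀ x, Function.Bijective (modStalkMap ψ x)) :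
    IsIso ψ := by
  refine Scheme.Modules.Hom.isIso_iff_isIso_app.mpr fun U => ?_
  have h1 := TopCat.Presheaf.app_bijective_of_stalkFunctor_map_bijective (C := Ab.{u}) (X := X)
    (F := ⟨E.presheaf, E.isSheaf⟩) (G := ⟨E'.presheaf, E'.isSheaf⟩) ⟨ψ.mapPresheaf⟩ U
    (fun x _ => h x)
  exact (ConcreteCategory.isIso_iff_bijective (ψ.app U)).mpr h1

theorem exists_modStalk_lift (E : X.Modules) (x : X) {T : Type u} [AddCommGroup T]
    (k : ∀ U : X.Opens, x ∈ U → Γ(E, U) →+ T)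
    (hk : ∀ (U V : X.Opens) (i : V ≤ U) (hx : x ∈ V) (m : Γ(E, U)),
      k V hx (E.presheaf.map (homOfLE i).op m) = k U (i hx) m) :
    ∃ K : modStalk E x →+ T, ∀ U hx m, K (modGerm E U x hx m) = k U hx m := by
  obtain ⟨K, hK⟩ := exists_stalk_lift (C := Ab.{u}) (X := X) E.presheaf x (T := AddCommGrpCat.of T)
    (fun U hx => AddCommGrpCat.ofHom (k U hx))
    (fun U V i hx => AddCommGrpCat.hom_ext (AddMonoidHom.ext (hk U V i.le hx)))
  exact ⟨K.hom, fun U hx m => congrArg (fun q => q m) (hK U hx)⟩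

variable (M : X.PresheafOfModules)

theorem toSheafifyModule_res {U V : X.Opens} (i : V ≤ U) (m : M.presheaf.obj (op U)) :
    toSheafifyModule M V (M.presheaf.map (homOfLE i).op m) =
      (sheafifyModule M).presheaf.map (homOfLE i).op (toSheafifyModule M U m) :=
  congrArg (fun q => q m) ((toSheafify (Opens.grothendieckTopology X) M.presheaf).naturality
    (homOfLE i).op)

theorem toSheafifyModule_smul (U : X.Opens) (s : X.ringCatSheaf.obj.obj (op U)) (m : M.obj (op U)) :
    toSheafifyModule M U (s • m) =
      HSMul.hSMul (α := Γ(X, U)) s (toSheafifyModule M U m) :=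
  (((PresheafOfModules.sheafificationAdjunction (𝟙 X.ringCatSheaf.obj)).unit.app M).app
    (op U)).hom.map_smul s m

theorem exists_modGerm_toSheafifyModule_eq (x : X) (t : modStalk (sheafifyModule M) x) :
    ∃ (U : X.Opens) (hx : x ∈ U) (m : M.presheaf.obj (op U)),
      modGerm (sheafifyModule M) U x hx (toSheafifyModule M U m) = t :=
  exists_germ_toSheafify_eq (C := Ab.{u}) (X := X) M.presheaf x t

theorem exists_modStalk_sheafify_lift (x : X) {T : Type u} [AddCommGroup T]
    (k : ∀ U : X.Opens, x ∈ U → M.presheaf.obj (op U) →+ T)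
    (hk : ∀ (U V : X.Opens) (i : V ≤ U) (hx : x ∈ V) (m : M.presheaf.obj (op U)),
      k V hx (M.presheaf.map (homOfLE i).op m) = k U (i hx) m) :
    ∃ K : modStalk (sheafifyModule M) x →+ T,
      ∀ U hx m, K (modGerm _ U x hx (toSheafifyModule M U m)) = k U hx m := by
  obtain ⟨K, hK⟩ := exists_stalk_sheafify_lift (C := Ab.{u}) (X := X) M.presheaf x
    (T := AddCommGrpCat.of T) (fun U hx => AddCommGrpCat.ofHom (k U hx))
    (fun U V i hx => AddCommGrpCat.hom_ext (AddMonoidHom.ext (hk U V i.le hx)))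
  exact ⟨K.hom, fun U hx m => congrArg (fun q => q m) (hK U hx)⟩

/-- Homomorphisms from a presheaf of modules to a sheaf of modules extend to the associated
sheaf. -/
theorem exists_sheafifyModule_lift (k : M ⟶ E.val) :
    ∃ ψ : sheafifyModule M ⟶ E, ∀ (U : X.Opens) (m : M.obj (op U)),
      ψ.app U (toSheafifyModule M U m) = (k.app (op U)).hom m := by
  let ψ : (PresheafOfModules.sheafification (𝟙 X.ringCatSheaf.obj)).obj M ⟶ E :=
    (PresheafOfModules.sheafificationHomEquiv (F := E) (𝟙 X.ringCatSheaf.obj)).symm k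
  refine ⟨ψ, fun U m => ?_⟩
  have h := PresheafOfModules.toPresheaf_map_sheafificationHomEquiv_def (𝟙 X.ringCatSheaf.obj) ψ
  have h' : PresheafOfModules.sheafificationHomEquiv (F := E) (𝟙 X.ringCatSheaf.obj) ψ = k :=
    Equiv.apply_symm_apply _ _
  rw [h'] at h
  exact (congrArg (fun q => (q.app (op U)) m) h).symm

variable {Y : Scheme.{u}} (f : X ⟶ Y)

theorem omegaD_res {U V : X.Opens} (i : V ≤ U) (s : Γ(X, U)) :
    omegaD f V (X.presheaf.map (homOfLE i).op s) =
      (Omega f).presheaf.map (homOfLE i).op (omegaD f U s) :=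
  (congrArg (toSheafifyModule (preOmega f) V)
    (PresheafOfModules.DifferentialsConstruction.relativeDifferentials'_map_d
      (S' := ((inverseImage f).obj Y.sheaf).obj) (R := X.presheaf) (invSharp f).hom
      (homOfLE i).op s)).symm.trans (toSheafifyModule_res (preOmega f) i _)

/-- The universal property of the sheaf of relative differentials. -/
theorem exists_omega_lift (E : X.Modules) (D : ∀ U : X.Opens, Γ(X, U) →+ Γ(E, U))
    (hmul : ∀ U s t, D U (s * t) = s • D U t + t • D U s)
    (hres : ∀ (U V : X.Opens) (i : V ≤ U) (s : Γ(X, U)),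
      D V (X.presheaf.map (homOfLE i).op s) = E.presheaf.map (homOfLE i).op (D U s))
    (hD : ∀ (U : X.Opens) (a : ((inverseImage f).obj Y.sheaf).obj.obj (op U)),
      D U ((invSharp f).hom.app (op U) a) = 0) :
    ∃ ψ : Omega f ⟶ E, ∀ (U : X.Opens) (s : Γ(X, U)), ψ.app U (omegaD f U s) = D U s := by
  let d' : PresheafOfModules.Derivation' (S' := ((inverseImage f).obj Y.sheaf).obj)
      (R := X.presheaf) E.val (invSharp f).hom :=
    { d := fun {U} => D U.unop
      d_mul := fun {U} a b => hmul U.unop a b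
      d_map := fun {U V} i s => hres U.unop V.unop i.unop.le s
      d_app := fun {U} a => hD U.unop a }
  obtain ⟨ψ, hψ⟩ := exists_sheafifyModule_lift (preOmega f)
    ((PresheafOfModules.DifferentialsConstruction.isUniversal'
      (S' := ((inverseImage f).obj Y.sheaf).obj) (R := X.presheaf) (invSharp f).hom).desc d')
  refine ⟨ψ, fun U s => (hψ U _).trans ?_⟩
  exact PresheafOfModules.Derivation.congr_d
    ((PresheafOfModules.DifferentialsConstruction.isUniversal'
      (S' := ((inverseImage f).obj Y.sheaf).obj) (R := X.presheaf) (invSharp f).hom).fac d')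
    (X := op U) s

theorem omegaD_add (U : X.Opens) (s t : Γ(X, U)) :
    omegaD f U (s + t) = omegaD f U s + omegaD f U t :=
  (congrArg (toSheafifyModule (preOmega f) U)
    ((CommRingCat.KaehlerDifferential.D ((invSharp f).hom.app (op U))).d_add
      (b := s) (b' := t))).trans (map_add _ _ _)

theorem omegaD_mul (U : X.Opens) (s t : Γ(X, U)) :
    omegaD f U (s * t) = s • omegaD f U t + t • omegaD f U s := by
  have h := (CommRingCat.KaehlerDifferential.D ((invSharp f).hom.app (op U))).d_mul s t
  refine (congrArg (toSheafifyModule (preOmega f) U) h).trans ((map_add _ _ _).trans ?_)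
  exact congrArg₂ (· + ·) (toSheafifyModule_smul (preOmega f) U s _)
    (toSheafifyModule_smul (preOmega f) U t _)

theorem omegaD_invSharp (U : X.Opens) (a : ((inverseImage f).obj Y.sheaf).obj.obj (op U)) :
    omegaD f U ((invSharp f).hom.app (op U) a) = 0 := by
  have h := (CommRingCat.KaehlerDifferential.D ((invSharp f).hom.app (op U))).d_map a
  exact (congrArg (toSheafifyModule (preOmega f) U) h).trans (map_zero _)

theorem kaehlerDifferential_induction {A B : CommRingCat.{u}} (φ : A ⟶ B)
    {P : CommRingCat.KaehlerDifferential φ → Prop} (h0 : P 0)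
    (hadd : ∀ a b, P a → P b → P (a + b))
    (hsmul : ∀ s t : B, P (s • CommRingCat.KaehlerDifferential.d (f := φ) t))
    (m : CommRingCat.KaehlerDifferential φ) : P m := by
  let := φ.hom.toAlgebra
  have hm : m ∈ Submodule.span B (Set.range (KaehlerDifferential.D A B)) := by
    rw [KaehlerDifferential.span_range_derivation]
    trivial
  induction hm using Submodule.closure_induction with
  | zero => exact h0
  | add a b _ _ ha hb => exact hadd a b ha hb
  | smul_mem s a ha =>
    obtain ⟨t, rfl⟩ := ha
    exact hsmul s t

/-- The stalks of `Ω_f` are generated by differentials. -/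
theorem modStalk_omega_induction (x : X) {P : modStalk (Omega f) x → Prop} (h0 : P 0)
    (hadd : ∀ a b, P a → P b → P (a + b))
    (hsmul : ∀ (U : X.Opens) (hx : x ∈ U) (s t : Γ(X, U)),
      P (modGerm (Omega f) U x hx (s • omegaD f U t)))
    (ω : modStalk (Omega f) x) : P ω := by
  obtain ⟨U, hx, m, rfl⟩ := exists_modGerm_toSheafifyModule_eq (preOmega f) x ω
  let k : CommRingCat.KaehlerDifferential ((invSharp f).hom.app (op U)) →+ modStalk (Omega f) x :=
    (modGerm (Omega f) U x hx).comp (toSheafifyModule (preOmega f) U).hom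
  refine kaehlerDifferential_induction ((invSharp f).hom.app (op U))
    (P := fun m => P (k m)) ?_ (fun a b ha hb => ?_) (fun s t => ?_) m
  · exact (congrArg P (map_zero k)).mpr h0
  · exact (congrArg P (map_add k a b)).mpr (hadd _ _ ha hb)
  · have h := toSheafifyModule_smul (preOmega f) U s
      (CommRingCat.KaehlerDifferential.d (f := (invSharp f).hom.app (op U)) t)
    exact (congrArg (fun q => P (modGerm (Omega f) U x hx q)) h).mpr (hsmul U hx s t)

theorem exists_strGerm_eq (x : X) (a : X.presheaf.stalk x) :
    ∃ (U : X.Opens) (hx : x ∈ U) (s : Γ(X, U)), strGerm U x hx s = a :=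
  exists_germAt_eq X.sheaf x a

theorem strGerm_res {U V : X.Opens} (i : V ≤ U) (x : X) (hx : x ∈ V) (s : Γ(X, U)) :
    strGerm V x hx (X.presheaf.map (homOfLE i).op s) = strGerm U x (i hx) s :=
  germAt_res X.sheaf i x hx s

/-- Two germs of functions are germs of sections over a common neighbourhood. -/
theorem exists_strGerm_eq₂ (x : X) (a b : X.presheaf.stalk x) :
    ∃ (U : X.Opens) (hx : x ∈ U) (s t : Γ(X, U)), strGerm U x hx s = a ∧ strGerm U x hx t = b := by
  obtain ⟨U, hU, s, rfl⟩ := exists_strGerm_eq x a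
  obtain ⟨V, hV, t, rfl⟩ := exists_strGerm_eq x b
  exact ⟨U ⊓ V, ⟨hU, hV⟩, X.presheaf.map (homOfLE inf_le_left).op s,
    X.presheaf.map (homOfLE inf_le_right).op t, strGerm_res inf_le_left x _ s,
    strGerm_res inf_le_right x _ t⟩

theorem exists_strGerm_modGerm_eq (E : X.Modules) (x : X) (a : X.presheaf.stalk x)
    (m : modStalk E x) : ∃ (U : X.Opens) (hx : x ∈ U) (s : Γ(X, U)) (m' : Γ(E, U)),
      strGerm U x hx s = a ∧ modGerm E U x hx m' = m := by
  obtain ⟨U, hU, s, rfl⟩ := exists_strGerm_eq x a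
  obtain ⟨V, hV, m, rfl⟩ := exists_modGerm_eq E x m
  exact ⟨U ⊓ V, ⟨hU, hV⟩, X.presheaf.map (homOfLE inf_le_left).op s,
    E.presheaf.map (homOfLE inf_le_right).op m, strGerm_res inf_le_left x _ s,
    modGerm_res E inf_le_right x _ m⟩

theorem modStalkMap_smul {E E' : X.Modules} (ψ : E ⟶ E') (x : X) (a : X.presheaf.stalk x)
    (m : modStalk E x) : modStalkMap ψ x (a • m) = a • modStalkMap ψ x m := by
  obtain ⟨U, hx, s, m, rfl, rfl⟩ := exists_strGerm_modGerm_eq E x a m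
  rw [← modGerm_smul, modStalkMap_modGerm, modStalkMap_modGerm, Scheme.Modules.Hom.app_smul,
    modGerm_smul]

/-- The derivation on the stalks of the structure sheaf with values in the stalks of `Ω_f`. -/
theorem exists_stalk_derivation (x : X) :
    ∃ D : X.presheaf.stalk x →+ modStalk (Omega f) x,
      (∀ U hx s, D (strGerm U x hx s) = modGerm (Omega f) U x hx (omegaD f U s)) ∧
      (∀ s t, D (s * t) = s • D t + t • D s) ∧ ∀ a, D ((f.stalkMap x).hom a) = 0 := by
  -- Each germ receives a chosen representative, and `key` shows that the value is independent of
  -- it. Additivity and the Leibniz rule can then be checked on sections over a common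
  -- neighbourhood.
  choose U hx s hs using exists_strGerm_eq (X := X) x
  have key : ∀ V (hV : x ∈ V) (t : Γ(X, V)), modGerm (Omega f) (U (strGerm V x hV t)) x (hx _)
      (omegaD f _ (s (strGerm V x hV t))) = modGerm (Omega f) V x hV (omegaD f V t) := by
    intro V hV t
    obtain ⟨W, hW, i, j, hij⟩ := TopCat.Presheaf.germ_eq (C := CommRingCat.{u}) (X := X)
      X.presheaf x (hx _) hV _ _ (hs (strGerm V x hV t))
    rw [← modGerm_res (Omega f) i.le x hW, ← modGerm_res (Omega f) j.le x hW, ← omegaD_res,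
      ← omegaD_res]
    exact congrArg (fun q => modGerm (Omega f) W x hW (omegaD f W q)) hij
  refine ⟨AddMonoidHom.mk' (fun a => modGerm (Omega f) (U a) x (hx a) (omegaD f _ (s a)))
    fun a b => ?_, fun V hV t => key V hV t, fun a b => ?_, fun a => ?_⟩
  · obtain ⟨V, hV, s, t, rfl, rfl⟩ := exists_strGerm_eq₂ x a b
    rw [← map_add, key, key, key, omegaD_add, map_add]
  · obtain ⟨V, hV, s, t, rfl, rfl⟩ := exists_strGerm_eq₂ x a b
    rw [← map_mul]
    simp only [AddMonoidHom.mk'_apply]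
    rw [key, key, key, omegaD_mul, map_add, modGerm_smul, modGerm_smul]
  · obtain ⟨V, hV, c, rfl⟩ := exists_strGerm_eq (X := Y) (f x) a
    have h1 : (f.stalkMap x).hom (strGerm V (f x) hV c) =
        strGerm (f ⁻¹ᵁ V) x hV ((invSharp f).hom.app (op (f ⁻¹ᵁ V))
          (inverseImageSection f Y.sheaf V c)) :=
      (Scheme.Hom.germ_stalkMap_apply f V x hV c).trans
        (congrArg (strGerm (f ⁻¹ᵁ V) x hV) (invSharp_inverseImageSection f V c).symm)
    rw [h1]
    refine (key _ _ _).trans ?_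
    exact (congrArg _ (omegaD_invSharp f _ _)).trans (map_zero _)

end modules

/-! ### Derivations and the kernel of multiplication -/

section derivation

variable {p : ℕ} {S R A N : Type u} [CommRing S] [CommRing R] [CommRing A]
  [AddCommGroup N] [Module R N] {g : S →+* R} {l r : R →+* A} {ε : A →+* R}

/-- A derivation `D` of `R` over `S` induces a linear map on the kernel of multiplication, sending
`1 ⊗ s - s ⊗ 1` to `D s`. -/
theorem IsFrobPushout.exists_addHom_of_derivation (h : IsFrobPushout p g l r)
    (hp0 : (p : R) = 0) (hεl : ε.comp l = RingHom.id R) (hεr : ε.comp r = RingHom.id R)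
    (D : R →+ N) (hmul : ∀ s t, D (s * t) = s • D t + t • D s) (hD : ∀ a, D (g a) = 0) :
    ∃ d : RingHom.ker ε →+ N, (∀ b z, d (b • z) = ε b • d z) ∧
      ∀ (z : RingHom.ker ε) (s : R), (z : A) = r s - l s → d z = D s := by
  -- Square-zero extensions are formed from bimodules; the right action is declared to be the left
  -- one.
  let : Module Rᵐᵒᵖ N := Module.compHom N ((RingHom.id R).fromOpposite mul_comm)
  have : IsCentralScalar R N := ⟨fun _ _ => rfl⟩
  have hD1 : D 1 = 0 := by simpa using hmul 1 1
  let w : R →+* TrivSqZeroExt R N :=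
    { toFun s := TrivSqZeroExt.inl s + TrivSqZeroExt.inr (D s)
      map_one' := by ext <;> simp [hD1]
      map_zero' := by ext <;> simp
      map_add' s t := by ext <;> simp
      map_mul' s t := by ext <;> simp [hmul, add_comm] }
  obtain ⟨ψ, h1, h2⟩ := h.exists_desc (TrivSqZeroExt.inlHom R N) w
    (RingHom.ext fun a => by ext <;> simp [w, hD])
    (fun s => by
      ext
      · simp [w]
      -- The second component of `(s + Ds)ᵖ` is `p sᵖ⁻¹ Ds`, which is zero, so `w` and the inclusion
      -- of `R` have the same `p`-th powers.
      · have h0 : (p : R) • (s ^ p.pred • D s) = 0 := by rw [hp0, zero_smul]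
        rw [TrivSqZeroExt.snd_pow, TrivSqZeroExt.snd_pow]
        simpa [w, Nat.cast_smul_eq_nsmul] using h0.symm)
  have h3 (a : A) : (ψ a).fst = ε a := by
    have h4 : (TrivSqZeroExt.fstHom R R N).toRingHom.comp ψ = ε := by
      refine h.hom_ext _ _ ?_ ?_
      · rw [RingHom.comp_assoc, h1, hεl]
        rfl
      · rw [RingHom.comp_assoc, h2, hεr]
        ext s
        simp [w]
    exact congrArg (fun q => q a) h4
  refine ⟨AddMonoidHom.mk' (fun z => (ψ z).snd) fun z z' => by simp, fun b z => ?_,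
    fun z s hz => ?_⟩
  -- The first component of `ψ` is `ε`, which vanishes on `z`, so only `ε b • (ψ z).snd` survives in
  -- the product.
  · have h4 : ε z = 0 := z.2
    simp [h3, h4]
  · have h5 : ψ (r s) = w s := congrArg (fun q => q s) h2
    have h6 : ψ (l s) = TrivSqZeroExt.inl s := congrArg (fun q => q s) h1
    simp [hz, h5, h6, w]

end derivation

/-! ### Stalks of augmented sheaves of algebras -/

theorem natCast_stalk_eq_zero (p : ℕ) (X : Scheme.{u}) [IsOfChar p X] (x : X) :
    (p : X.presheaf.stalk x) = 0 := by
  have h := congrArg (strGerm ⊤ x trivial) (IsOfChar.cast_eq_zero p X ⊤)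
  rwa [map_natCast, map_zero] at h

section augmented

variable {X : Scheme.{u}} {A : Under X.sheaf} (ε : A ⟶ Under.mk (𝟙 X.sheaf))

/-- The structure homomorphism of the stalk of a sheaf of algebras. -/
def algStalk (A : Under X.sheaf) (x : X) : X.presheaf.stalk x →+* stalkRing A.right x :=
  stalkHom A.hom x

/-- The augmentation of the stalk. -/
def augStalk (x : X) : stalkRing A.right x →+* X.presheaf.stalk x :=
  stalkHom ε.right x

/-- The structure homomorphism of sections of a sheaf of algebras. -/
def algSection (A : Under X.sheaf) (U : X.Opens) : Γ(X, U) →+* A.right.obj.obj (op U) :=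
  (A.hom.hom.app (op U)).hom

/-- The augmentation on sections. -/
def augSection (U : X.Opens) : A.right.obj.obj (op U) →+* Γ(X, U) :=
  (ε.right.hom.app (op U)).hom

theorem augSection_algSection (U : X.Opens) (s : Γ(X, U)) :
    augSection ε U (algSection A U s) = s :=
  congrArg (fun q => (q.hom.app (op U)).hom s) (Under.w ε)

theorem algStalk_strGerm (U : X.Opens) (x : X) (hx : x ∈ U) (s : Γ(X, U)) :
    algStalk A x (strGerm U x hx s) = germAt A.right U x hx (algSection A U s) :=
  stalkHom_germAt A.hom U x hx s

theorem augStalk_germAt (U : X.Opens) (x : X) (hx : x ∈ U) (a : A.right.obj.obj (op U)) :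
    augStalk ε x (germAt A.right U x hx a) = strGerm U x hx (augSection ε U a) :=
  stalkHom_germAt ε.right U x hx a

theorem augStalk_comp_algStalk (x : X) : (augStalk ε x).comp (algStalk A x) = RingHom.id _ := by
  refine RingHom.ext fun a => ?_
  obtain ⟨U, hx, s, rfl⟩ := exists_strGerm_eq x a
  rw [RingHom.comp_apply, algStalk_strGerm, augStalk_germAt, augSection_algSection]
  rfl

/-- The restriction maps of the kernel of an augmentation. -/
def augRes {U V : X.Opens} (i : V ≤ U) (z : augIdeal ε (op U)) : augIdeal ε (op V) :=
  ⟨A.right.obj.map (homOfLE i).op z, augIdeal_le ε (homOfLE i).op z.2⟩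

/-- The germ of a section of the kernel of an augmentation. -/
def augGerm (U : X.Opens) (x : X) (hx : x ∈ U) : augIdeal ε (op U) →+ RingHom.ker (augStalk ε x) :=
  AddMonoidHom.mk' (fun z => ⟨germAt A.right U x hx z, by
    have h : augSection ε U z = 0 := z.2
    rw [RingHom.mem_ker, augStalk_germAt, h, map_zero]⟩) fun z z' => Subtype.ext (map_add _ _ _)

theorem augGerm_res {U V : X.Opens} (i : V ≤ U) (x : X) (hx : x ∈ V) (z : augIdeal ε (op U)) :
    augGerm ε V x hx (augRes ε i z) = augGerm ε U x (i hx) z :=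
  Subtype.ext (germAt_res A.right i x hx z.1)

/-- If the germ of `a` is in the kernel, the augmentation of `a` vanishes after shrinking the
neighbourhood. -/
theorem exists_augGerm_eq (x : X) (z : RingHom.ker (augStalk ε x)) :
    ∃ (U : X.Opens) (hx : x ∈ U) (y : augIdeal ε (op U)), augGerm ε U x hx y = z := by
  obtain ⟨z, hz⟩ := z
  obtain ⟨U, hx, a, rfl⟩ := exists_germAt_eq A.right x z
  rw [RingHom.mem_ker, augStalk_germAt, ← map_zero (strGerm U x hx)] at hz
  obtain ⟨V, i, hV, h⟩ := exists_res_eq_of_germAt_eq X.sheaf hx hz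
  have h1 : augSection ε V (A.right.obj.map (homOfLE i).op a) = 0 :=
    (congrArg (fun q => q.hom a) (ε.right.hom.naturality (homOfLE i).op)).trans
      (h.trans (map_zero (X.presheaf.map (homOfLE i).op).hom))
  exact ⟨V, hV, ⟨_, h1⟩, Subtype.ext (germAt_res A.right i x hV a)⟩

theorem exists_augRes_eq_of_augGerm_eq {U V : X.Opens} {x : X} (hU : x ∈ U) (hV : x ∈ V)
    {y : augIdeal ε (op U)} {z : augIdeal ε (op V)} (h : augGerm ε U x hU y = augGerm ε V x hV z) :
    ∃ (W : X.Opens) (i : W ≤ U) (j : W ≤ V), x ∈ W ∧ augRes ε i y = augRes ε j z := by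
  obtain ⟨W, hW, i, j, hij⟩ := TopCat.Presheaf.germ_eq (C := CommRingCat.{u}) (X := X)
      A.right.obj x hU hV y.1 z.1 (congrArg Subtype.val h)
  exact ⟨W, i.le, j.le, hW, Subtype.ext hij⟩

/-- Two germs are germs of sections over a common neighbourhood. -/
theorem exists_augGerm_eq₂ (x : X) (y z : RingHom.ker (augStalk ε x)) :
    ∃ (U : X.Opens) (hx : x ∈ U) (y' z' : augIdeal ε (op U)),
      augGerm ε U x hx y' = y ∧ augGerm ε U x hx z' = z := by
  obtain ⟨U, hU, y, rfl⟩ := exists_augGerm_eq ε x y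
  obtain ⟨V, hV, z, rfl⟩ := exists_augGerm_eq ε x z
  exact ⟨U ⊓ V, ⟨hU, hV⟩, augRes ε inf_le_left y, augRes ε inf_le_right z,
    augGerm_res ε inf_le_left x _ y, augGerm_res ε inf_le_right x _ z⟩

/-! ### Sections and stalks of the conormal sheaf -/

theorem conormalMk_res {U V : X.Opens} (i : V ≤ U) (z : augIdeal ε (op U)) :
    conormalMk ε V (augRes ε i z) =
      (conormal ε).presheaf.map (homOfLE i).op (conormalMk ε U z) :=
  toSheafifyModule_res (preConormal ε) i ((augIdeal ε (op U)).toCotangent z)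

theorem conormalMk_add (U : X.Opens) (y z : augIdeal ε (op U)) :
    conormalMk ε U (y + z) = conormalMk ε U y + conormalMk ε U z :=
  (congrArg (toSheafifyModule (preConormal ε) U)
    (map_add (augIdeal ε (op U)).toCotangent y z)).trans
    (map_add (toSheafifyModule (preConormal ε) U).hom _ _)

/-- All of `A`, and not only `𝒪_X`, acts on `I / I²` through the augmentation: `a` and the image of
its augmentation differ by an element of `I`. -/
theorem conormalMk_smul (U : X.Opens) (a : A.right.obj.obj (op U)) (z : augIdeal ε (op U)) :
    conormalMk ε U (a • z) = augSection ε U a • conormalMk ε U z := by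
  have h1 : (augIdeal ε (op U)).toCotangent (a • z) =
      (augIdeal ε (op U)).toCotangent (algSection A U (augSection ε U a) • z) := by
    refine (Ideal.toCotangent_eq _).mpr ?_
    have h2 : a - algSection A U (augSection ε U a) ∈ augIdeal ε (op U) := by
      refine (map_sub (augSection ε U) _ _).trans ?_
      rw [augSection_algSection]
      exact sub_self _
    rw [pow_two]
    have h3 := Ideal.mul_mem_mul h2 z.2
    rwa [sub_mul] at h3
  exact (congrArg (toSheafifyModule (preConormal ε) U) h1).trans
    (toSheafifyModule_smul (preConormal ε) U (augSection ε U a)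
      ((augIdeal ε (op U)).toCotangent z))

/-- The map from the kernel of the augmentation of the stalk to the stalk of the conormal sheaf. -/
theorem exists_stalk_conormalMk (x : X) :
    ∃ c : RingHom.ker (augStalk ε x) →+ modStalk (conormal ε) x,
      (∀ U hx z, c (augGerm ε U x hx z) = modGerm (conormal ε) U x hx (conormalMk ε U z)) ∧
      (∀ b z, c (b • z) = augStalk ε x b • c z) ∧ Function.Surjective c := by
  choose U hx y hy using exists_augGerm_eq ε x
  have key : ∀ V (hV : x ∈ V) (z : augIdeal ε (op V)),
      modGerm (conormal ε) (U (augGerm ε V x hV z)) x (hx _)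
        (conormalMk ε _ (y (augGerm ε V x hV z))) =
      modGerm (conormal ε) V x hV (conormalMk ε V z) := by
    intro V hV z
    obtain ⟨W, i, j, hW, hij⟩ := exists_augRes_eq_of_augGerm_eq ε (hx _) hV
      (hy (augGerm ε V x hV z))
    rw [← modGerm_res (conormal ε) i x hW, ← modGerm_res (conormal ε) j x hW, ← conormalMk_res,
      ← conormalMk_res, hij]
  obtain ⟨c, hc⟩ : ∃ c : RingHom.ker (augStalk ε x) →+ modStalk (conormal ε) x,
      ∀ U hx z, c (augGerm ε U x hx z) = modGerm (conormal ε) U x hx (conormalMk ε U z) := by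
    refine ⟨AddMonoidHom.mk' (fun a => modGerm (conormal ε) (U a) x (hx a) (conormalMk ε _ (y a)))
      fun a b => ?_, key⟩
    obtain ⟨V, hV, s, t, rfl, rfl⟩ := exists_augGerm_eq₂ ε x a b
    rw [← map_add, key, key, key, conormalMk_add, map_add]
  refine ⟨c, hc, fun b z => ?_, fun m => ?_⟩
  · obtain ⟨V, hV, z, rfl⟩ := exists_augGerm_eq ε x z
    obtain ⟨W, hW, b, rfl⟩ := exists_germAt_eq A.right x b
    let b' := A.right.obj.map (homOfLE (inf_le_left : W ⊓ V ≤ W)).op b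
    have h1 : germAt A.right W x hW b = germAt A.right (W ⊓ V) x ⟨hW, hV⟩ b' :=
      (germAt_res A.right inf_le_left x ⟨hW, hV⟩ b).symm
    have h2 : augGerm ε V x hV z = augGerm ε (W ⊓ V) x ⟨hW, hV⟩ (augRes ε inf_le_right z) :=
      (augGerm_res ε inf_le_right x ⟨hW, hV⟩ z).symm
    have h3 : germAt A.right (W ⊓ V) x ⟨hW, hV⟩ b' •
          augGerm ε (W ⊓ V) x ⟨hW, hV⟩ (augRes ε inf_le_right z) =
        augGerm ε (W ⊓ V) x ⟨hW, hV⟩ (b' • augRes ε inf_le_right z) :=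
      Subtype.ext (map_mul (germAt A.right (W ⊓ V) x ⟨hW, hV⟩) _ _).symm
    have h4 := congrArg (modGerm (conormal ε) (W ⊓ V) x ⟨hW, hV⟩)
      (conormalMk_smul ε (W ⊓ V) b' (augRes ε inf_le_right z))
    rw [h2, h1, h3]
    refine (hc _ _ _).trans (h4.trans ((modGerm_smul _ _ _ _ _ _).trans ?_))
    exact congrArg₂ (· • ·) (augStalk_germAt ε (W ⊓ V) x ⟨hW, hV⟩ b').symm (hc _ _ _).symm
  · obtain ⟨V, hV, m, rfl⟩ := exists_modGerm_toSheafifyModule_eq (preConormal ε) x m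
    obtain ⟨z, rfl⟩ := (augIdeal ε (op V)).toCotangent_surjective m
    exact ⟨augGerm ε V x hV z, hc V hV z⟩

/-- Additive maps out of a stalk of the conormal sheaf. -/
theorem exists_stalk_conormal_lift (x : X) {N : Type u} [AddCommGroup N]
    [Module (X.presheaf.stalk x) N] (d : RingHom.ker (augStalk ε x) →+ N)
    (hd : ∀ b z, d (b • z) = augStalk ε x b • d z) :
    ∃ χ : modStalk (conormal ε) x →+ N, ∀ U hx z,
      χ (modGerm (conormal ε) U x hx (conormalMk ε U z)) = d (augGerm ε U x hx z) := by
  have hk (U : X.Opens) (hx : x ∈ U) : ∃ k : (augIdeal ε (op U)).Cotangent →+ N,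
      ∀ z, k ((augIdeal ε (op U)).toCotangent z) = d (augGerm ε U x hx z) := by
    let φ : A.right.obj.obj (op U) →+* X.presheaf.stalk x :=
      (augStalk ε x).comp (germAt A.right U x hx)
    let : Module (A.right.obj.obj (op U)) N := Module.compHom N φ
    have h1 (a : A.right.obj.obj (op U)) (z : augIdeal ε (op U)) :
        d (augGerm ε U x hx (a • z)) = a • d (augGerm ε U x hx z) := by
      refine Eq.trans (congrArg d (Subtype.ext ?_)) (hd (germAt A.right U x hx a) _)
      exact map_mul (germAt A.right U x hx) _ _
    let k' : augIdeal ε (op U) →ₗ[A.right.obj.obj (op U)] N :=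
      { toFun z := d (augGerm ε U x hx z)
        map_add' y z := by rw [map_add, map_add]
        map_smul' a z := h1 a z }
    refine ⟨(Ideal.Cotangent.lift k' fun y z => ?_).toAddMonoidHom, fun z => rfl⟩
    refine (h1 y.1 z).trans ?_
    -- Elements of the ideal act on `N` by zero, so linearity forces `d` to vanish on products of
    -- two of them.
    have h2 : φ y.1 = 0 := (augGerm ε U x hx y).2
    exact (congrArg (· • d (augGerm ε U x hx z)) h2).trans (zero_smul _ _)
  choose k hk using hk
  obtain ⟨χ, hχ⟩ := exists_modStalk_sheafify_lift (preConormal ε) x (T := N) k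
    (fun U V i hx m => by
      obtain ⟨z, rfl⟩ := (augIdeal ε (op U)).toCotangent_surjective m
      refine (hk V hx (augRes ε i z)).trans (Eq.trans ?_ (hk U (i hx) z).symm)
      rw [augGerm_res])
  exact ⟨χ, fun U hx z => (hχ U hx _).trans (hk U hx z)⟩

/-! ### The conormal sheaf and differentials -/

variable (r : X.sheaf ⟶ A.right) (hr : r ≫ ε.right = 𝟙 X.sheaf)

/-- A second homomorphism from the structure sheaf to an augmented sheaf of algebras,
on sections. -/
def secSection (U : X.Opens) : Γ(X, U) →+* A.right.obj.obj (op U) := (r.hom.app (op U)).hom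

include hr in
theorem augSection_secSection (U : X.Opens) (s : Γ(X, U)) :
    augSection ε U (secSection r U s) = s :=
  congrArg (fun q => (q.hom.app (op U)).hom s) hr

/-- The section `1 ⊗ s - s ⊗ 1`. -/
def diffSection (U : X.Opens) (s : Γ(X, U)) : augIdeal ε (op U) :=
  ⟨secSection r U s - algSection A U s, (map_sub (augSection ε U) _ _).trans
    ((congrArg₂ (· - ·) (augSection_secSection ε r hr U s)
      (augSection_algSection ε U s)).trans (sub_self s))⟩

/-- The homomorphism of stalks induced by a second homomorphism from the structure sheaf. -/
def secStalk (x : X) : X.presheaf.stalk x →+* stalkRing A.right x := stalkHom r x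

theorem secStalk_strGerm (U : X.Opens) (x : X) (hx : x ∈ U) (s : Γ(X, U)) :
    secStalk r x (strGerm U x hx s) = germAt A.right U x hx (secSection r U s) :=
  stalkHom_germAt r U x hx s

include hr in
theorem augStalk_comp_secStalk (x : X) : (augStalk ε x).comp (secStalk r x) = RingHom.id _ := by
  refine RingHom.ext fun a => ?_
  obtain ⟨U, hx, s, rfl⟩ := exists_strGerm_eq x a
  rw [RingHom.comp_apply, secStalk_strGerm, augStalk_germAt, augSection_secSection ε r hr]
  rfl

theorem diffSection_res {U V : X.Opens} (i : V ≤ U) (s : Γ(X, U)) :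
    diffSection ε r hr V (X.presheaf.map (homOfLE i).op s) =
      augRes ε i (diffSection ε r hr U s) := by
  refine Subtype.ext ?_
  refine Eq.trans ?_ (map_sub (A.right.obj.map (homOfLE i).op).hom _ _).symm
  exact congrArg₂ (· - ·) (congrArg (fun q => q.hom s) (r.hom.naturality (homOfLE i).op))
    (congrArg (fun q => q.hom s) (A.hom.hom.naturality (homOfLE i).op))

theorem diffSection_add (U : X.Opens) (s t : Γ(X, U)) :
    diffSection ε r hr U (s + t) = diffSection ε r hr U s + diffSection ε r hr U t := by
  refine Subtype.ext ?_
  change secSection r U (s + t) - algSection A U (s + t) =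
    (secSection r U s - algSection A U s) + (secSection r U t - algSection A U t)
  rw [map_add, map_add]
  ring

/-- One has `δ(st) = r(s) δ(t) + l(t) δ(s)`, and both `r(s)` and `l(t)` act on `I / I²` through
their augmentations `s` and `t`. -/
theorem conormalMk_diffSection_mul (U : X.Opens) (s t : Γ(X, U)) :
    conormalMk ε U (diffSection ε r hr U (s * t)) =
      s • conormalMk ε U (diffSection ε r hr U t) +
        t • conormalMk ε U (diffSection ε r hr U s) := by
  have h : diffSection ε r hr U (s * t) = secSection r U s • diffSection ε r hr U t +
      algSection A U t • diffSection ε r hr U s := by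
    refine Subtype.ext ?_
    change secSection r U (s * t) - algSection A U (s * t) =
      secSection r U s * (secSection r U t - algSection A U t) +
        algSection A U t * (secSection r U s - algSection A U s)
    rw [map_mul, map_mul]
    ring
  rw [h, conormalMk_add, conormalMk_smul, conormalMk_smul, augSection_secSection ε r hr,
    augSection_algSection]

variable {p : ℕ} {Y : Scheme.{u}} (f : X ⟶ Y)
  (hA : ∀ x : X, IsFrobPushout p (f.stalkMap x).hom (algStalk A x) (secStalk r x))

include hA in
-- Equality of sections is tested on stalks, where `l` and `r` agree on the local ring of `Y`.
theorem diffSection_invSharp (U : X.Opens) (a : ((inverseImage f).obj Y.sheaf).obj.obj (op U)) :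
    diffSection ε r hr U ((invSharp f).hom.app (op U) a) = 0 := by
  refine Subtype.ext (sub_eq_zero.mpr ?_)
  refine section_ext_of_germAt A.right fun x hx => ?_
  have h1 := (comp_stalkHom_invSharp_eq_iff f x _ _).mpr (hA x).comp_eq
  have h2 : stalkHom (invSharp f) x (germAt _ U x hx a) =
    strGerm U x hx ((invSharp f).hom.app (op U) a) := stalkHom_germAt (invSharp f) U x hx a
  refine (secStalk_strGerm r U x hx _).symm.trans (Eq.trans ?_ (algStalk_strGerm U x hx _))
  exact ((congrArg (secStalk r x) h2).symm.trans
    (RingHom.congr_fun h1.symm (germAt _ U x hx a))).trans (congrArg (algStalk A x) h2)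

include hA in
/-- If the stalks of `A` are tensor products, then the conormal sheaf of `A` is the sheaf of
differentials. -/
theorem exists_omega_iso_conormal [IsOfChar p Y] : ∃ ψ : Omega f ⟶ conormal ε, IsIso ψ ∧
    ∀ (U : X.Opens) (s : Γ(X, U)),
      ψ.app U (omegaD f U s) = conormalMk ε U (diffSection ε r hr U s) := by
  obtain ⟨ψ, hψ⟩ := exists_omega_lift f (conormal ε)
    (fun U => AddMonoidHom.mk' (fun s => conormalMk ε U (diffSection ε r hr U s))
      fun s t => by rw [diffSection_add, conormalMk_add])
    (fun U s t => conormalMk_diffSection_mul ε r hr U s t)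
    (fun U V i s => (congrArg (conormalMk ε V) (diffSection_res ε r hr i s)).trans
      (conormalMk_res ε i _))
    (fun U a => (congrArg (conormalMk ε U) (diffSection_invSharp ε r hr f hA U a)).trans (by
      have h := conormalMk_smul ε U 0 0
      rw [map_zero, zero_smul, zero_smul] at h
      exact h))
  have hψ' (U : X.Opens) (s : Γ(X, U)) :
    ψ.app U (omegaD f U s) = conormalMk ε U (diffSection ε r hr U s) := hψ U s
  refine ⟨ψ, isIso_of_modStalkMap_bijective ψ fun x => ?_, hψ'⟩
  have := IsOfChar.of_hom p f
  have hp := natCast_stalk_eq_zero p X x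
  have hstalk (U : X.Opens) (hx : x ∈ U) (s t : Γ(X, U)) :
      modStalkMap ψ x (modGerm (Omega f) U x hx (s • omegaD f U t)) =
        modGerm (conormal ε) U x hx
          (conormalMk ε U (algSection A U s • diffSection ε r hr U t)) := by
    rw [modStalkMap_modGerm, Scheme.Modules.Hom.app_smul, hψ', conormalMk_smul,
      augSection_algSection]
  obtain ⟨D, hD1, hD2, hD3⟩ := exists_stalk_derivation f x
  obtain ⟨d, hd1, hd2⟩ := (hA x).exists_addHom_of_derivation hp (augStalk_comp_algStalk ε x)
    (augStalk_comp_secStalk ε r hr x) D hD2 hD3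
  obtain ⟨χ, hχ⟩ := exists_stalk_conormal_lift ε x d hd1
  obtain ⟨c, hc1, hc2, hc3⟩ := exists_stalk_conormalMk ε x
  constructor
  -- Injectivity: the stalk derivation of `Ω_f` defines `d` on the kernel, which descends to `χ` on
  -- the conormal stalk. It is a left inverse, as seen on the additive generators `s dt`.
  · have hinv (ω : modStalk (Omega f) x) : χ (modStalkMap ψ x ω) = ω := by
      refine modStalk_omega_induction f x (P := fun ω => χ (modStalkMap ψ x ω) = ω) ?_ ?_ ?_ ω
      · rw [map_zero, map_zero]
      · intro a b ha hb
        rw [map_add, map_add, ha, hb]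
      · intro U hx s t
        have h1 : augGerm ε U x hx (algSection A U s • diffSection ε r hr U t) =
            algStalk A x (strGerm U x hx s) • augGerm ε U x hx (diffSection ε r hr U t) := by
          rw [algStalk_strGerm]
          exact Subtype.ext (map_mul (germAt A.right U x hx) _ _)
        have h2 : ((augGerm ε U x hx (diffSection ε r hr U t) : RingHom.ker (augStalk ε x)) :
            stalkRing A.right x) =
            secStalk r x (strGerm U x hx t) - algStalk A x (strGerm U x hx t) := by
          rw [secStalk_strGerm, algStalk_strGerm]
          exact map_sub (germAt A.right U x hx) _ _
        rw [hstalk, hχ, h1, hd1, hd2 _ _ h2, hD1, modGerm_smul]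
        exact congrArg (· • _) (RingHom.congr_fun (augStalk_comp_algStalk ε x) _)
    exact Function.LeftInverse.injective hinv
  -- Surjectivity: the kernel is generated by the differences, which represent the images of
  -- differentials, and the stalk map is linear.
  · intro m
    obtain ⟨⟨z, hz⟩, rfl⟩ := hc3 m
    have hspan : z ∈ Ideal.span (Set.range fun s => secStalk r x s - algStalk A x s) := by
      rwa [← (hA x).ker_eq_span _ (augStalk_comp_algStalk ε x) (augStalk_comp_secStalk ε r hr x)]
    have hker (z) (hz : z ∈ Ideal.span (Set.range fun s => secStalk r x s - algStalk A x s)) :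
        z ∈ RingHom.ker (augStalk ε x) := by
      rwa [(hA x).ker_eq_span _ (augStalk_comp_algStalk ε x) (augStalk_comp_secStalk ε r hr x)]
    change ∃ ω, modStalkMap ψ x ω = c ⟨z, hker z hspan⟩
    clear hz
    induction hspan using Submodule.span_induction with
    | mem z hz =>
      obtain ⟨a, rfl⟩ := hz
      obtain ⟨U, hx, s, rfl⟩ := exists_strGerm_eq x a
      refine ⟨modGerm (Omega f) U x hx (omegaD f U s), ?_⟩
      rw [modStalkMap_modGerm, hψ', ← hc1]
      refine congrArg c (Subtype.ext ?_)
      simp only [secStalk_strGerm, algStalk_strGerm]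
      exact map_sub (germAt A.right U x hx) _ _
    | zero => exact ⟨0, (map_zero _).trans (map_zero c).symm⟩
    | add y z hy hz h1 h2 =>
      obtain ⟨ω, hω⟩ := h1
      obtain ⟨ω', hω'⟩ := h2
      refine ⟨ω + ω', (map_add _ _ _).trans ?_⟩
      rw [hω, hω']
      exact (map_add c _ _).symm
    | smul b z hz h1 =>
      obtain ⟨ω, hω⟩ := h1
      refine ⟨augStalk ε x b • ω, (modStalkMap_smul ψ x _ _).trans ?_⟩
      rw [hω]
      exact (hc2 b ⟨z, hker z hz⟩).symm

end augmented

/-! ### The associated graded ring -/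

section gr

variable {A B : Type u} [CommRing A] [CommRing B] (I : Ideal A)

theorem Gr.mk_mul {j k : ℕ} {a b : A} (ha : a ∈ I ^ j) (hb : b ∈ I ^ k)
    (hab : a * b ∈ I ^ (j + k)) :
    Gr.mk I j a ha * Gr.mk I k b hb = Gr.mk I (j + k) (a * b) hab := by
  refine (map_mul (Ideal.Quotient.mk (grKer I)) _ _).symm.trans ?_
  exact congrArg (Ideal.Quotient.mk (grKer I))
    (Subtype.ext (Polynomial.monomial_mul_monomial j k a b))

theorem Gr.mk_add {k : ℕ} {a b : A} (ha : a ∈ I ^ k) (hb : b ∈ I ^ k) (hab : a + b ∈ I ^ k) :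
    Gr.mk I k (a + b) hab = Gr.mk I k a ha + Gr.mk I k b hb := by
  refine Eq.trans ?_ (map_add (Ideal.Quotient.mk (grKer I)) _ _)
  exact congrArg (Ideal.Quotient.mk (grKer I)) (Subtype.ext (map_add (Polynomial.monomial k) a b))

theorem Gr.mk_eq_zero {k : ℕ} {a : A} (ha : a ∈ I ^ k) (ha' : a ∈ I ^ (k + 1)) :
    Gr.mk I k a ha = 0 := by
  refine Ideal.Quotient.eq_zero_iff_mem.mpr fun j => ?_
  change (Polynomial.monomial k a).coeff j ∈ _
  rw [Polynomial.coeff_monomial]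
  split_ifs with h
  · exact h ▸ ha'
  · exact zero_mem _

theorem Gr.algebraMap_eq_zero {a : A} (ha : a ∈ I) : algebraMap A (Gr I) a = 0 :=
  Gr.mk_eq_zero (k := 0) I (by simp) (by simpa using ha)

theorem Gr.algebraMap_mul_mk {k : ℕ} (a : A) {b : A} (hb : b ∈ I ^ k) (hab : a * b ∈ I ^ k) :
    algebraMap A (Gr I) a * Gr.mk I k b hb = Gr.mk I k (a * b) hab := by
  refine (map_mul (Ideal.Quotient.mk (grKer I)) _ _).symm.trans ?_
  exact congrArg (Ideal.Quotient.mk (grKer I)) (Subtype.ext (Polynomial.C_mul_monomial))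

theorem Gr.mk_pow {k : ℕ} {a : A} (ha : a ∈ I ^ k) (n : ℕ) (han : a ^ n ∈ I ^ (k * n)) :
    Gr.mk I k a ha ^ n = Gr.mk I (k * n) (a ^ n) han := by
  refine (map_pow (Ideal.Quotient.mk (grKer I)) _ _).symm.trans ?_
  exact congrArg (Ideal.Quotient.mk (grKer I))
    (Subtype.ext (Polynomial.monomial_pow k a n))

theorem Gr.mk_pow_eq_zero {k : ℕ} {a : A} (ha : a ∈ I ^ k) {n : ℕ} (hn : a ^ n = 0) :
    Gr.mk I k a ha ^ n = 0 := by
  rw [Gr.mk_pow I ha n (hn ▸ zero_mem _)]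
  exact Gr.mk_eq_zero I _ (hn ▸ zero_mem _)

theorem Gr.induction {P : Gr I → Prop} (hmk : ∀ k a ha, P (Gr.mk I k a ha))
    (hadd : ∀ x y, P x → P y → P (x + y)) (x : Gr I) : P x := by
  obtain ⟨⟨f, hf⟩, rfl⟩ := Ideal.Quotient.mk_surjective x
  have h1 : (⟨f, hf⟩ : reesAlgebra I) = ∑ k ∈ f.support,
      ⟨Polynomial.monomial k (f.coeff k), reesAlgebra.monomial_mem.mpr (hf k)⟩ := by
    refine Subtype.ext ?_
    rw [AddSubmonoidClass.coe_finsetSum]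
    exact f.as_sum_support
  rw [h1, map_sum]
  refine Finset.sum_induction _ P hadd ?_ fun k _ => hmk k _ (hf k)
  rw [← Gr.mk_eq_zero I (k := 0) (zero_mem _) (zero_mem _)]
  exact hmk 0 0 _

theorem Gr.map_algebraMap (φ : A →+* B) {J : Ideal B} (h : I ≤ J.comap φ) (a : A) :
    Gr.map φ h (algebraMap A (Gr I) a) = algebraMap B (Gr J) (φ a) :=
  congrArg (Ideal.Quotient.mk (grKer J)) (Subtype.ext (Polynomial.map_C φ))

theorem Gr.map_map {C : Type u} [CommRing C] (φ : A →+* B) (ψ : B →+* C) (χ : A →+* C)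
    {J : Ideal B} {K : Ideal C} (h : I ≤ J.comap φ) (h' : J ≤ K.comap ψ) (h'' : I ≤ K.comap χ)
    (hχ : ∀ a, ψ (φ a) = χ a) (x : Gr I) : Gr.map ψ h' (Gr.map φ h x) = Gr.map χ h'' x := by
  obtain rfl : ψ.comp φ = χ := RingHom.ext hχ
  exact (congrArg (fun q => q x) (Gr.map_comp φ ψ h h' h'')).symm

/-- The natural map `I / I² → ⨁ₖ Iᵏ / Iᵏ⁺¹`. -/
def Gr.cotangentι : I.Cotangent →+ Gr I :=
  (Ideal.Cotangent.lift (R := A) (M := Gr I)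
    { toFun := fun z : I => Gr.mk I 1 z.1 ((pow_one I).symm ▸ z.2)
      map_add' := fun y z => Gr.mk_add I _ _ _
      map_smul' := fun a z =>
        (Gr.algebraMap_mul_mk I a _ _).symm.trans (Algebra.smul_def (A := Gr I) a _).symm }
    fun y z => Gr.mk_eq_zero I ((pow_one I).symm ▸ (y * z).2) (by
      have h := Ideal.mul_mem_mul y.2 z.2
      rwa [← pow_two] at h)).toAddMonoidHom

end gr

/-! ### Sheaves of algebras associated with presheaves of algebras -/

section sheafification

variable {X : Scheme.{u}} (B : Under X.presheaf)

/-- The map from a presheaf of algebras to the associated sheaf, on sections. -/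
def algSheafify (U : X.Opens) :
    B.right.obj (op U) →+* (sheafifyAlgebra B).right.obj.obj (op U) :=
  (toSheafifyAlgebra B U).hom

theorem algSheafify_res {U V : X.Opens} (i : V ≤ U) (b : B.right.obj (op U)) :
    algSheafify B V (B.right.map (homOfLE i).op b) =
      (sheafifyAlgebra B).right.obj.map (homOfLE i).op (algSheafify B U b) :=
  congrArg (fun q => q.hom b) ((toSheafify (Opens.grothendieckTopology X) B.right).naturality
    (homOfLE i).op)

theorem exists_germAt_algSheafify_eq (x : X) (t : stalkRing (sheafifyAlgebra B).right x) :
    ∃ (U : X.Opens) (hx : x ∈ U) (b : B.right.obj (op U)),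
      germAt (sheafifyAlgebra B).right U x hx (algSheafify B U b) = t :=
  exists_germ_toSheafify_eq (C := CommRingCat.{u}) (X := X) B.right x t

theorem exists_stalk_sheafifyAlgebra_lift (x : X) {T : Type u} [CommRing T]
    (k : ∀ U : X.Opens, x ∈ U → B.right.obj (op U) →+* T)
    (hk : ∀ (U V : X.Opens) (i : V ≤ U) (hx : x ∈ V) (b : B.right.obj (op U)),
      k V hx (B.right.map (homOfLE i).op b) = k U (i hx) b) :
    ∃ K : stalkRing (sheafifyAlgebra B).right x →+* T,
      ∀ U hx b, K (germAt _ U x hx (algSheafify B U b)) = k U hx b := by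
  obtain ⟨K, hK⟩ := exists_stalk_sheafify_lift (C := CommRingCat.{u}) (X := X) B.right x
    (T := CommRingCat.of T) (fun U hx => CommRingCat.ofHom (k U hx))
    (fun U V i hx => CommRingCat.hom_ext (RingHom.ext (hk U V i.le hx)))
  exact ⟨K.hom, fun U hx b => congrArg (fun q => q.hom b) (hK U hx)⟩

/-- Homomorphisms from a presheaf of algebras to a sheaf of algebras extend to the associated
sheaf. -/
theorem exists_sheafifyAlgebra_lift (C : Under X.sheaf)
    (k : ∀ U : X.Opens, B.right.obj (op U) →+* C.right.obj.obj (op U))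
    (hk : ∀ (U V : X.Opens) (i : V ≤ U) (b : B.right.obj (op U)),
      k V (B.right.map (homOfLE i).op b) = C.right.obj.map (homOfLE i).op (k U b))
    (hk' : ∀ (U : X.Opens) (s : Γ(X, U)), k U ((B.hom.app (op U)).hom s) = algSection C U s) :
    ∃ φ : sheafifyAlgebra B ⟶ C, ∀ (U : X.Opens) (b : B.right.obj (op U)),
      φ.right.hom.app (op U) (algSheafify B U b) = k U b := by
  let k' : B.right ⟶ C.right.obj :=
    { app := fun U => CommRingCat.ofHom (k U.unop)
      naturality := fun U V i => CommRingCat.hom_ext (RingHom.ext (hk U.unop V.unop i.unop.le)) }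
  let φ : (sheafifyAlgebra B).right ⟶ C.right :=
    ⟨sheafifyLift (Opens.grothendieckTopology X) k' C.right.property⟩
  have h : toSheafify (Opens.grothendieckTopology X) B.right ≫ φ.hom = k' :=
    toSheafify_sheafifyLift (Opens.grothendieckTopology X) k' C.right.property
  refine ⟨Under.homMk φ ?_, fun U b => congrArg (fun q => (q.app (op U)).hom b) h⟩
  refine CategoryTheory.Sheaf.hom_ext ?_
  refine (Category.assoc B.hom (toSheafify (Opens.grothendieckTopology X) B.right) φ.hom).trans ?_
  rw [h]
  exact NatTrans.ext (funext fun U => CommRingCat.hom_ext (RingHom.ext (hk' U.unop)))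

/-- A homomorphism of sheaves of algebras which is bijective on stalks is an isomorphism. -/
theorem isIso_of_stalkHom_bijective {C D : Under X.sheaf} (φ : C ⟶ D)
    (h : ∀ x, Function.Bijective (stalkHom φ.right x)) : IsIso φ := by
  have h1 (x : X) : IsIso ((TopCat.Presheaf.stalkFunctor CommRingCat.{u} (X := X) x).map
      φ.right.hom) :=
    (ConcreteCategory.isIso_iff_bijective _).mpr (h x)
  have : IsIso ((Under.forget X.sheaf).map φ) :=
    TopCat.Presheaf.isIso_of_stalkFunctor_map_iso (X := X) φ.right
  exact isIso_of_reflects_iso φ (Under.forget X.sheaf)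

end sheafification

/-! ### The homomorphism from the truncated symmetric algebra of the conormal sheaf -/

section degreeOne

variable {X : Scheme.{u}} {A : Under X.sheaf} (ε : A ⟶ Under.mk (𝟙 X.sheaf))

theorem algSection_res (C : Under X.sheaf) {U V : X.Opens} (i : V ≤ U) (s : Γ(X, U)) :
    algSection C V (X.presheaf.map (homOfLE i).op s) =
      C.right.obj.map (homOfLE i).op (algSection C U s) :=
  congrArg (fun q => q.hom s) (C.hom.hom.naturality (homOfLE i).op)

/-- Sections of the conormal sheaf are locally classes of sections of the ideal. -/
theorem exists_conormalMk_eq {U : X.Opens} (e : Γ(conormal ε, U)) {x : X} (hx : x ∈ U) :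
    ∃ (V : X.Opens) (i : V ≤ U), x ∈ V ∧ ∃ z : augIdeal ε (op V),
      conormalMk ε V z = (conormal ε).presheaf.map (homOfLE i).op e := by
  obtain ⟨W, hW, b, hb⟩ := exists_modGerm_toSheafifyModule_eq (preConormal ε) x
    (modGerm (conormal ε) U x hx e)
  obtain ⟨z, rfl⟩ := (augIdeal ε (op W)).toCotangent_surjective b
  obtain ⟨V, hV, i, j, hij⟩ := TopCat.Presheaf.germ_eq (C := Ab.{u}) (X := X)
    (conormal ε).presheaf x hW hx _ _ hb
  exact ⟨V, j.le, hV, augRes ε i.le z, (conormalMk_res ε i.le z).trans hij⟩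

theorem grMkOne_res {U V : X.Opens} (i : V ≤ U) (z : augIdeal ε (op U)) :
    grMkOne ε V (augRes ε i z) = (grSheaf ε).right.obj.map (homOfLE i).op (grMkOne ε U z) := by
  refine Eq.trans ?_ (algSheafify_res (preGr ε) i _)
  exact congrArg (algSheafify (preGr ε) V) (Gr.map_mk (A.right.obj.map (homOfLE i).op).hom
    (augIdeal_le ε (homOfLE i).op) 1 z.1 _ _).symm

/-- The underlying presheaf of abelian groups of a sheaf of rings. -/
def abPresheaf (F : TopCat.Sheaf CommRingCat.{u} X) : TopCat.Presheaf Ab.{u} X :=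
  F.obj ⋙ forget₂ CommRingCat.{u} RingCat.{u} ⋙ forget₂ RingCat.{u} Ab.{u}

theorem abPresheaf_isSheaf (F : TopCat.Sheaf CommRingCat.{u} X) :
    Presheaf.IsSheaf (Opens.grothendieckTopology X) (abPresheaf F) :=
  ((sheafCompose (Opens.grothendieckTopology X)
    (forget₂ CommRingCat.{u} RingCat.{u} ⋙ forget₂ RingCat.{u} Ab.{u})).obj F).property

/-- The inclusion of the conormal sheaf in degree one of the associated graded algebra. -/
theorem exists_conormal_to_grSheaf : ∃ L : ∀ U : X.Opens, Γ(conormal ε, U) →+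
      (grSheaf ε).right.obj.obj (op U),
    (∀ (U V : X.Opens) (i : V ≤ U) (e : Γ(conormal ε, U)),
      L V ((conormal ε).presheaf.map (homOfLE i).op e) =
        (grSheaf ε).right.obj.map (homOfLE i).op (L U e)) ∧
    ∀ (U : X.Opens) (z : augIdeal ε (op U)), L U (conormalMk ε U z) = grMkOne ε U z := by
  let k : (preConormal ε).presheaf ⟶ abPresheaf (grSheaf ε).right :=
    { app := fun U => AddCommGrpCat.ofHom
        ((algSheafify (preGr ε) U.unop).toAddMonoidHom.comp (Gr.cotangentι (augIdeal ε U)))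
      naturality := fun U V i => AddCommGrpCat.hom_ext (AddMonoidHom.ext fun z => by
        obtain ⟨z, rfl⟩ := (augIdeal ε U).toCotangent_surjective z
        exact grMkOne_res ε i.unop.le z) }
  let L : (conormal ε).presheaf ⟶ abPresheaf (grSheaf ε).right :=
    sheafifyLift (Opens.grothendieckTopology X) k (abPresheaf_isSheaf _)
  have h : toSheafify (Opens.grothendieckTopology X) (preConormal ε).presheaf ≫ L = k :=
    toSheafify_sheafifyLift (Opens.grothendieckTopology X) k (abPresheaf_isSheaf _)
  refine ⟨fun U => (L.app (op U)).hom, fun U V i e => ?_, fun U z => ?_⟩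
  · exact congrArg (fun q => q.hom e) (L.naturality (homOfLE i).op)
  · exact congrArg (fun q => (q.app (op U)).hom ((augIdeal ε (op U)).toCotangent z)) h

variable {ε} {L : ∀ U : X.Opens, Γ(conormal ε, U) →+ (grSheaf ε).right.obj.obj (op U)}
  (hres : ∀ (U V : X.Opens) (i : V ≤ U) (e : Γ(conormal ε, U)),
      L V ((conormal ε).presheaf.map (homOfLE i).op e) =
        (grSheaf ε).right.obj.map (homOfLE i).op (L U e))
  (hL : ∀ (U : X.Opens) (z : augIdeal ε (op U)), L U (conormalMk ε U z) = grMkOne ε U z)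

include hres hL

/-- A section of the conormal sheaf is only locally the class of a section of `I`, so the identity
is verified on germs after shrinking. -/
theorem conormal_to_grSheaf_smul (U : X.Opens) (s : Γ(X, U)) (e : Γ(conormal ε, U)) :
    L U (s • e) = algSection (grSheaf ε) U s * L U e := by
  refine section_ext_of_germAt (grSheaf ε).right fun x hx => ?_
  obtain ⟨V, i, hV, z, hz⟩ := exists_conormalMk_eq ε e hx
  have h1 : grMkOne ε V (algSection A V (X.presheaf.map (homOfLE i).op s) • z) =
      algSection (grSheaf ε) V (X.presheaf.map (homOfLE i).op s) * grMkOne ε V z := by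
    refine Eq.trans ?_ (map_mul (algSheafify (preGr ε) V) _ _)
    exact congrArg (algSheafify (preGr ε) V) (Gr.algebraMap_mul_mk _ _ _ _).symm
  have h2 : L V ((conormal ε).presheaf.map (homOfLE i).op (s • e)) =
      algSection (grSheaf ε) V (X.presheaf.map (homOfLE i).op s) *
        L V ((conormal ε).presheaf.map (homOfLE i).op e) := by
    rw [Scheme.Modules.map_smul, ← hz, hL, ← h1, ← hL, conormalMk_smul, augSection_algSection]
  rw [hres, hres, algSection_res, ← map_mul] at h2
  rw [← germAt_res (grSheaf ε).right i x hV, ← germAt_res (grSheaf ε).right i x hV, h2]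

theorem conormal_to_grSheaf_pow {p : ℕ}
    (hp : ∀ (U : X.Opens) (z : augIdeal ε (op U)), (z : A.right.obj.obj (op U)) ^ p = 0)
    (U : X.Opens) (e : Γ(conormal ε, U)) : L U e ^ p = 0 := by
  refine section_ext_of_germAt (grSheaf ε).right fun x hx => ?_
  obtain ⟨V, i, hV, z, hz⟩ := exists_conormalMk_eq ε e hx
  have h1 : grMkOne ε V z ^ p = 0 := by
    refine (map_pow (algSheafify (preGr ε) V) _ _).symm.trans ?_
    exact (congrArg (algSheafify (preGr ε) V) (Gr.mk_pow_eq_zero _ _ (hp V z))).trans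
      (map_zero _)
  rw [← hL, hz, hres, ← map_pow] at h1
  rw [← germAt_res (grSheaf ε).right i x hV, h1, map_zero, map_zero]

end degreeOne

/-! ### Homomorphisms of sheaves of algebras on sections and stalks. -/

section sections

variable {X : Scheme.{u}} {C D : Under X.sheaf} (φ : C ⟶ D)

/-- A homomorphism of sheaves of algebras on sections. -/
def secHom (U : X.Opens) : C.right.obj.obj (op U) →+* D.right.obj.obj (op U) :=
  (φ.right.hom.app (op U)).hom

theorem secHom_res {U V : X.Opens} (i : V ≤ U) (t : C.right.obj.obj (op U)) :
    secHom φ V (C.right.obj.map (homOfLE i).op t) =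
      D.right.obj.map (homOfLE i).op (secHom φ U t) :=
  congrArg (fun q => q.hom t) (φ.right.hom.naturality (homOfLE i).op)

theorem secHom_algSection (U : X.Opens) (s : Γ(X, U)) :
    secHom φ U (algSection C U s) = algSection D U s :=
  congrArg (fun q => (q.hom.app (op U)).hom s) (Under.w φ)

theorem stalkHom_right_germAt (U : X.Opens) (x : X) (hx : x ∈ U) (t : C.right.obj.obj (op U)) :
    stalkHom φ.right x (germAt C.right U x hx t) = germAt D.right U x hx (secHom φ U t) :=
  stalkHom_germAt φ.right U x hx t

theorem stalkHom_right_algStalk (x : X) (a : X.presheaf.stalk x) :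
    stalkHom φ.right x (algStalk C x a) = algStalk D x a := by
  obtain ⟨U, hx, s, rfl⟩ := exists_strGerm_eq x a
  rw [algStalk_strGerm, stalkHom_right_germAt, secHom_algSection, algStalk_strGerm]

end sections

/-! ### Sections and stalks of the truncated symmetric algebra -/

section tau

variable (p : ℕ) {X : Scheme.{u}} (E : X.Modules)

theorem tauι_res {U V : X.Opens} (i : V ≤ U) (e : Γ(E, U)) :
    tauι p E V (E.presheaf.map (homOfLE i).op e) =
      (tauSheaf p E).right.obj.map (homOfLE i).op (tauι p E U e) := by
  refine Eq.trans ?_ (algSheafify_res (preTau p E) i _)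
  exact congrArg (algSheafify (preTau p E) V)
    (Tau.map_ι p (resHom (homOfLE i).op) (resMap E (homOfLE i).op) e).symm

theorem tauι_add (U : X.Opens) (e e' : Γ(E, U)) :
    tauι p E U (e + e') = tauι p E U e + tauι p E U e' :=
  (congrArg (algSheafify (preTau p E) U) (map_add (Tau.ι p Γ(X, U) Γ(E, U)) e e')).trans
    (map_add (algSheafify (preTau p E) U) _ _)

theorem tauι_smul (U : X.Opens) (s : Γ(X, U)) (e : Γ(E, U)) :
    tauι p E U (s • e) = algSection (tauSheaf p E) U s * tauι p E U e :=
  (congrArg (algSheafify (preTau p E) U) (Tau.ι_smul p s e)).trans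
    (map_mul (algSheafify (preTau p E) U) _ _)

theorem tauι_pow (U : X.Opens) (e : Γ(E, U)) : tauι p E U e ^ p = 0 :=
  (map_pow (algSheafify (preTau p E) U) _ _).symm.trans
    ((congrArg (algSheafify (preTau p E) U) (Tau.ι_pow p e)).trans (map_zero _))

/-- The stalks of `τ(E)` are quotients of `τ` of the stalks. -/
theorem exists_tau_stalk (x : X) :
    ∃ κ : Tau p (X.presheaf.stalk x) (modStalk E x) →+* stalkRing (tauSheaf p E).right x,
      Function.Surjective κ ∧ (∀ a, κ (algebraMap _ _ a) = algStalk _ x a) ∧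
      ∀ U hx e, κ (Tau.ι p _ _ (modGerm E U x hx e)) =
        germAt (tauSheaf p E).right U x hx (tauι p E U e) := by
  obtain ⟨l, hl⟩ := exists_modStalk_lift E x
    (fun U hx => AddMonoidHom.mk' (fun e => germAt (tauSheaf p E).right U x hx (tauι p E U e))
      fun e e' => by rw [tauι_add, map_add])
    (fun U V i hx m => (congrArg (germAt (tauSheaf p E).right V x hx) (tauι_res p E i m)).trans
      (germAt_res (tauSheaf p E).right i x hx _))
  have hl' (U hx e) : l (modGerm E U x hx e) =
    germAt (tauSheaf p E).right U x hx (tauι p E U e) := hl U hx e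
  have h1 (a m) : l (a • m) = algStalk (tauSheaf p E) x a * l m := by
    obtain ⟨U, hx, s, e, rfl, rfl⟩ := exists_strGerm_modGerm_eq E x a m
    rw [← modGerm_smul, hl', hl', tauι_smul, map_mul, algStalk_strGerm]
  have h2 (m) : l m ^ p = 0 := by
    obtain ⟨U, hx, e, rfl⟩ := exists_modGerm_eq E x m
    rw [hl', ← map_pow, tauι_pow, map_zero]
  have h3 := Tau.lift_ι p (algStalk (tauSheaf p E) x) l h1 h2
  have h4 := Tau.lift_algebraMap p (algStalk (tauSheaf p E) x) l h1 h2
  refine ⟨Tau.lift p (algStalk (tauSheaf p E) x) l h1 h2, fun t => ?_, h4,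
    fun U hx e => (h3 _).trans (hl' U hx e)⟩
  obtain ⟨U, hx, b, rfl⟩ := exists_germAt_algSheafify_eq (preTau p E) x t
  -- Germs come from presheaf sections, which are polynomials in functions and sections of `E`. The
  -- germs of these generators lie in the image.
  refine Tau.induction p (A := Γ(X, U)) (M := Γ(E, U)) (motive := fun b => ∃ y,
    Tau.lift p (algStalk (tauSheaf p E) x) l h1 h2 y =
      germAt (tauSheaf p E).right U x hx (algSheafify (preTau p E) U b)) ?_ ?_ ?_ ?_ b
  · exact fun a => ⟨algebraMap _ _ (strGerm U x hx a), (h4 _).trans (algStalk_strGerm U x hx a)⟩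
  · exact fun e => ⟨Tau.ι p _ _ (modGerm E U x hx e), (h3 _).trans (hl' U hx e)⟩
  · rintro b b' ⟨y, hy⟩ ⟨y', hy'⟩
    refine ⟨y * y', (map_mul _ _ _).trans ?_⟩
    rw [hy, hy']
    exact (map_mul ((germAt (tauSheaf p E).right U x hx).comp (algSheafify (preTau p E) U))
      b b').symm
  · rintro b b' ⟨y, hy⟩ ⟨y', hy'⟩
    refine ⟨y + y', (map_add _ _ _).trans ?_⟩
    rw [hy, hy']
    exact (map_add ((germAt (tauSheaf p E).right U x hx).comp (algSheafify (preTau p E) U))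
      b b').symm

end tau

/-! ### Stalks of the associated graded algebra -/

section gr

variable {X : Scheme.{u}} {A : Under X.sheaf} (ε : A ⟶ Under.mk (𝟙 X.sheaf))

theorem augIdeal_le_comap_germAt (U : X.Opens) (x : X) (hx : x ∈ U) :
    augIdeal ε (op U) ≤ (RingHom.ker (augStalk ε x)).comap (germAt A.right U x hx) :=
  fun z hz => (augGerm ε U x hx ⟨z, hz⟩).2

/-- The stalks of the associated graded algebra map to the associated graded algebras of the
stalks. -/
theorem exists_grSheaf_stalk (x : X) :
    ∃ θ : stalkRing (grSheaf ε).right x →+* Gr (RingHom.ker (augStalk ε x)),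
      (∀ a, θ (algStalk _ x a) = algebraMap (stalkRing A.right x) _ (algStalk A x a)) ∧
      ∀ U hx z (hz : (augGerm ε U x hx z : stalkRing A.right x) ∈ RingHom.ker (augStalk ε x) ^ 1),
        θ (germAt _ U x hx (grMkOne ε U z)) =
        Gr.mk (RingHom.ker (augStalk ε x)) 1 (augGerm ε U x hx z) hz := by
  obtain ⟨θ, hθ⟩ := exists_stalk_sheafifyAlgebra_lift (preGr ε) x
    (T := Gr (RingHom.ker (augStalk ε x)))
    (fun U hx => (show (preGr ε).right.obj (op U) ⟶ CommRingCat.of (Gr (RingHom.ker (augStalk ε x)))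
      from CommRingCat.ofHom
        (Gr.map (germAt A.right U x hx) (augIdeal_le_comap_germAt ε U x hx))).hom)
    (fun U V i hx b => Gr.map_map (augIdeal ε (op U)) (A.right.obj.map (homOfLE i).op).hom
      (germAt A.right V x hx) (germAt A.right U x (i hx)) (augIdeal_le ε (homOfLE i).op)
      (augIdeal_le_comap_germAt ε V x hx) (augIdeal_le_comap_germAt ε U x (i hx))
      (fun a => germAt_res A.right i x hx a) b)
  refine ⟨θ, fun a => ?_, fun U hx z hz => ?_⟩
  · obtain ⟨U, hx, s, rfl⟩ := exists_strGerm_eq x a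
    rw [algStalk_strGerm, algStalk_strGerm]
    exact (hθ U hx _).trans (Gr.map_algebraMap _ _ _ _)
  · exact (hθ U hx _).trans (Gr.map_mk _ _ _ _ _ _)

end gr

/-! ### Powers of submodules and graded pieces -/

section pieces

theorem submodule_pow_induction {R T : Type*} [CommSemiring R] [Semiring T] [Algebra R T]
    (S : Submodule R T) {P : ℕ → T → Prop} (halg : ∀ r, P 0 (algebraMap R T r))
    (hmul : ∀ k, ∀ b ∈ S ^ k, P k b → ∀ m ∈ S, P (k + 1) (b * m))
    (hadd : ∀ k b c, P k b → P k c → P k (b + c)) (k : ℕ) (b : T) (hb : b ∈ S ^ k) : P k b := by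
  induction k generalizing b with
  | zero =>
    obtain ⟨s, rfl⟩ := Submodule.mem_one.mp (by simpa using hb)
    exact halg s
  | succ k ih =>
    rw [pow_succ] at hb
    exact Submodule.mul_induction_on hb (fun b hb m hm => hmul k b hb (ih b hb) m hm)
      fun b c => hadd (k + 1) b c

theorem algebraMap_mem_submodule_pow_zero {R T : Type*} [CommSemiring R] [Semiring T] [Algebra R T]
    (S : Submodule R T) (r : R) : algebraMap R T r ∈ S ^ 0 := by
  rw [pow_zero]
  exact Submodule.mem_one.mpr ⟨r, rfl⟩

theorem mul_mem_submodule_pow_succ {R T : Type*} [CommSemiring R] [Semiring T] [Algebra R T]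
    (S : Submodule R T) {k : ℕ} {b m : T} (hb : b ∈ S ^ k) (hm : m ∈ S) : b * m ∈ S ^ (k + 1) := by
  rw [pow_succ]
  exact Submodule.mul_mem_mul hb hm

variable {p : ℕ} {A M : Type u} [CommRing A] [AddCommGroup M] [Module A M]

theorem Tau.algebraMap_mem_piece (a : A) : algebraMap A _ a ∈ Tau.piece p A M 0 :=
  algebraMap_mem_submodule_pow_zero _ a

theorem Tau.mul_ι_mem_piece {k : ℕ} {b : Tau p A M} (hb : b ∈ Tau.piece p A M k) (m : M) :
    b * Tau.ι p A M m ∈ Tau.piece p A M (k + 1) :=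
  mul_mem_submodule_pow_succ _ hb ⟨m, rfl⟩

theorem Tau.piece_induction {P : ℕ → Tau p A M → Prop}
    (halg : ∀ a, P 0 (algebraMap A _ a))
    (hmul : ∀ k b, P k b → ∀ m, P (k + 1) (b * Tau.ι p A M m))
    (hadd : ∀ k b c, P k b → P k c → P k (b + c)) (k : ℕ) (b : Tau p A M)
    (hb : b ∈ Tau.piece p A M k) : P k b :=
  submodule_pow_induction _ halg
    (fun k b _ h _ hm => by obtain ⟨m, rfl⟩ := hm; exact hmul k b h m) hadd k b hb

end pieces

/-! ### Graded pieces of the associated graded sheaf. -/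

section grPiece

variable {X : Scheme.{u}} {A : Under X.sheaf} (ε : A ⟶ Under.mk (𝟙 X.sheaf))

/-- The class in degree `k` of the associated graded algebra of a section of `Iᵏ`. -/
def grMk (k : ℕ) (U : X.Opens) (a : A.right.obj.obj (op U)) (ha : a ∈ augIdeal ε (op U) ^ k) :
    (grSheaf ε).right.obj.obj (op U) :=
  algSheafify (preGr ε) U (Gr.mk (augIdeal ε (op U)) k a ha)

theorem augIdeal_pow_res {U V : X.Opens} (i : V ≤ U) {k : ℕ} {a : A.right.obj.obj (op U)}
    (ha : a ∈ augIdeal ε (op U) ^ k) :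
    (A.right.obj.map (homOfLE i).op).hom a ∈ augIdeal ε (op V) ^ k := by
  have h := Ideal.mem_map_of_mem (A.right.obj.map (homOfLE i).op).hom ha
  rw [Ideal.map_pow] at h
  exact Ideal.pow_right_mono (Ideal.map_le_iff_le_comap.mpr (augIdeal_le ε (homOfLE i).op)) k h

theorem grMk_res {U V : X.Opens} (i : V ≤ U) {k : ℕ} {a : A.right.obj.obj (op U)}
    (ha : a ∈ augIdeal ε (op U) ^ k) :
    (grSheaf ε).right.obj.map (homOfLE i).op (grMk ε k U a ha) =
      grMk ε k V _ (augIdeal_pow_res ε i ha) :=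
  (algSheafify_res (preGr ε) i _).symm.trans (congrArg (algSheafify (preGr ε) V)
    (Gr.map_mk (A.right.obj.map (homOfLE i).op).hom (augIdeal_le ε (homOfLE i).op) k a _ _))

theorem mem_grPiece_iff {k : ℕ} {U : X.Opens} {t : (grSheaf ε).right.obj.obj (op U)} :
    t ∈ grPiece ε k U ↔ ∀ x ∈ U, ∃ (V : X.Opens) (i : V ≤ U), x ∈ V ∧ ∃ a ha,
      grMk ε k V a ha = (grSheaf ε).right.obj.map (homOfLE i).op t := by
  refine forall₂_congr fun x hx => exists₂_congr fun V i => and_congr_right fun hV => ?_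
  constructor
  · rintro ⟨_, ⟨a, ha, rfl⟩, h⟩
    exact ⟨a, ha, h⟩
  · rintro ⟨a, ha, h⟩
    exact ⟨_, ⟨a, ha, rfl⟩, h⟩

theorem res_res (F : TopCat.Sheaf CommRingCat.{u} X) {U V W : X.Opens} (i : V ≤ U) (j : W ≤ V)
    (t : F.obj.obj (op U)) : F.obj.map (homOfLE j).op (F.obj.map (homOfLE i).op t) =
      F.obj.map (homOfLE (j.trans i)).op t :=
  (congrArg (fun q => q.hom t) (F.obj.map_comp (homOfLE i).op (homOfLE j).op)).symm

variable {ε}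

theorem mem_grPiece_of_local {k : ℕ} {U : X.Opens} {t : (grSheaf ε).right.obj.obj (op U)}
    (h : ∀ x ∈ U, ∃ (V : X.Opens) (i : V ≤ U), x ∈ V ∧
      (grSheaf ε).right.obj.map (homOfLE i).op t ∈ grPiece ε k V) : t ∈ grPiece ε k U := by
  refine (mem_grPiece_iff ε).mpr fun x hx => ?_
  obtain ⟨V, i, hV, ht⟩ := h x hx
  obtain ⟨W, j, hW, a, ha, hat⟩ := (mem_grPiece_iff ε).mp ht x hV
  exact ⟨W, j.trans i, hW, a, ha, hat.trans (res_res (grSheaf ε).right i j t)⟩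

theorem exists_grMk_eq₂ {j k : ℕ} {U : X.Opens} {s t : (grSheaf ε).right.obj.obj (op U)}
    (hs : s ∈ grPiece ε j U) (ht : t ∈ grPiece ε k U) {x : X} (hx : x ∈ U) :
    ∃ (V : X.Opens) (i : V ≤ U), x ∈ V ∧ ∃ a ha b hb,
      grMk ε j V a ha = (grSheaf ε).right.obj.map (homOfLE i).op s ∧
      grMk ε k V b hb = (grSheaf ε).right.obj.map (homOfLE i).op t := by
  obtain ⟨V, i, hV, a, ha, has⟩ := (mem_grPiece_iff ε).mp hs x hx
  obtain ⟨W, j, hW, b, hb, hbt⟩ := (mem_grPiece_iff ε).mp ht x hx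
  refine ⟨V ⊓ W, inf_le_left.trans i, ⟨hV, hW⟩, _, augIdeal_pow_res ε inf_le_left ha, _,
    augIdeal_pow_res ε inf_le_right hb, ?_, ?_⟩
  · rw [← grMk_res ε inf_le_left ha, has, res_res]
  · rw [← grMk_res ε inf_le_right hb, hbt, res_res]

theorem add_mem_grPiece {k : ℕ} {U : X.Opens} {s t : (grSheaf ε).right.obj.obj (op U)}
    (hs : s ∈ grPiece ε k U) (ht : t ∈ grPiece ε k U) : s + t ∈ grPiece ε k U := by
  refine (mem_grPiece_iff ε).mpr fun x hx => ?_
  obtain ⟨V, i, hV, a, ha, b, hb, has, hbt⟩ := exists_grMk_eq₂ hs ht hx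
  refine ⟨V, i, hV, a + b, add_mem ha hb, Eq.trans ?_
    (map_add ((grSheaf ε).right.obj.map (homOfLE i).op).hom s t).symm⟩
  refine Eq.trans ?_ (congrArg₂ (· + ·) has hbt)
  exact (congrArg (algSheafify (preGr ε) V) (Gr.mk_add _ ha hb _)).trans (map_add _ _ _)

theorem mul_mem_grPiece {j k : ℕ} {U : X.Opens} {s t : (grSheaf ε).right.obj.obj (op U)}
    (hs : s ∈ grPiece ε j U) (ht : t ∈ grPiece ε k U) : s * t ∈ grPiece ε (j + k) U := by
  refine (mem_grPiece_iff ε).mpr fun x hx => ?_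
  obtain ⟨V, i, hV, a, ha, b, hb, has, hbt⟩ := exists_grMk_eq₂ hs ht hx
  refine ⟨V, i, hV, a * b, pow_add (augIdeal ε (op V)) j k ▸ Ideal.mul_mem_mul ha hb, Eq.trans ?_
    (map_mul ((grSheaf ε).right.obj.map (homOfLE i).op).hom s t).symm⟩
  refine Eq.trans ?_ (congrArg₂ (· * ·) has hbt)
  exact (congrArg (algSheafify (preGr ε) V) (Gr.mk_mul _ ha hb _).symm).trans (map_mul _ _ _)

theorem grMk_mem_grPiece (k : ℕ) (U : X.Opens) (a : A.right.obj.obj (op U))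
    (ha : a ∈ augIdeal ε (op U) ^ k) : grMk ε k U a ha ∈ grPiece ε k U :=
  (mem_grPiece_iff ε).mpr fun _ hx => ⟨U, le_rfl, hx, _, _, (grMk_res ε le_rfl ha).symm⟩

theorem algSection_mem_grPiece (U : X.Opens) (s : Γ(X, U)) :
    algSection (grSheaf ε) U s ∈ grPiece ε 0 U :=
  grMk_mem_grPiece 0 U (algSection A U s) (by simp)

end grPiece

/-! ### The comparison homomorphism -/

section comparison

variable (p : ℕ) {X : Scheme.{u}} {A : Under X.sheaf} (ε : A ⟶ Under.mk (𝟙 X.sheaf))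

/-- If the `p`-th powers of sections of the ideal vanish, then the inclusion of the conormal sheaf
into the associated graded algebra extends to the truncated symmetric algebra. -/
theorem exists_tauSheaf_to_grSheaf
    (hp : ∀ (U : X.Opens) (z : augIdeal ε (op U)), (z : A.right.obj.obj (op U)) ^ p = 0) :
    ∃ φ : tauSheaf p (conormal ε) ⟶ grSheaf ε, ∀ (U : X.Opens) (z : augIdeal ε (op U)),
      secHom φ U (tauι p (conormal ε) U (conormalMk ε U z)) = grMkOne ε U z := by
  obtain ⟨L, hres, hL⟩ := exists_conormal_to_grSheaf ε
  let k (U : X.Opens) : Tau p Γ(X, U) Γ(conormal ε, U) →+* (grSheaf ε).right.obj.obj (op U) :=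
    Tau.lift p (algSection (grSheaf ε) U) (L U) (conormal_to_grSheaf_smul hres hL U)
      (conormal_to_grSheaf_pow hres hL hp U)
  have hk1 (U : X.Opens) (s : Γ(X, U)) : k U (algebraMap _ _ s) = algSection (grSheaf ε) U s :=
    Tau.lift_algebraMap p _ _ _ _ s
  have hk2 (U : X.Opens) (e : Γ(conormal ε, U)) : k U (Tau.ι p _ _ e) = L U e :=
    Tau.lift_ι p _ _ _ _ e
  have hk3 (U V : X.Opens) (i : V ≤ U) :
      (k V).comp (Tau.map p (resHom (homOfLE i).op) (resMap (conormal ε) (homOfLE i).op)) =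
      ((grSheaf ε).right.obj.map (homOfLE i).op).hom.comp (k U) := by
    refine Tau.ringHom_ext p (fun s => ?_) (fun e => ?_)
    · refine (congrArg (k V) (Tau.map_algebraMap p _ _ s)).trans ((hk1 V _).trans ?_)
      refine (algSection_res (grSheaf ε) i s).trans ?_
      exact congrArg _ (hk1 U s).symm
    · refine (congrArg (k V) (Tau.map_ι p _ _ e)).trans ((hk2 V _).trans ?_)
      refine (hres U V i e).trans ?_
      exact congrArg _ (hk2 U e).symm
  obtain ⟨φ, hφ⟩ := exists_sheafifyAlgebra_lift (preTau p (conormal ε)) (grSheaf ε)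
    (fun U => (show (preTau p (conormal ε)).right.obj (op U) ⟶ (grSheaf ε).right.obj.obj (op U)
      from CommRingCat.ofHom (k U)).hom)
    (fun U V i b => RingHom.congr_fun (hk3 U V i) b) (fun U s => hk1 U s)
  exact ⟨φ, fun U z => (hφ U _).trans ((hk2 U _).trans (hL U z))⟩

variable {p ε} {φ : tauSheaf p (conormal ε) ⟶ grSheaf ε}
  (hφ : ∀ (U : X.Opens) (z : augIdeal ε (op U)),
    secHom φ U (tauι p (conormal ε) U (conormalMk ε U z)) = grMkOne ε U z)

include hφ

theorem secHom_tauι_mem_grPiece (U : X.Opens) (e : Γ(conormal ε, U)) :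
    secHom φ U (tauι p (conormal ε) U e) ∈ grPiece ε 1 U := by
  refine mem_grPiece_of_local fun x hx => ?_
  obtain ⟨V, i, hV, z, hz⟩ := exists_conormalMk_eq ε e hx
  refine ⟨V, i, hV, ?_⟩
  rw [← secHom_res, ← tauι_res, ← hz, hφ]
  exact grMk_mem_grPiece 1 V _ _

/-- A homomorphism that respects degrees zero and one respects all degrees, since the source is
generated there. -/
theorem secHom_algSheafify_mem_grPiece (k : ℕ) (U : X.Opens)
    {b : Tau p Γ(X, U) Γ(conormal ε, U)} (hb : b ∈ Tau.piece p Γ(X, U) Γ(conormal ε, U) k) :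
    secHom φ U (algSheafify (preTau p (conormal ε)) U b) ∈ grPiece ε k U := by
  let κ : Tau p Γ(X, U) Γ(conormal ε, U) →+* (grSheaf ε).right.obj.obj (op U) :=
    (secHom φ U).comp (algSheafify (preTau p (conormal ε)) U)
  change κ b ∈ grPiece ε k U
  refine Tau.piece_induction (P := fun k b => κ b ∈ grPiece ε k U) (fun s => ?_)
    (fun k b hb e => ?_) (fun k b c hb hc => ?_) k b hb
  · have h : κ (algebraMap _ _ s) = algSection (grSheaf ε) U s := secHom_algSection φ U s
    rw [h]
    exact algSection_mem_grPiece U s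
  · rw [map_mul]
    exact mul_mem_grPiece hb (secHom_tauι_mem_grPiece hφ U e)
  · rw [map_add]
    exact add_mem_grPiece hb hc

/-- `Iᵏ` consists of sums of products of `k` elements of `I`, and each factor lifts to degree one.
The preimage already exists over `U`, without shrinking, and has the right degree. -/
theorem exists_piece_secHom_eq_grMk (k : ℕ) (U : X.Opens) {a : A.right.obj.obj (op U)}
    (ha : a ∈ augIdeal ε (op U) ^ k) : ∃ b ∈ Tau.piece p Γ(X, U) Γ(conormal ε, U) k,
      secHom φ U (algSheafify (preTau p (conormal ε)) U b) = grMk ε k U a ha := by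
  let κ : Tau p Γ(X, U) Γ(conormal ε, U) →+* (grSheaf ε).right.obj.obj (op U) :=
    (secHom φ U).comp (algSheafify (preTau p (conormal ε)) U)
  change ∃ b ∈ Tau.piece p Γ(X, U) Γ(conormal ε, U) k, κ b = grMk ε k U a ha
  induction k generalizing a with
  | zero =>
    refine ⟨algebraMap _ _ (augSection ε U a), Tau.algebraMap_mem_piece _, ?_⟩
    have h : κ (algebraMap _ _ (augSection ε U a)) =
      algSection (grSheaf ε) U (augSection ε U a) := secHom_algSection φ U _
    -- In degree zero only the class modulo `I` matters, and `a` is congruent to the image of its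
    -- augmentation.
    refine h.trans (congrArg (algSheafify (preGr ε) U) ?_)
    change algebraMap (A.right.obj.obj (op U)) (Gr (augIdeal ε (op U)))
      (algSection A U (augSection ε U a)) = algebraMap _ (Gr (augIdeal ε (op U))) a
    rw [← sub_eq_zero, ← map_sub]
    refine Gr.algebraMap_eq_zero _ ((map_sub (augSection ε U) _ _).trans ?_)
    rw [augSection_algSection]
    exact sub_self _
  | succ k ih =>
    suffices H : ∃ ha, ∃ b ∈ Tau.piece p Γ(X, U) Γ(conormal ε, U) (k + 1),
        κ b = grMk ε (k + 1) U a ha from H.2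
    refine Submodule.mul_induction_on (C := fun a => ∃ ha,
      ∃ b ∈ Tau.piece p Γ(X, U) Γ(conormal ε, U) (k + 1), κ b = grMk ε (k + 1) U a ha)
      (pow_succ (augIdeal ε (op U)) k ▸ ha) (fun a ha z hz => ?_) ?_
    · obtain ⟨b, hb, hba⟩ := ih ha
      refine ⟨pow_succ (augIdeal ε (op U)) k ▸ Ideal.mul_mem_mul ha hz,
        b * Tau.ι p _ _ (conormalMk ε U ⟨z, hz⟩), ?_, ?_⟩
      · exact Tau.mul_ι_mem_piece hb _
      · rw [map_mul, hba]
        refine (congrArg (_ * ·) (hφ U ⟨z, hz⟩)).trans ?_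
        refine (map_mul (algSheafify (preGr ε) U) _ _).symm.trans ?_
        exact congrArg (algSheafify (preGr ε) U) (Gr.mk_mul _ _ _ _)
    · rintro a a' ⟨ha, b, hb, hba⟩ ⟨ha', b', hb', hba'⟩
      refine ⟨add_mem ha ha', b + b', add_mem hb hb', ?_⟩
      rw [map_add, hba, hba']
      refine (map_add (algSheafify (preGr ε) U) _ _).symm.trans ?_
      exact congrArg (algSheafify (preGr ε) U) (Gr.mk_add _ _ _ _).symm

theorem stalkHom_surjective (x : X) : Function.Surjective (stalkHom φ.right x) := by
  intro t
  obtain ⟨U, hx, b, rfl⟩ := exists_germAt_algSheafify_eq (preGr ε) x t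
  refine Gr.induction (augIdeal ε (op U)) (P := fun b => ∃ s, stalkHom φ.right x s =
    germAt (grSheaf ε).right U x hx (algSheafify (preGr ε) U b)) (fun k a ha => ?_) ?_ b
  · obtain ⟨b, _, hb⟩ := exists_piece_secHom_eq_grMk hφ k U ha
    exact ⟨germAt _ U x hx (algSheafify (preTau p (conormal ε)) U b),
      (stalkHom_right_germAt φ U x hx _).trans (congrArg _ hb)⟩
  · rintro b b' ⟨s, hs⟩ ⟨s', hs'⟩
    refine ⟨s + s', (map_add _ _ _).trans ?_⟩
    rw [hs, hs']
    exact (map_add ((germAt (grSheaf ε).right U x hx).comp (algSheafify (preGr ε) U)) b b').symm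

/-- To reflect degrees, a homogeneous image is lifted locally to an element of the same degree.
Since `φ` is invertible, that lift must be the restriction of `t`. -/
theorem mem_grPiece_iff_of_isIso [IsIso φ] (k : ℕ) (U : X.Opens)
    (t : (tauSheaf p (conormal ε)).right.obj.obj (op U)) :
    secHom φ U t ∈ grPiece ε k U ↔ t ∈ tauPiece p (conormal ε) k U := by
  constructor
  · intro h x hx
    obtain ⟨V, i, hV, a, ha, hat⟩ := (mem_grPiece_iff ε).mp h x hx
    obtain ⟨b, hb, hba⟩ := exists_piece_secHom_eq_grMk hφ k V ha
    refine ⟨V, i, hV, b, hb, ?_⟩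
    have h1 : secHom φ V (algSheafify (preTau p (conormal ε)) V b) =
        secHom φ V ((tauSheaf p (conormal ε)).right.obj.map (homOfLE i).op t) :=
      hba.trans (hat.trans (secHom_res φ i t).symm)
    have h2 (y) : secHom (inv φ) V (secHom φ V y) = y :=
      congrArg (fun q => (q.right.hom.app (op V)).hom y) (IsIso.hom_inv_id φ)
    exact (h2 _).symm.trans ((congrArg (secHom (inv φ) V) h1).trans (h2 _))
  · intro h
    refine mem_grPiece_of_local fun x hx => ?_
    obtain ⟨V, i, hV, b, hb, hbt⟩ := h x hx
    refine ⟨V, i, hV, ?_⟩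
    rw [← secHom_res]
    exact (congrArg (fun q => secHom φ V q ∈ grPiece ε k V) hbt).mp
      (secHom_algSheafify_mem_grPiece hφ k V hb)

end comparison

/-! ### The comparison isomorphism -/

section comparisonIso

theorem stalkMap_formallySmooth {X Y : Scheme.{u}} (f : X ⟶ Y) [Smooth f] (x : X) :
    (f.stalkMap x).hom.FormallySmooth :=
  Scheme.Hom.mem_smoothLocus.mp (f.smoothLocus_eq_top ▸ trivial)

variable {p : ℕ} [Fact p.Prime] {X Y : Scheme.{u}} (f : X ⟶ Y) {A : Under X.sheaf}
  (ε : A ⟶ Under.mk (𝟙 X.sheaf)) (r : X.sheaf ⟶ A.right) (hr : r ≫ ε.right = 𝟙 _)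
  (hA : ∀ x, IsFrobPushout p (f.stalkMap x).hom (algStalk A x) (secStalk r x))

include hr hA in
-- On each stalk the ideal is generated by differences killed by Frobenius, and sections are
-- determined by their germs.
theorem augIdeal_pow_eq_zero [IsOfChar p X] (U : X.Opens) (z : augIdeal ε (op U)) :
    (z : A.right.obj.obj (op U)) ^ p = 0 := by
  refine section_ext_of_germAt A.right fun x hx => ?_
  have hp : (p : stalkRing A.right x) = 0 := by
    rw [← map_natCast (algStalk A x), natCast_stalk_eq_zero, map_zero]
  rw [map_pow, map_zero]
  exact (hA x).pow_eq_zero (augStalk ε x) (augStalk_comp_algStalk ε x)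
    (augStalk_comp_secStalk ε r hr x) hp
    (augGerm ε U x hx z).2

include hr hA in
-- The composite of `κ` (from `τ` of the stalk to the stalk of `τ`), the stalk of `φ`, and `θ` (from
-- the stalk of `Gr` to `Gr` of the stalk) is injective by the ring-level result. As `κ` is
-- surjective, the middle map is injective, and neither `κ` nor `θ` has to be shown to be an
-- isomorphism.
theorem stalkHom_injective [IsOfChar p X] [Smooth f]
    {φ : tauSheaf p (conormal ε) ⟶ grSheaf ε}
    (hφ : ∀ (U : X.Opens) (z : augIdeal ε (op U)),
      secHom φ U (tauι p (conormal ε) U (conormalMk ε U z)) = grMkOne ε U z) (x : X) :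
    Function.Injective (stalkHom φ.right x) := by
  obtain ⟨q, hq1, hq2, hq3⟩ := exists_stalk_conormalMk ε x
  obtain ⟨c, hT⟩ := Tau.isTruncatedGraded p (X.presheaf.stalk x) (modStalk (conormal ε) x)
  obtain ⟨κ, hκ, hκ1, hκ2⟩ := exists_tau_stalk p (conormal ε) x
  obtain ⟨θ, hθ1, hθ2⟩ := exists_grSheaf_stalk ε x
  have hη : Function.Injective (θ.comp ((stalkHom φ.right x).comp κ)) := by
    refine injective_of_isTruncatedGraded (hA x) (stalkMap_formallySmooth f x)
      (natCast_stalk_eq_zero p X x) (augStalk_comp_algStalk ε x)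
      (augStalk_comp_secStalk ε r hr x) q hq2 hT _ (fun s => ?_) fun m => ?_
    · rw [RingHom.comp_apply, RingHom.comp_apply, hκ1, stalkHom_right_algStalk, hθ1]
    · obtain ⟨z, rfl⟩ := hq3 m
      obtain ⟨U, hx, z, rfl⟩ := exists_augGerm_eq ε x z
      have hz : (augGerm ε U x hx z : stalkRing A.right x) ∈ RingHom.ker (augStalk ε x) ^ 1 :=
        (pow_one (RingHom.ker (augStalk ε x))).symm ▸ (augGerm ε U x hx z).2
      refine ⟨augGerm ε U x hx z, hz, rfl, ?_⟩
      rw [hq1]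
      refine Eq.trans (congrArg (fun t => θ (stalkHom φ.right x t)) (hκ2 U hx _)) ?_
      refine Eq.trans (congrArg θ ((stalkHom_right_germAt φ U x hx _).trans
        (congrArg _ (hφ U z)))) (hθ2 U hx z hz)
  intro s t hst
  obtain ⟨s, rfl⟩ := hκ s
  obtain ⟨t, rfl⟩ := hκ t
  exact congrArg κ (hη (congrArg θ hst))

end comparisonIso

theorem diagSection_eq_diffSection {X Y : Scheme.{u}} (g : X ⟶ Y)
    (r : X.sheaf ⟶ (pullPush g).right) (hr : r ≫ (counitAlgebra g).right = 𝟙 _) (V : Y.Opens)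
    (s : Γ(X, g ⁻¹ᵁ V)) (h : sectionRight g V s = r.hom.app (op (g ⁻¹ᵁ V)) s) :
    diagSection g V s = diffSection (counitAlgebra g) r hr (g ⁻¹ᵁ V) s :=
  Subtype.ext (congrArg (fun t : (pullPush g).right.obj.obj (op (g ⁻¹ᵁ V)) =>
    t - sectionLeft g (g ⁻¹ᵁ V) s) h)

end

end FrobDiff

theorem proposition3p2 (p : ℕ) [Fact p.Prime] {X Y : Scheme.{u}} [IsOfChar p Y] [IsIntegral X]
    (f : X ⟶ Y) [Smooth f] :
    -- `I / I² ≅ Ω_f` as `𝒪_X`-modules, with `1 ⊗ s - s ⊗ 1` corresponding to `ds`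
    (∃ e : conormal (frobCounit p f) ≅ Omega f,
      ∀ (V : (frobeniusTwist p f).Opens) (s : Γ(X, relativeFrobenius p f ⁻¹ᵁ V)),
        e.hom.app (relativeFrobenius p f ⁻¹ᵁ V)
          (conormalMk (frobCounit p f) _ (diagSection (relativeFrobenius p f) V s)) =
        omegaD f (relativeFrobenius p f ⁻¹ᵁ V) s) ∧
    -- `τ(I / I²) ≅ Gr(F^* F_* 𝒪_X)` as `𝒪_X`-algebras, the identity of `I / I²` in degree one,
    -- and compatible with the gradings
    (∃ φ : tauSheaf p (conormal (frobCounit p f)) ≅ grSheaf (frobCounit p f),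
      (∀ (U : X.Opens) (z : augIdeal (frobCounit p f) (op U)),
        φ.hom.right.hom.app (op U)
          (tauι p (conormal (frobCounit p f)) U (conormalMk (frobCounit p f) U z)) =
        grMkOne (frobCounit p f) U z) ∧
      (∀ (k : ℕ) (U : X.Opens)
        (t : (tauSheaf p (conormal (frobCounit p f))).right.obj.obj (op U)),
        φ.hom.right.hom.app (op U) t ∈ grPiece (frobCounit p f) k U ↔
          t ∈ tauPiece p (conormal (frobCounit p f)) k U)) := by
  obtain ⟨r, hr, hrs, hA⟩ := exists_right_relativeFrobenius p f
  have hX := IsOfChar.of_hom p f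
  have hA' (x : X) : IsFrobPushout p (f.stalkMap x).hom
    (algStalk (pullPush (relativeFrobenius p f)) x) (secStalk r x) := hA x
  constructor
  · obtain ⟨ψ, hψ, hψd⟩ := exists_omega_iso_conormal (frobCounit p f) r hr f hA'
    -- The universal property of differentials yields a map out of `Ω_f`; the isomorphism required
    -- is its inverse.
    refine ⟨(asIso ψ).symm, fun V s => ?_⟩
    rw [diagSection_eq_diffSection (relativeFrobenius p f) r hr V s (hrs V s)]
    refine (congrArg ((inv ψ).app (relativeFrobenius p f ⁻¹ᵁ V)) (hψd _ s)).symm.trans ?_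
    exact congrArg (fun q => q.app (relativeFrobenius p f ⁻¹ᵁ V) (omegaD f _ s))
      (IsIso.hom_inv_id ψ)
  · obtain ⟨φ, hφ⟩ := exists_tauSheaf_to_grSheaf p (frobCounit p f)
      (augIdeal_pow_eq_zero f (frobCounit p f) r hr hA')
    have : IsIso φ := isIso_of_stalkHom_bijective φ fun x =>
      ⟨stalkHom_injective f (frobCounit p f) r hr hA' hφ x, stalkHom_surjective hφ x⟩
    exact ⟨asIso φ, hφ, mem_grPiece_iff_of_isIso hφ⟩
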